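/- Let $\mathcal A$ be an arrangement of $d$ lines in the Euclidean plane $\mathbb R^2$ that is \emph{strongly generic}: no two lines are parallel, no two are perpendicular, and no three have a common point. Let $G=\prod_{i=1}^d L_i$ be a product of polynomials of degree one defining the lines. The \emph{vertices} of $\mathcal A$ are the intersection points of pairs of its lines. At each vertex $v$ the two lines through $v$ bound two open cones (pairs of opposite sectors); near $v$, $G$ is positive on one of them and negative on the other. A \emph{type of resolution} $\sigma$ chooses at each vertex, independently, one of the two cones, the \emph{merging} cone; the other one, $\mathcal C_v$, is the \emph{persistent} cone. The \emph{dual persistent cone} $\mathcal C_v^\perp$ is the union of all lines through $v$ that are orthogonal to no line of the closure of $\mathcal C_v$; it is the cone with the same axis as $\mathcal C_v$ bounded by the perpendiculars at $v$ to the two lines of $\mathcal A$ through $v$. An \emph{altitude} is a segment from a vertex $v$ to a point of a line of $\mathcal A$ not containing $v$ that is perpendicular to this line; it is \emph{admissible} with respect to $\sigma$ if it lies in $\mathcal C_v^\perp$. Two distinct vertices $v,w$ \emph{see each other} with respect to $\sigma$ if $w\in\mathcal C_v^\perp$ and $v\in\mathcal C_w^\perp$. A \emph{small resolution} of $\mathcal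 A$ of type $\sigma$ is a real curve $\mathcal R=\{F=0\}$, where $F$ is a real polynomial of degree at most $d$ whose coefficients are sufficiently close to those of $G$, such that at each vertex $v$ the two sectors of the merging cone are glued together in $\mathcal R$, i.e. the set of points of a small disc about $v$ at which $F$ has the sign that $G$ has on the merging cone near $v$ is connected. A \emph{real diameter} of $\mathcal R$ is a segment whose endpoints are two distinct smooth real points of $\mathcal R$ and which is perpendicular to the tangent lines of $\mathcal R$ at both endpoints. Then for every small resolution $\mathcal R$ of $\mathcal A$, of any type $\sigma$, the number of real diameters of $\mathcal R$ is at least $$\binom d2+2a+4s,$$ where $a$ is the number of altitudes admissible with respect to $\sigma$ and $s$ is the number of unordered pairs of distinct vertices that see each other with respect to $\sigma$. Precisely: there is $r_0>0$, depending only on $\mathcal A$ and $G$, such that for every radius $r\in(0,r_0)$ there is $\delta>0$ such that the inequality holds for every type $\sigma$ and every real polynomial $F$ of degree at most $d$ whose coefficients differ by less than $\delta$ from those of $G$ and which realizes $\sigma$ in the discs of radius $r$ about the vertices. -/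

import Mathlib

open scoped Topology

noncomputable section

/-- The Euclidean plane. -/
abbrev Plane := EuclideanSpace ℝ (Fin 2)

/-- The value at a point of the plane of a real polynomial in two variables. -/
def polyVal (F : MvPolynomial (Fin 2) ℝ) (x : Plane) : ℝ :=
  MvPolynomial.eval (fun i => x i) F

/-- The gradient of a real polynomial in two variables at a point of the plane. -/
def polyGrad (F : MvPolynomial (Fin 2) ℝ) (x : Plane) : Plane :=
  !₂[polyVal (MvPolynomial.pderiv 0 F) x, polyVal (MvPolynomial.pderiv 1 F) x]

/-- `p` is a smooth point of the real curve `F = 0`. -/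
def IsSmoothPoint (F : MvPolynomial (Fin 2) ℝ) (p : Plane) : Prop :=
  polyVal F p = 0 ∧ polyGrad F p ≠ 0

/-- The tangent line to the curve `F = 0` at a smooth point `p`. -/
def tangentLineAt (F : MvPolynomial (Fin 2) ℝ) (p : Plane) : Set Plane :=
  {x | inner ℝ (polyGrad F p) (x - p) = 0}

/-- The segment from `p` to `q` is a real diameter of the curve `F = 0`: its endpoints are distinct
real points of the curve, and it is perpendicular to the tangent lines at both of them. -/
def IsDiameter (F : MvPolynomial (Fin 2) ℝ) (p q : Plane) : Prop :=
  p ≠ q ∧ IsSmoothPoint F p ∧ IsSmoothPoint F q ∧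
    (∀ x ∈ tangentLineAt F p, inner ℝ (q - p) (x - p) = 0) ∧
    (∀ x ∈ tangentLineAt F q, inner ℝ (q - p) (x - q) = 0)

/-- The set of real diameters of the curve `F = 0`, as unordered pairs of endpoints. -/
def diameters (F : MvPolynomial (Fin 2) ℝ) : Set (Sym2 Plane) :=
  {s | ∃ p q, s = s(p, q) ∧ IsDiameter F p q}

/-- An arrangement of `d` lines in the plane; the `i`-th line has the equation
`⟪normal i, x⟫ = level i`. -/
structure LineArrangement (d : ℕ) where
  normal : Fin d → Plane
  level : Fin d → ℝ
  normal_ne_zero : ∀ i, normal i ≠ 0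

namespace LineArrangement

variable {d : ℕ} (A : LineArrangement d)

/-- The `i`-th line of the arrangement. -/
def line (i : Fin d) : Set Plane := {x | inner ℝ (A.normal i) x = A.level i}

/-- No two lines are parallel, no three lines have a common point, no two are perpendicular. -/
structure StronglyGeneric : Prop where
  not_parallel : ∀ i j, i ≠ j → LinearIndependent ℝ ![A.normal i, A.normal j]
  not_concurrent : ∀ i j k, i ≠ j → i ≠ k → j ≠ k → A.line i ∩ A.line j ∩ A.line k = ∅
  not_perpendicular : ∀ i j, i ≠ j → inner ℝ (A.normal i) (A.normal j) ≠ 0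

/-- The vertices of the arrangement. -/
def vertices : Set Plane := {v | ∃ i j, i ≠ j ∧ v ∈ A.line i ∧ v ∈ A.line j}

/-- The polynomial of degree one defining the `i`-th line. -/
def linePoly (i : Fin d) : MvPolynomial (Fin 2) ℝ :=
  MvPolynomial.C (A.normal i 0) * MvPolynomial.X 0
    + MvPolynomial.C (A.normal i 1) * MvPolynomial.X 1 - MvPolynomial.C (A.level i)

/-- The product of the linear equations, whose zero locus is the arrangement. -/
def poly : MvPolynomial (Fin 2) ℝ := ∏ i, A.linePoly i

/-- For a vertex `v` and a sign `s`: the open cone with apex `v`, bounded by the two lines of the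
arrangement through `v`, that consists of the rays on which the product of the linear equations
has the sign `s` near `v`. The two cones at `v` are those with `s = 1` and `s = -1`. -/
def signCone (s : ℤˣ) (v : Plane) : Set Plane :=
  {x | ∀ᶠ t : ℝ in 𝓝[>] 0, 0 < ((s : ℤ) : ℝ) * polyVal A.poly (v + t • (x - v))}

/-- A type of small resolution is given by a sign `σ v` at each vertex `v` (the values elsewhere
play no role). The merging cone at `v` is the one in which the product has the sign `σ v`. -/
def mergingCone (σ : Plane → ℤˣ) (v : Plane) : Set Plane := A.signCone (σ v) v

/-- The persistent cone at `v` is the other cone at `v`. -/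
def persistentCone (σ : Plane → ℤˣ) (v : Plane) : Set Plane := A.signCone (-σ v) v

/-- The dual persistent cone at `v`: the union of the lines through `v` that are orthogonal to some
line through `v` in the merging cone; equivalently, that are orthogonal to no line of the closed
persistent cone. It is open away from `v`, and it is bounded by the perpendiculars at `v` to the two
lines of the arrangement through `v`. For a persistent cone with opening angle `θ` it has the same
axis and the opening angle `π - θ`, so it is the double of the (open) dual cone, in the sense of
convex geometry, of a persistent sector. -/
def dualPersistentCone (σ : Plane → ℤˣ) (v : Plane) : Set Plane :=
  {x | ∃ y ∈ A.mergingCone σ v, inner ℝ (x - v) (y - v) = 0}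

/-- The segment from `v` to `f` is an altitude: `v` is a vertex, `f` is a point on a line of the
arrangement not containing `v`, and the segment is perpendicular to that line. -/
def IsAltitude (v f : Plane) : Prop :=
  v ∈ A.vertices ∧ ∃ k, v ∉ A.line k ∧ f ∈ A.line k ∧ ∀ x ∈ A.line k, inner ℝ (f - v) (x - f) = 0

/-- The altitudes that lie in the dual persistent cone at the vertex where they start. -/
def admissibleAltitudes (σ : Plane → ℤˣ) : Set (Plane × Plane) :=
  {α | A.IsAltitude α.1 α.2 ∧ segment ℝ α.1 α.2 ⊆ A.dualPersistentCone σ α.1}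

/-- The unordered pairs of distinct vertices that see each other. -/
def seeingPairs (σ : Plane → ℤˣ) : Set (Sym2 Plane) :=
  {s | ∃ v w, s = s(v, w) ∧ v ≠ w ∧ v ∈ A.vertices ∧ w ∈ A.vertices ∧
    w ∈ A.dualPersistentCone σ v ∧ v ∈ A.dualPersistentCone σ w}

/-- The curve `F = 0` resolves every vertex `v` in the way prescribed by `σ v`, as seen in the disc
of radius `r` about `v`: the two opposite local components of the complement on which the product of
the linear equations has the sign `σ v` are glued together to one component. -/
def Realizes (σ : Plane → ℤˣ) (r : ℝ) (F : MvPolynomial (Fin 2) ℝ) : Prop :=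
  ∀ v ∈ A.vertices, IsConnected {x ∈ Metric.ball v r | 0 < ((σ v : ℤ) : ℝ) * polyVal F x}

/-- The curve `F = 0` is a deformation of the arrangement of the same degree and of size less
than `δ`: the coefficients of `F` differ by less than `δ` from those of the product. -/
def IsDeformation (δ : ℝ) (F : MvPolynomial (Fin 2) ℝ) : Prop :=
  F.totalDegree ≤ d ∧ ∀ m, |F.coeff m - A.poly.coeff m| < δ

end LineArrangement

end

noncomputable section

open Filter

lemma inner_plane (x y : Plane) : inner ℝ x y = x 0 * y 0 + x 1 * y 1 := by
  simp [PiLp.inner_apply, Fin.sum_univ_two, mul_comm]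

/-- The Hessian of a real polynomial in two variables, as the derivative of its gradient. -/
def polyHess (F : MvPolynomial (Fin 2) ℝ) (x : Plane) : Plane →L[ℝ] Plane :=
  (innerSL ℝ (polyGrad (MvPolynomial.pderiv 0 F) x)).smulRight (!₂[1, 0] : Plane) +
    (innerSL ℝ (polyGrad (MvPolynomial.pderiv 1 F) x)).smulRight (!₂[0, 1] : Plane)

lemma polyGrad_eq (F : MvPolynomial (Fin 2) ℝ) (x : Plane) :
    polyGrad F x = polyVal (MvPolynomial.pderiv 0 F) x • (!₂[1, 0] : Plane)
      + polyVal (MvPolynomial.pderiv 1 F) x • (!₂[0, 1] : Plane) := by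
  ext i; fin_cases i <;> simp [polyGrad]

lemma polyVal_add (F G : MvPolynomial (Fin 2) ℝ) (x : Plane) :
    polyVal (F + G) x = polyVal F x + polyVal G x := by simp [polyVal]

lemma polyVal_sub (F G : MvPolynomial (Fin 2) ℝ) (x : Plane) :
    polyVal (F - G) x = polyVal F x - polyVal G x := by simp [polyVal]

lemma polyVal_mul (F G : MvPolynomial (Fin 2) ℝ) (x : Plane) :
    polyVal (F * G) x = polyVal F x * polyVal G x := by simp [polyVal]

lemma polyGrad_add (F G : MvPolynomial (Fin 2) ℝ) (x : Plane) :
    polyGrad (F + G) x = polyGrad F x + polyGrad G x := by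
  simp only [polyGrad_eq, map_add, polyVal_add]; module

lemma polyGrad_sub (F G : MvPolynomial (Fin 2) ℝ) (x : Plane) :
    polyGrad (F - G) x = polyGrad F x - polyGrad G x := by
  simp only [polyGrad_eq, map_sub, polyVal_sub]; module

lemma polyGrad_mul (F G : MvPolynomial (Fin 2) ℝ) (x : Plane) :
    polyGrad (F * G) x = polyVal F x • polyGrad G x + polyVal G x • polyGrad F x := by
  simp only [polyGrad_eq, MvPolynomial.pderiv_mul, polyVal_add, polyVal_mul]; module

lemma hasFDerivAt_polyVal (F : MvPolynomial (Fin 2) ℝ) (x : Plane) :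
    HasFDerivAt (polyVal F) (innerSL ℝ (polyGrad F x)) x := by
  induction F using MvPolynomial.induction_on with
  | C a =>
    have h1 : polyVal (MvPolynomial.C a) = fun _ => a := by ext; simp [polyVal]
    have h2 : polyGrad (MvPolynomial.C a) x = 0 := by
      ext i; fin_cases i <;> simp [polyGrad, polyVal]
    rw [h1, h2, map_zero]
    exact hasFDerivAt_const a x
  | add p q hp hq =>
    have h1 : polyVal (p + q) = polyVal p + polyVal q := by ext; simp [polyVal]
    rw [h1, polyGrad_add, map_add]
    exact hp.add hq
  | mul_X p i hp =>
    have h0 : HasFDerivAt (fun y : Plane => y i) (innerSL ℝ (polyGrad (MvPolynomial.X i) x)) x := by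
      have h2 : innerSL ℝ (polyGrad (MvPolynomial.X i) x)
          = (EuclideanSpace.proj i : Plane →L[ℝ] ℝ) := by
        ext y
        fin_cases i <;> simp [inner_plane, polyGrad, polyVal, MvPolynomial.pderiv_X]
      rw [h2]
      exact (EuclideanSpace.proj i : Plane →L[ℝ] ℝ).hasFDerivAt
    have h1 : polyVal (p * MvPolynomial.X i) = fun y => polyVal p y * y i := by ext; simp [polyVal]
    have h2 : polyVal (MvPolynomial.X i) x = x i := by simp [polyVal]
    rw [h1, polyGrad_mul, map_add, map_smul, map_smul, h2]
    exact hp.mul h0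

lemma hasFDerivAt_polyGrad (F : MvPolynomial (Fin 2) ℝ) (x : Plane) :
    HasFDerivAt (polyGrad F) (polyHess F x) x := by
  have h : polyGrad F = fun x => polyVal (MvPolynomial.pderiv 0 F) x • (!₂[1, 0] : Plane)
      + polyVal (MvPolynomial.pderiv 1 F) x • (!₂[0, 1] : Plane) := funext (polyGrad_eq F)
  rw [h]
  exact ((hasFDerivAt_polyVal _ x).smul_const _).add ((hasFDerivAt_polyVal _ x).smul_const _)

@[fun_prop]
lemma continuous_polyVal (F : MvPolynomial (Fin 2) ℝ) : Continuous (polyVal F) :=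
  continuous_iff_continuousAt.2 fun x => (hasFDerivAt_polyVal F x).continuousAt

@[fun_prop]
lemma continuous_polyGrad (F : MvPolynomial (Fin 2) ℝ) : Continuous (polyGrad F) :=
  continuous_iff_continuousAt.2 fun x => (hasFDerivAt_polyGrad F x).continuousAt

lemma continuous_polyHess (F : MvPolynomial (Fin 2) ℝ) : Continuous (polyHess F) := by
  have h : ∀ (i : Fin 2) (e : Plane), Continuous fun x =>
      (innerSL ℝ (polyGrad (MvPolynomial.pderiv i F) x)).smulRight e := fun i e =>
    (ContinuousLinearMap.smulRightL ℝ Plane Plane).flip e |>.continuous.comp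
      ((innerSL ℝ).continuous.comp (continuous_polyGrad _))
  exact (h 0 _).add (h 1 _)

/-- A polynomial of degree at most `d` whose coefficients are at most `δ` in absolute value. -/
def HasSmallCoeffs (d : ℕ) (δ : ℝ) (P : MvPolynomial (Fin 2) ℝ) : Prop :=
  P.totalDegree ≤ d ∧ ∀ m, |P.coeff m| ≤ δ

lemma HasSmallCoeffs.pderiv {d : ℕ} {δ : ℝ} {P : MvPolynomial (Fin 2) ℝ}
    (h : HasSmallCoeffs d δ P) (i : Fin 2) :
    HasSmallCoeffs d (δ * (d + 1)) (MvPolynomial.pderiv i P) := by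
  have hδ : 0 ≤ δ := (abs_nonneg _).trans (h.2 0)
  have key : ∀ m : Fin 2 →₀ ℕ, (MvPolynomial.pderiv i P).coeff m ≠ 0 → m.degree + 1 ≤ d := by
    intro m hm
    rw [MvPolynomial.coeff_pderiv] at hm
    have h1 : m + Finsupp.single i 1 ∈ P.support := by
      rw [MvPolynomial.mem_support_iff]
      exact left_ne_zero_of_mul hm
    have h2 := (MvPolynomial.le_totalDegree h1).trans h.1
    have h3 : (m + Finsupp.single i 1).sum (fun _ e => e) = m.degree + 1 := by
      calc _ = (m + Finsupp.single i 1).degree := rfl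
        _ = _ := by rw [map_add, Finsupp.degree_single]
    omega
  refine ⟨?_, fun m => ?_⟩
  · refine Finset.sup_le fun m hm => ?_
    have := key m (MvPolynomial.mem_support_iff.1 hm)
    change m.degree ≤ d
    omega
  · by_cases hm : (MvPolynomial.pderiv i P).coeff m = 0
    · rw [hm, abs_zero]; positivity
    have h1 := key m hm
    rw [MvPolynomial.coeff_pderiv, abs_mul]
    have h2 : m i ≤ d := (Finsupp.le_degree i m).trans (by omega)
    have h3 : |(m i : ℝ) + 1| ≤ d + 1 := by
      rw [abs_of_nonneg (by positivity)]
      have : (m i : ℝ) ≤ d := by exact_mod_cast h2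
      linarith
    exact mul_le_mul (h.2 _) h3 (abs_nonneg _) hδ

lemma exists_bound_of_hasSmallCoeffs (d : ℕ) (R : ℝ) : ∃ C : ℝ, 0 < C ∧
    ∀ (δ : ℝ) (P : MvPolynomial (Fin 2) ℝ), HasSmallCoeffs d δ P →
      ∀ x : Plane, ‖x‖ ≤ R → |polyVal P x| ≤ C * δ := by
  classical
  have hfin := Finsupp.finite_of_degree_le (σ := Fin 2) d
  refine ⟨hfin.toFinset.card * (max 1 R) ^ d + 1, by positivity, fun δ P hP x hx => ?_⟩
  have hδ : 0 ≤ δ := (abs_nonneg _).trans (hP.2 0)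
  have hsub : P.support ⊆ hfin.toFinset := by
    intro m hm
    have := (MvPolynomial.le_totalDegree hm).trans hP.1
    simpa [Finsupp.degree_eq_sum, Finsupp.sum_fintype] using this
  have hterm : ∀ m ∈ P.support, |P.coeff m * ∏ i ∈ m.support, x i ^ m i| ≤ δ * (max 1 R) ^ d := by
    intro m hm
    have hdeg := (MvPolynomial.le_totalDegree hm).trans hP.1
    rw [abs_mul, Finset.abs_prod]
    refine mul_le_mul (hP.2 m) ?_ (Finset.prod_nonneg fun _ _ => abs_nonneg _) hδ
    calc ∏ i ∈ m.support, |x i ^ m i| ≤ ∏ i ∈ m.support, (max 1 R) ^ m i := by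
          refine Finset.prod_le_prod (fun _ _ => abs_nonneg _) fun i _ => ?_
          rw [abs_pow]
          refine pow_le_pow_left₀ (abs_nonneg _) ?_ _
          exact ((PiLp.norm_apply_le x i).trans hx).trans (le_max_right _ _)
      _ = (max 1 R) ^ (m.sum fun _ e => e) := by rw [Finset.prod_pow_eq_pow_sum]; rfl
      _ ≤ (max 1 R) ^ d := pow_le_pow_right₀ (le_max_left _ _) hdeg
  calc |polyVal P x| ≤ ∑ m ∈ P.support, |P.coeff m * ∏ i ∈ m.support, x i ^ m i| := by
        rw [polyVal, MvPolynomial.eval_eq]; exact Finset.abs_sum_le_sum_abs _ _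
    _ ≤ ∑ m ∈ P.support, δ * (max 1 R) ^ d := Finset.sum_le_sum hterm
    _ ≤ ∑ m ∈ hfin.toFinset, δ * (max 1 R) ^ d :=
        Finset.sum_le_sum_of_subset_of_nonneg hsub fun _ _ _ => by positivity
    _ = hfin.toFinset.card * (max 1 R) ^ d * δ := by rw [Finset.sum_const, nsmul_eq_mul]; ring
    _ ≤ _ := by nlinarith

namespace LineArrangement

variable {d : ℕ} (A : LineArrangement d)

/-- The filter of polynomials of degree at most `d` that tend to the product of the linear
equations of an arrangement. -/
def deformations : Filter (MvPolynomial (Fin 2) ℝ) :=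
  ⨅ δ ∈ Set.Ioi (0 : ℝ), 𝓟 {F | A.IsDeformation δ F}

lemma eventually_deformations {p : MvPolynomial (Fin 2) ℝ → Prop} :
    (∀ᶠ F in A.deformations, p F) ↔ ∃ δ > 0, ∀ F, A.IsDeformation δ F → p F := by
  have h : A.deformations.HasBasis (fun δ => δ ∈ Set.Ioi (0 : ℝ)) fun δ => {F | A.IsDeformation δ F} := by
    refine hasBasis_biInf_principal ?_ ⟨1, Set.mem_Ioi.2 one_pos⟩
    intro a ha b hb
    refine ⟨min a b, Set.mem_Ioi.2 (lt_min ha hb), fun F hF => ?_, fun F hF => ?_⟩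
    · exact ⟨hF.1, fun m => (hF.2 m).trans_le (min_le_left _ _)⟩
    · exact ⟨hF.1, fun m => (hF.2 m).trans_le (min_le_right _ _)⟩
  rw [h.eventually_iff]
  simp

lemma totalDegree_poly : A.poly.totalDegree ≤ d := by
  refine (MvPolynomial.totalDegree_finsetProd _ _).trans ?_
  have : ∀ i, (A.linePoly i).totalDegree ≤ 1 := by
    intro i
    have hX : ∀ (a : ℝ) (j : Fin 2),
        (MvPolynomial.C a * MvPolynomial.X j : MvPolynomial (Fin 2) ℝ).totalDegree ≤ 1 := by
      intro a j
      refine (MvPolynomial.totalDegree_mul _ _).trans ?_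
      simp
    refine (MvPolynomial.totalDegree_sub _ _).trans (max_le ?_ (by simp))
    exact (MvPolynomial.totalDegree_add _ _).trans (max_le (hX _ _) (hX _ _))
  exact (Finset.sum_le_sum fun i _ => this i).trans (by simp)

lemma IsDeformation.hasSmallCoeffs {δ : ℝ} {F : MvPolynomial (Fin 2) ℝ} (h : A.IsDeformation δ F) :
    HasSmallCoeffs d δ (F - A.poly) := by
  refine ⟨(MvPolynomial.totalDegree_sub _ _).trans (max_le h.1 A.totalDegree_poly), fun m => ?_⟩
  rw [MvPolynomial.coeff_sub]
  exact (h.2 m).le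

lemma _root_.norm_polyGrad_le (F : MvPolynomial (Fin 2) ℝ) (x : Plane) : ‖polyGrad F x‖ ≤
    |polyVal (MvPolynomial.pderiv 0 F) x| + |polyVal (MvPolynomial.pderiv 1 F) x| := by
  rw [polyGrad_eq]
  refine (norm_add_le _ _).trans ?_
  rw [norm_smul, norm_smul]
  simp [EuclideanSpace.norm_eq]

lemma _root_.norm_polyHess_le (F : MvPolynomial (Fin 2) ℝ) (x : Plane) : ‖polyHess F x‖ ≤
    ‖polyGrad (MvPolynomial.pderiv 0 F) x‖ + ‖polyGrad (MvPolynomial.pderiv 1 F) x‖ := by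
  refine (norm_add_le _ _).trans ?_
  rw [ContinuousLinearMap.norm_smulRight_apply, ContinuousLinearMap.norm_smulRight_apply,
    innerSL_apply_norm, innerSL_apply_norm]
  simp [EuclideanSpace.norm_eq]

lemma _root_.polyHess_sub (F G : MvPolynomial (Fin 2) ℝ) (x : Plane) :
    polyHess (F - G) x = polyHess F x - polyHess G x := by
  ext1 u
  simp only [polyHess, map_sub, polyGrad_sub, add_apply,
    ContinuousLinearMap.smulRight_apply, sub_apply]
  module

lemma eventually_close (R : ℝ) {ε : ℝ} (hε : 0 < ε) : ∀ᶠ F in A.deformations, ∀ x : Plane, ‖x‖ ≤ R →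
    |polyVal F x - polyVal A.poly x| ≤ ε ∧ ‖polyGrad F x - polyGrad A.poly x‖ ≤ ε ∧
      ‖polyHess F x - polyHess A.poly x‖ ≤ ε := by
  obtain ⟨C, hC, hb⟩ := exists_bound_of_hasSmallCoeffs d R
  rw [eventually_deformations]
  set D : ℝ := d + 1 with hD
  have hD1 : 1 ≤ D := by rw [hD]; linarith [(Nat.cast_nonneg d : (0 : ℝ) ≤ d)]
  have hpos : 0 < 4 * C * D ^ 2 := by positivity
  refine ⟨ε / (4 * C * D ^ 2), by positivity, fun F hF x hx => ?_⟩
  have hs := IsDeformation.hasSmallCoeffs A hF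
  have he : C * (ε / (4 * C * D ^ 2) * D * D) = ε / 4 := by field_simp
  have hδ : 0 ≤ ε / (4 * C * D ^ 2) := by positivity
  have h2 : ∀ i j, |polyVal (MvPolynomial.pderiv i (MvPolynomial.pderiv j (F - A.poly))) x| ≤ ε / 4 :=
    fun i j => (hb _ _ ((hs.pderiv j).pderiv i) x hx).trans he.le
  have h1 : ∀ j, |polyVal (MvPolynomial.pderiv j (F - A.poly)) x| ≤ ε / 4 :=
    fun j => (hb _ _ (hs.pderiv j) x hx).trans (he ▸ mul_le_mul_of_nonneg_left
      (le_mul_of_one_le_right (by positivity) hD1) hC.le)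
  have h0 : |polyVal (F - A.poly) x| ≤ ε / 4 := by
    refine (hb _ _ hs x hx).trans (he ▸ mul_le_mul_of_nonneg_left ?_ hC.le)
    exact (le_mul_of_one_le_right (by positivity) hD1).trans
      (le_mul_of_one_le_right (by positivity) hD1)
  refine ⟨?_, ?_, ?_⟩
  · rw [← polyVal_sub]; linarith
  · rw [← polyGrad_sub]
    exact (norm_polyGrad_le _ _).trans (by linarith [h1 0, h1 1])
  · rw [← polyHess_sub]
    refine (norm_polyHess_le _ _).trans ?_
    linarith [norm_polyGrad_le (MvPolynomial.pderiv 0 (F - A.poly)) x,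
      norm_polyGrad_le (MvPolynomial.pderiv 1 (F - A.poly)) x, h2 0 0, h2 0 1, h2 1 0, h2 1 1]

end LineArrangement

/-- `P` is an inverse, near the point `v`, of the gradient map of `F`, defined on the disc of radius
`R` about the origin and with derivative within `ε` of `B`. -/
structure IsGradInverse (F : MvPolynomial (Fin 2) ℝ) (v : Plane) (ρ R ε : ℝ)
    (B : Plane →L[ℝ] Plane) (P : Plane → Plane) : Prop where
  mem : ∀ ξ, ‖ξ‖ < R → P ξ ∈ Metric.ball v ρ
  grad : ∀ ξ, ‖ξ‖ < R → polyGrad F (P ξ) = ξ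
  leftInv : ∀ x ∈ Metric.ball v ρ, P (polyGrad F x) = x
  deriv : ∀ ξ, ‖ξ‖ < R → ∃ P', HasFDerivAt P P' ξ ∧ ‖P' - B‖ ≤ ε

lemma exists_equiv_of_close (H : Plane ≃L[ℝ] Plane) {c : ℝ}
    (hcN : c * ‖(H.symm : Plane →L[ℝ] Plane)‖ ≤ 1 / 2) {T : Plane →L[ℝ] Plane}
    (hT : ‖T - H‖ ≤ c) : ∃ T' : Plane ≃L[ℝ] Plane, (T' : Plane →L[ℝ] Plane) = T ∧
      ‖(T'.symm : Plane →L[ℝ] Plane) - H.symm‖ ≤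
        2 * ‖(H.symm : Plane →L[ℝ] Plane)‖ ^ 2 * c := by
  set N := ‖(H.symm : Plane →L[ℝ] Plane)‖ with hN
  have hN0 : 0 ≤ N := norm_nonneg _
  have hc : 0 ≤ c := (norm_nonneg _).trans hT
  have hHs : ∀ u, ‖H.symm u‖ ≤ N * ‖u‖ := fun u => (H.symm : Plane →L[ℝ] Plane).le_opNorm u
  have hTu : ∀ u, ‖T u - H u‖ ≤ c * ‖u‖ := fun u => by
    simpa using (T - H).le_of_opNorm_le hT u
  have hbound : ∀ u, ‖u‖ ≤ 2 * N * ‖T u‖ := fun u => by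
    have h1 : ‖u‖ ≤ N * ‖H u‖ := by simpa using hHs (H u)
    have h2 : ‖H u‖ ≤ ‖T u‖ + c * ‖u‖ := by
      have := norm_sub_norm_le (H u) (T u)
      rw [norm_sub_rev] at this
      linarith [hTu u]
    nlinarith [norm_nonneg u]
  have hinj : Function.Injective (T : Plane →ₗ[ℝ] Plane) := by
    rw [injective_iff_map_eq_zero]
    intro u hu
    have := hbound u
    have hu' : T u = 0 := hu
    rw [hu'] at this
    simpa using this
  set T' := (LinearEquiv.ofInjectiveEndo (T : Plane →ₗ[ℝ] Plane) hinj).toContinuousLinearEquiv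
  have hT' : (T' : Plane →L[ℝ] Plane) = T := by ext1 u; rfl
  refine ⟨T', hT', ContinuousLinearMap.opNorm_le_bound _ (by positivity) fun e => ?_⟩
  set w := T'.symm e with hw
  have hTw : T w = e := by rw [← hT']; simp [hw]
  have h3 : ((T'.symm : Plane →L[ℝ] Plane) - H.symm) e = - H.symm (T w - H w) := by
    rw [map_sub, hTw]; simp [hw]
  rw [h3, norm_neg]
  have h4 := hbound w
  rw [hTw] at h4
  calc ‖H.symm (T w - H w)‖ ≤ N * (c * ‖w‖) := (hHs _).trans (by gcongr; exact hTu w)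
    _ ≤ N * (c * (2 * N * ‖e‖)) := by gcongr
    _ = 2 * N ^ 2 * c * ‖e‖ := by ring

namespace LineArrangement

variable {d : ℕ} (A : LineArrangement d)

lemma eventually_hess_close (v : Plane) {c : ℝ} (hc : 0 < c) : ∃ ρ₁ > 0, ∀ ρ, ρ ≤ ρ₁ →
    ∀ᶠ F in A.deformations, ∀ x ∈ Metric.ball v ρ, ‖polyHess F x - polyHess A.poly v‖ ≤ c := by
  obtain ⟨ρ₁, hρ₁, h1⟩ := Metric.continuousAt_iff.1
    ((continuous_polyHess A.poly).continuousAt (x := v)) (c / 2) (by positivity)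
  refine ⟨ρ₁, hρ₁, fun ρ hρ => ?_⟩
  filter_upwards [A.eventually_close (‖v‖ + ρ₁) (ε := c / 2) (by positivity)] with F hF x hx
  have hx1 : dist x v < ρ₁ := (Metric.mem_ball.1 hx).trans_le hρ
  have h2 := h1 hx1
  rw [dist_eq_norm] at h2 hx1
  have h3 : ‖x‖ ≤ ‖v‖ + ρ₁ := by
    have := norm_sub_norm_le x v
    linarith
  have := norm_add_le (polyHess F x - polyHess A.poly x) (polyHess A.poly x - polyHess A.poly v)
  rw [sub_add_sub_cancel] at this
  linarith [(hF x h3).2.2]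

lemma _root_.approximatesLinearOn_polyGrad {F : MvPolynomial (Fin 2) ℝ} {v : Plane} {ρ : ℝ} {c : NNReal}
    {T : Plane →L[ℝ] Plane} (h : ∀ x ∈ Metric.ball v ρ, ‖polyHess F x - T‖ ≤ c) :
    ApproximatesLinearOn (polyGrad F) T (Metric.ball v ρ) c := fun _ hx _ hy =>
  (convex_ball v ρ).norm_image_sub_le_of_norm_hasFDerivWithin_le'
    (fun z _ => (hasFDerivAt_polyGrad F z).hasFDerivWithinAt) h hy hx

lemma exists_isGradInverse (v : Plane) (hv : polyGrad A.poly v = 0) (H : Plane ≃L[ℝ] Plane)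
    (hH : (H : Plane →L[ℝ] Plane) = polyHess A.poly v) {ε ρ₀ : ℝ} (hε : 0 < ε) (hρ₀ : 0 < ρ₀) :
    ∃ ρ, 0 < ρ ∧ ρ ≤ ρ₀ ∧ ∃ R > 0, ∀ᶠ F in A.deformations, ∃ P,
      IsGradInverse F v ρ R ε (H.symm : Plane →L[ℝ] Plane) P := by
  set N := ‖(H.symm : Plane →L[ℝ] Plane)‖ with hN
  have hN0 : 0 < N := H.norm_symm_pos
  obtain ⟨c, hc, hcN, hcε⟩ : ∃ c : ℝ, 0 < c ∧ c * N ≤ 1 / 2 ∧ 2 * N ^ 2 * c ≤ ε := by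
    refine ⟨min (1 / (2 * N)) (ε / (2 * N ^ 2)), by positivity, ?_, ?_⟩
    · calc _ ≤ 1 / (2 * N) * N := by gcongr; exact min_le_left _ _
        _ = 1 / 2 := by field_simp
    · calc _ ≤ 2 * N ^ 2 * (ε / (2 * N ^ 2)) := by gcongr; exact min_le_right _ _
        _ = ε := by field_simp
  lift c to NNReal using hc.le
  obtain ⟨ρ₁, hρ₁, h1⟩ := A.eventually_hess_close v hc
  set ρ := min ρ₀ ρ₁
  have hρ : 0 < ρ := lt_min hρ₀ hρ₁
  have hcN' : c < N⁻¹ := by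
    rw [lt_inv_comm₀ hc hN0, lt_inv_comm₀ hN0 hc]
    by_contra! h
    have : 1 ≤ c * N := by
      calc (1 : ℝ) = N⁻¹ * N := by field_simp
        _ ≤ c * N := by gcongr
    linarith
  set R := (N⁻¹ - c) * (ρ / 2) / 2 with hR
  have hR0 : 0 < R := by have := sub_pos.2 hcN'; positivity
  refine ⟨ρ, hρ, min_le_left _ _, R, hR0, ?_⟩
  filter_upwards [h1 ρ (min_le_right _ _), A.eventually_close ‖v‖ hR0] with F hF hFv
  have hFv' : ‖polyGrad F v‖ ≤ R := by simpa [hv] using (hFv v le_rfl).2.1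
  have happ : ApproximatesLinearOn (polyGrad F) (H : Plane →L[ℝ] Plane) (Metric.ball v ρ)
      c := approximatesLinearOn_polyGrad (by rw [hH]; exact hF)
  have hc' : Subsingleton Plane ∨
      c < ‖(H.symm : Plane →L[ℝ] Plane)‖₊⁻¹ := Or.inr (by
    rw [← NNReal.coe_lt_coe]; simpa using hcN')
  set e := happ.toOpenPartialHomeomorph (polyGrad F) (Metric.ball v ρ) hc' Metric.isOpen_ball with he
  have htgt : ∀ ξ : Plane, ‖ξ‖ < R → ξ ∈ e.target := fun ξ hξ => by
    refine happ.closedBall_subset_target hc' Metric.isOpen_ball (b := v) (ε := ρ / 2) (by positivity)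
      (Metric.closedBall_subset_ball (by linarith)) ?_
    rw [Metric.mem_closedBall, dist_eq_norm]
    calc ‖ξ - polyGrad F v‖ ≤ ‖ξ‖ + ‖polyGrad F v‖ := norm_sub_le _ _
      _ ≤ R + R := by linarith
      _ = (N⁻¹ - c) * (ρ / 2) := by rw [hR]; ring
  refine ⟨e.symm, fun ξ hξ => e.map_target (htgt ξ hξ), fun ξ hξ => e.right_inv (htgt ξ hξ),
    fun x hx => e.left_inv hx, fun ξ hξ => ?_⟩
  obtain ⟨T', hT', hT'2⟩ := exists_equiv_of_close H hcN (by
    rw [hH]; exact hF _ (e.map_target (htgt ξ hξ)))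
  refine ⟨T'.symm, e.hasFDerivAt_symm (htgt ξ hξ) ?_, hT'2.trans hcε⟩
  rw [hT']
  exact hasFDerivAt_polyGrad F _

end LineArrangement

namespace IsGradInverse

variable {F : MvPolynomial (Fin 2) ℝ} {v : Plane} {ρ R ε : ℝ} {B : Plane →L[ℝ] Plane}
  {P : Plane → Plane}

lemma continuousOn (h : IsGradInverse F v ρ R ε B P) : ContinuousOn P {ξ | ‖ξ‖ < R} := fun ξ hξ =>
  (h.deriv ξ hξ).choose_spec.1.continuousAt.continuousWithinAt

lemma approx (h : IsGradInverse F v ρ R ε B P) {ξ ζ : Plane} (hξ : ‖ξ‖ < R) (hζ : ‖ζ‖ < R) :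
    ‖P ξ - P ζ - B (ξ - ζ)‖ ≤ ε * ‖ξ - ζ‖ := by
  choose! P' hP' hB using h.deriv
  refine (convex_ball (0 : Plane) R).norm_image_sub_le_of_norm_hasFDerivWithin_le' (f' := P')
    (fun z hz => (hP' z (mem_ball_zero_iff.1 hz)).hasFDerivWithinAt)
    (fun z hz => hB z (mem_ball_zero_iff.1 hz)) (mem_ball_zero_iff.2 hζ) (mem_ball_zero_iff.2 hξ)

/-- The derivative, along a line in the space of gradients, of the value of the polynomial. -/
lemma hasDerivAt_line (h : IsGradInverse F v ρ R ε B P) (ξ e : Plane) (t : ℝ)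
    (ht : ‖ξ + t • e‖ < R) : ∃ T : Plane →L[ℝ] Plane, ‖T - B‖ ≤ ε ∧
      HasDerivAt (fun t : ℝ => polyVal F (P (ξ + t • e))) (inner ℝ (ξ + t • e) (T e)) t := by
  obtain ⟨T, hT, hB⟩ := h.deriv _ ht
  refine ⟨T, hB, ?_⟩
  have h1 : HasDerivAt (fun t : ℝ => ξ + t • e) e t := by
    simpa using ((hasDerivAt_id t).smul_const e).const_add ξ
  have h2 := hT.comp_hasDerivAt t h1
  have h3 := (hasFDerivAt_polyVal F (P (ξ + t • e))).comp_hasDerivAt t h2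
  rw [h.grad _ ht] at h3
  exact h3

end IsGradInverse

/-- The determinant of two plane vectors. -/
def cross (x y : Plane) : ℝ := x 0 * y 1 - x 1 * y 0

lemma exists_smul_of_cross_eq_zero {y w : Plane} (hy : y ≠ 0) (h : cross y w = 0) :
    ∃ t : ℝ, w = t • y := by
  have hyy : y 0 * y 0 + y 1 * y 1 ≠ 0 := by
    rw [← inner_plane]; exact inner_self_ne_zero.2 hy
  unfold cross at h
  refine ⟨(y 0 * w 0 + y 1 * w 1) / (y 0 * y 0 + y 1 * y 1), ?_⟩
  ext i
  fin_cases i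
  · simp only [Fin.zero_eta, PiLp.smul_apply, smul_eq_mul]
    rw [div_mul_eq_mul_div, eq_div_iff hyy]
    linear_combination (-y 1) * h
  · simp only [Fin.mk_one, PiLp.smul_apply, smul_eq_mul]
    rw [div_mul_eq_mul_div, eq_div_iff hyy]
    linear_combination (y 0) * h

lemma cross_add_right (x y z : Plane) : cross x (y + z) = cross x y + cross x z := by
  simp [cross]; ring

lemma cross_sub_right (x y z : Plane) : cross x (y - z) = cross x y - cross x z := by
  simp [cross]; ring

lemma cross_smul_right (t : ℝ) (x y : Plane) : cross x (t • y) = t * cross x y := by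
  simp [cross]; ring

lemma cross_add_left (x y z : Plane) : cross (x + y) z = cross x z + cross y z := by
  simp [cross]; ring

lemma cross_smul_left (t : ℝ) (x y : Plane) : cross (t • x) y = t * cross x y := by
  simp [cross]; ring

lemma abs_cross_le (x y : Plane) : |cross x y| ≤ ‖x‖ * ‖y‖ := by
  have h : (cross x y) ^ 2 ≤ (‖x‖ * ‖y‖) ^ 2 := by
    rw [mul_pow, ← real_inner_self_eq_norm_sq, ← real_inner_self_eq_norm_sq, inner_plane,
      inner_plane, cross]
    nlinarith [sq_nonneg (x 0 * y 0 + x 1 * y 1)]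
  exact abs_le_of_sq_le_sq h (by positivity)

@[fun_prop]
lemma Continuous.cross {X : Type*} [TopologicalSpace X] {f g : X → Plane} (hf : Continuous f)
    (hg : Continuous g) : Continuous fun x => cross (f x) (g x) := by
  unfold _root_.cross; fun_prop

@[fun_prop]
lemma ContinuousOn.cross {X : Type*} [TopologicalSpace X] {S : Set X} {f g : X → Plane}
    (hf : ContinuousOn f S) (hg : ContinuousOn g S) :
    ContinuousOn (fun x => cross (f x) (g x)) S := by
  unfold _root_.cross; fun_prop

/-- A function that is strictly decreasing in its second variable and changes sign has a root that
depends continuously on the first variable. -/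
lemma exists_continuousOn_root {X : Type*} [TopologicalSpace X] {S : Set X} {f : X → ℝ → ℝ}
    {a b : ℝ} (hab : a ≤ b)
    (hf : ContinuousOn (fun p : X × ℝ => f p.1 p.2) (S ×ˢ Set.Icc a b))
    (hanti : ∀ x ∈ S, StrictAntiOn (f x) (Set.Icc a b)) (ha : ∀ x ∈ S, 0 ≤ f x a)
    (hb : ∀ x ∈ S, f x b ≤ 0) :
    ∃ g : X → ℝ, ContinuousOn g S ∧ ∀ x ∈ S, g x ∈ Set.Icc a b ∧ f x (g x) = 0 := by
  have h1 : ∀ x ∈ S, ∃ t ∈ Set.Icc a b, f x t = 0 := fun x hx => by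
    have hc : ContinuousOn (f x) (Set.Icc a b) :=
      hf.comp (f := fun t => (x, t)) (by fun_prop) fun t ht => ⟨hx, ht⟩
    exact intermediate_value_Icc' hab hc ⟨hb x hx, ha x hx⟩
  choose! g hg hg0 using h1
  have hslice : ∀ c ∈ Set.Icc a b, ContinuousOn (fun x => f x c) S := fun c hc =>
    hf.comp (f := fun x => (x, c)) (by fun_prop) fun x hx => ⟨hx, hc⟩
  refine ⟨g, fun x hx => tendsto_order.2 ⟨fun c hc => ?_, fun c hc => ?_⟩, fun x hx =>
    ⟨hg x hx, hg0 x hx⟩⟩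
  · by_cases hca : c < a
    · filter_upwards [self_mem_nhdsWithin] with y hy using hca.trans_le (hg y hy).1
    have hcI : c ∈ Set.Icc a b := ⟨not_lt.1 hca, (hc.trans_le (hg x hx).2).le⟩
    have hpos : 0 < f x c := by
      rw [← hg0 x hx]; exact hanti x hx hcI (hg x hx) hc
    filter_upwards [self_mem_nhdsWithin, (hslice c hcI x hx).eventually_const_lt hpos] with y hy hy2
    by_contra! hle
    have := (hanti y hy).antitoneOn (hg y hy) hcI hle
    linarith [hg0 y hy]
  · by_cases hcb : b < c
    · filter_upwards [self_mem_nhdsWithin] with y hy using (hg y hy).2.trans_lt hcb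
    have hcI : c ∈ Set.Icc a b := ⟨((hg x hx).1.trans_lt hc).le, not_lt.1 hcb⟩
    have hneg : f x c < 0 := by
      rw [← hg0 x hx]; exact hanti x hx (hg x hx) hcI hc
    filter_upwards [self_mem_nhdsWithin, (hslice c hcI x hx).eventually_lt_const hneg] with y hy hy2
    by_contra! hle
    have := (hanti y hy).antitoneOn hcI (hg y hy) hle
    linarith [hg0 y hy]

namespace IsGradInverse

variable {F : MvPolynomial (Fin 2) ℝ} {v : Plane} {ρ R ε : ℝ} {B : Plane →L[ℝ] Plane}
  {P : Plane → Plane}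

lemma antitoneOn_line (h : IsGradInverse F v ρ R ε B P) {ξ e : Plane} {a b s : ℝ} {φ φ' : ℝ → ℝ}
    (hR : ∀ t ∈ Set.Icc a b, ‖ξ + t • e‖ < R) (hφ : ∀ t, HasDerivAt φ (φ' t) t)
    (hq : ∀ t ∈ Set.Icc a b, ∀ T : Plane →L[ℝ] Plane, ‖T - B‖ ≤ ε →
      s * inner ℝ (ξ + t • e) (T e) + φ' t ≤ 0) :
    AntitoneOn (fun t : ℝ => s * polyVal F (P (ξ + t • e)) + φ t) (Set.Icc a b) := by
  have hd : ∀ t ∈ Set.Icc a b, ∃ D ≤ (0 : ℝ),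
      HasDerivAt (fun t : ℝ => s * polyVal F (P (ξ + t • e)) + φ t) D t := fun t ht => by
    obtain ⟨T, hT, hD⟩ := h.hasDerivAt_line ξ e t (hR t ht)
    exact ⟨_, hq t ht T hT, (hD.const_mul s).add (hφ t)⟩
  refine antitoneOn_of_deriv_nonpos (convex_Icc a b) (fun t ht => ?_) (fun t ht => ?_)
    (fun t ht => ?_)
  · obtain ⟨D, -, hD⟩ := hd t ht
    exact hD.continuousAt.continuousWithinAt
  · obtain ⟨D, -, hD⟩ := hd t (interior_subset ht)
    exact hD.differentiableAt.differentiableWithinAt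
  · obtain ⟨D, hD0, hD⟩ := hd t (interior_subset ht)
    rw [hD.deriv]; exact hD0

lemma antitoneOn_ray (h : IsGradInverse F v ρ R ε B P) {n : Plane} {t₀ s m : ℝ}
    (hR : t₀ * ‖n‖ < R)
    (hq : ∀ T : Plane →L[ℝ] Plane, ‖T - B‖ ≤ ε → s * inner ℝ n (T n) ≤ -m) :
    AntitoneOn (fun t : ℝ => s * polyVal F (P (t • n)) + m * t ^ 2 / 2) (Set.Icc 0 t₀) := by
  have := h.antitoneOn_line (ξ := 0) (e := n) (a := 0) (b := t₀) (s := s)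
    (φ := fun t => m * t ^ 2 / 2) (φ' := fun t => m * t) (fun t ht => ?_) (fun t => ?_)
    fun t ht T hT => ?_
  · simpa only [zero_add] using this
  · rw [zero_add, norm_smul, Real.norm_of_nonneg ht.1]
    exact (mul_le_mul_of_nonneg_right ht.2 (norm_nonneg _)).trans_lt hR
  · have := ((hasDerivAt_pow 2 t).const_mul m).div_const 2
    exact this.congr_deriv (by norm_num; ring)
  · rw [zero_add, real_inner_smul_left]
    nlinarith [hq T hT, ht.1]

lemma strictAntiOn_ray (h : IsGradInverse F v ρ R ε B P) {n : Plane} {t₀ s m : ℝ} (hm : 0 < m)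
    (hR : t₀ * ‖n‖ < R)
    (hq : ∀ T : Plane →L[ℝ] Plane, ‖T - B‖ ≤ ε → s * inner ℝ n (T n) ≤ -m) :
    StrictAntiOn (fun t : ℝ => s * polyVal F (P (t • n))) (Set.Icc 0 t₀) := by
  intro t ht u hu htu
  have := h.antitoneOn_ray hR hq ht hu htu.le
  have h2 : t ^ 2 < u ^ 2 := by nlinarith [ht.1]
  simp only at this ⊢
  nlinarith

/-- On the rays in the given directions of gradients there is exactly one point of the curve, and
it depends continuously on the direction. -/
lemma exists_root_ray (h : IsGradInverse F v ρ R ε B P) {W : Set Plane} {t₀ s m : ℝ} (hm : 0 < m)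
    (ht₀ : 0 < t₀) (hR : ∀ n ∈ W, t₀ * ‖n‖ < R)
    (hq : ∀ n ∈ W, ∀ T : Plane →L[ℝ] Plane, ‖T - B‖ ≤ ε → s * inner ℝ n (T n) ≤ -m)
    (hpos : 0 < s * polyVal F (P 0)) (hlt : s * polyVal F (P 0) < m * t₀ ^ 2 / 2) :
    ∃ g : Plane → ℝ, ContinuousOn g W ∧ ∀ n ∈ W, 0 < g n ∧ g n < t₀ ∧
      polyVal F (P (g n • n)) = 0 := by
  have hend : ∀ n ∈ W, s * polyVal F (P (t₀ • n)) < 0 := fun n hn => by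
    have := h.antitoneOn_ray (hR n hn) (hq n hn) (Set.left_mem_Icc.2 ht₀.le)
      (Set.right_mem_Icc.2 ht₀.le) ht₀.le
    simp only [zero_smul] at this
    linarith
  have hcont : ContinuousOn (fun p : Plane × ℝ => s * polyVal F (P (p.2 • p.1)))
      (W ×ˢ Set.Icc 0 t₀) := by
    refine continuousOn_const.mul ((continuous_polyVal F).comp_continuousOn
      (h.continuousOn.comp (by fun_prop) ?_))
    rintro ⟨n, t⟩ ⟨hn, ht⟩
    simp only [Set.mem_ofPred_eq, norm_smul, Real.norm_of_nonneg ht.1]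
    exact (mul_le_mul_of_nonneg_right ht.2 (norm_nonneg _)).trans_lt (hR n hn)
  obtain ⟨g, hg, hg2⟩ := exists_continuousOn_root ht₀.le hcont
    (fun n hn => h.strictAntiOn_ray hm (hR n hn) (hq n hn))
    (fun n _ => by rw [zero_smul]; exact hpos.le) (fun n hn => (hend n hn).le)
  have hs : s ≠ 0 := by rintro rfl; simp at hpos
  refine ⟨g, hg, fun n hn => ?_⟩
  obtain ⟨hgI, hg0⟩ := hg2 n hn
  refine ⟨lt_of_le_of_ne hgI.1 fun h0 => ?_, lt_of_le_of_ne hgI.2 fun h0 => ?_,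
    (mul_eq_zero.1 hg0).resolve_left hs⟩
  · rw [← h0, zero_smul] at hg0; linarith
  · have := hend n hn
    rw [← h0] at this; linarith

end IsGradInverse

/-- Near a critical point the polynomial is dominated by its second order part. -/
lemma le_of_hess_close {F : MvPolynomial (Fin 2) ℝ} {v c y : Plane} {r m s : ℝ} {ε : NNReal}
    {H : Plane →L[ℝ] Plane} (hF : ∀ x ∈ Metric.ball v r, ‖polyHess F x - H‖ ≤ ε)
    (hc : c ∈ Metric.ball v r) (hgrad : polyGrad F c = 0)
    (hy : s * inner ℝ y (H y) + |s| * ε * ‖y‖ ^ 2 ≤ -m) {t : ℝ} (ht : 0 ≤ t)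
    (hcy : c + t • y ∈ Metric.ball v r) :
    s * polyVal F (c + t • y) + m * t ^ 2 / 2 ≤ s * polyVal F c := by
  have happ := approximatesLinearOn_polyGrad hF
  have hmem : ∀ u ∈ Set.Icc 0 t, c + u • y ∈ Metric.ball v r := fun u hu => by
    rcases ht.eq_or_lt with rfl | ht'
    · obtain rfl : u = 0 := le_antisymm hu.2 hu.1
      simpa using hc
    refine (convex_ball v r).segment_subset hc hcy ⟨1 - u / t, u / t, ?_, ?_, by ring, ?_⟩
    · rw [sub_nonneg, div_le_one ht']; exact hu.2
    · exact div_nonneg hu.1 ht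
    · rw [smul_add, smul_smul, div_mul_cancel₀ _ ht'.ne']; module
  have hd : ∀ u, HasDerivAt (fun u : ℝ => s * polyVal F (c + u • y) + m * u ^ 2 / 2)
      (s * inner ℝ (polyGrad F (c + u • y)) y + m * u) u := fun u => by
    have h1 : HasDerivAt (fun u : ℝ => c + u • y) y u := by
      simpa using ((hasDerivAt_id u).smul_const y).const_add c
    have h2 := (hasFDerivAt_polyVal F (c + u • y)).comp_hasDerivAt u h1
    refine (h2.const_mul s).add ?_
    have := ((hasDerivAt_pow 2 u).const_mul m).div_const 2
    exact this.congr_deriv (by norm_num; ring)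
  have hanti : AntitoneOn (fun u : ℝ => s * polyVal F (c + u • y) + m * u ^ 2 / 2)
      (Set.Icc 0 t) := by
    refine antitoneOn_of_deriv_nonpos (convex_Icc 0 t)
      (fun u _ => (hd u).continuousAt.continuousWithinAt)
      (fun u _ => (hd u).differentiableAt.differentiableWithinAt) (fun u hu => ?_)
    have hu := interior_subset hu
    rw [(hd u).deriv]
    have h1 := happ _ (hmem u hu) _ hc
    rw [hgrad, sub_zero, add_sub_cancel_left, map_smul, norm_smul, Real.norm_of_nonneg hu.1] at h1
    have h2 : |inner ℝ (polyGrad F (c + u • y) - u • H y) y| ≤ ε * (u * ‖y‖) * ‖y‖ :=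
      (abs_real_inner_le_norm _ _).trans (by gcongr)
    rw [inner_sub_left, real_inner_smul_left] at h2
    have h3 := (le_abs_self _).trans ((abs_mul s _).le.trans (mul_le_mul_of_nonneg_left h2 (abs_nonneg s)))
    rw [real_inner_comm y (H y)] at h3
    nlinarith [mul_le_mul_of_nonneg_left hy hu.1]
  have := hanti (Set.left_mem_Icc.2 ht) (Set.right_mem_Icc.2 ht) ht
  simpa using this

namespace LineArrangement

variable {d : ℕ} (A : LineArrangement d)

lemma eventually_deformations.self {p : MvPolynomial (Fin 2) ℝ → Prop}
    (h : ∀ᶠ F in A.deformations, p F) : p A.poly := by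
  obtain ⟨δ, hδ, h⟩ := A.eventually_deformations.1 h
  exact h _ ⟨A.totalDegree_poly, fun m => by simpa using hδ⟩

lemma eventually_polyVal_pos {s : ℝ} {x : Plane} (h : 0 < s * polyVal A.poly x) :
    ∀ᶠ F in A.deformations, 0 < s * polyVal F x := by
  have hs : 0 < |s| := abs_pos.2 (left_ne_zero_of_mul h.ne')
  filter_upwards [A.eventually_close ‖x‖ (ε := s * polyVal A.poly x / (2 * |s|)) (by positivity)]
    with F hF
  have h1 := (hF x le_rfl).1
  have h2 : |s * polyVal F x - s * polyVal A.poly x| ≤ s * polyVal A.poly x / 2 := by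
    rw [← mul_sub, abs_mul]
    calc _ ≤ |s| * (s * polyVal A.poly x / (2 * |s|)) := by gcongr
      _ = _ := by field_simp
  linarith [(abs_le.1 h2).1]

/-- If the two components of the complement of the arrangement near a vertex are glued together,
then the critical value near the vertex has the corresponding sign. -/
lemma critical_value_pos {v : Plane} (hv : polyVal A.poly v = 0) (hv' : polyGrad A.poly v = 0)
    {s : ℝ} {y z : Plane} (hy : s * inner ℝ y (polyHess A.poly v y) < 0)
    (hz : 0 < s * inner ℝ z (polyHess A.poly v z)) :
    ∃ r₀ > 0, ∀ r, 0 < r → r < r₀ → ∃ η > 0, ∀ᶠ F in A.deformations,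
      IsConnected {x ∈ Metric.ball v r | 0 < s * polyVal F x} →
        ∀ c ∈ Metric.ball v η, polyGrad F c = 0 → 0 < s * polyVal F c := by
  set H := polyHess A.poly v
  have hy0 : y ≠ 0 := by rintro rfl; simp at hy
  have hz0 : z ≠ 0 := by rintro rfl; simp at hz
  have hyz : cross y z ≠ 0 := fun h => by
    obtain ⟨t, rfl⟩ := exists_smul_of_cross_eq_zero hy0 h
    rw [map_smul, real_inner_smul_left, real_inner_smul_right] at hz
    nlinarith [sq_nonneg t]
  have hs : 0 < |s| := abs_pos.2 (left_ne_zero_of_mul hz.ne')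
  have hyn : 0 < ‖y‖ := norm_pos_iff.2 hy0
  have hzn : 0 < ‖z‖ := norm_pos_iff.2 hz0
  obtain ⟨ε, hε, hεy, hεz⟩ : ∃ ε : ℝ, 0 < ε ∧
      s * inner ℝ y (H y) + |s| * ε * ‖y‖ ^ 2 ≤ 0 ∧
      |s| * ε * ‖z‖ ^ 2 ≤ s * inner ℝ z (H z) / 2 := by
    have h1 : 0 < -(s * inner ℝ y (H y)) / (|s| * ‖y‖ ^ 2) := by
      have := neg_pos.2 hy; positivity
    have h2 : 0 < s * inner ℝ z (H z) / (2 * (|s| * ‖z‖ ^ 2)) := by positivity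
    refine ⟨min _ _, lt_min h1 h2, ?_, ?_⟩
    · have : min (-(s * inner ℝ y (H y)) / (|s| * ‖y‖ ^ 2))
        (s * inner ℝ z (H z) / (2 * (|s| * ‖z‖ ^ 2))) * (|s| * ‖y‖ ^ 2) ≤ -(s * inner ℝ y (H y)) := by
        calc _ ≤ -(s * inner ℝ y (H y)) / (|s| * ‖y‖ ^ 2) * (|s| * ‖y‖ ^ 2) := by
              gcongr; exact min_le_left _ _
          _ = _ := by field_simp
      linarith
    · calc _ ≤ |s| * (s * inner ℝ z (H z) / (2 * (|s| * ‖z‖ ^ 2))) * ‖z‖ ^ 2 := by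
                  gcongr; exact min_le_right _ _
        _ = _ := by field_simp
  lift ε to NNReal using hε.le
  obtain ⟨r₀, hr₀, hball⟩ := A.eventually_hess_close v hε
  refine ⟨r₀, hr₀, fun r hr hrr => ?_⟩
  have hball := hball r hrr.le
  have hG := eventually_deformations.self A hball
  set t := r / (2 * ‖z‖) with ht
  have ht0 : 0 < t := by positivity
  have hend : ∀ e : ℝ, |e| = 1 → v + t • (e • z) ∈ Metric.ball v r ∧
      0 < s * polyVal A.poly (v + t • (e • z)) := by
    intro e he
    have hnorm : ‖e • z‖ = ‖z‖ := by rw [norm_smul, Real.norm_eq_abs, he, one_mul]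
    have hmem : v + t • (e • z) ∈ Metric.ball v r := by
      rw [Metric.mem_ball, dist_eq_norm, add_sub_cancel_left, norm_smul, hnorm,
        Real.norm_of_nonneg ht0.le, ht]
      have : r / (2 * ‖z‖) * ‖z‖ = r / 2 := by field_simp
      linarith
    refine ⟨hmem, ?_⟩
    have he2 : e * e = 1 := by rw [← abs_mul_abs_self, he, one_mul]
    have h1 := le_of_hess_close (s := -s) (y := e • z) (m := s * inner ℝ z (H z) / 2) hG
      (Metric.mem_ball_self hr) hv' (by
        rw [map_smul, real_inner_smul_left, real_inner_smul_right, hnorm, abs_neg, ← mul_assoc e,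
          he2]
        linarith) ht0.le hmem
    rw [hv] at h1
    have : 0 < s * inner ℝ z (H z) / 2 * t ^ 2 / 2 := by positivity
    linarith
  set η := min r (t * |cross y z| / ‖y‖) with hη
  have hη0 : 0 < η := lt_min hr (by positivity)
  refine ⟨η, hη0, ?_⟩
  filter_upwards [hball, A.eventually_polyVal_pos (hend 1 (by simp)).2,
    A.eventually_polyVal_pos (hend (-1) (by simp)).2] with F hF hF1 hF2 hconn c hc hgrad
  by_contra! hle
  have hcr : c ∈ Metric.ball v r := Metric.ball_subset_ball (min_le_left _ _) hc
  have hcross : |cross y (c - v)| < t * |cross y z| := by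
    have h1 : ‖c - v‖ < t * |cross y z| / ‖y‖ := by
      rw [← dist_eq_norm]; exact (Metric.mem_ball.1 hc).trans_le (min_le_right _ _)
    rw [lt_div_iff₀ hyn] at h1
    exact (abs_cross_le _ _).trans_lt (by linarith)
  have hline : ∀ x ∈ Metric.ball v r, cross y (x - c) = 0 → s * polyVal F x ≤ 0 := by
    intro x hx hxc
    obtain ⟨u, hu⟩ := exists_smul_of_cross_eq_zero hy0 hxc
    obtain ⟨e, he, w, hw, rfl⟩ : ∃ e : ℝ, |e| = 1 ∧ ∃ w : ℝ, 0 ≤ w ∧ u = w * e := by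
      rcases le_total 0 u with h | h
      · exact ⟨1, by simp, u, h, by simp⟩
      · exact ⟨-1, by simp, -u, by linarith, by simp⟩
    have hx' : x = c + w • (e • y) := by rw [smul_smul, ← hu]; abel
    have he2 : e * e = 1 := by rw [← abs_mul_abs_self, he, one_mul]
    have h1 := le_of_hess_close (s := s) (y := e • y) (m := 0) hF hcr hgrad (by
        rw [map_smul, real_inner_smul_left, real_inner_smul_right, norm_smul, Real.norm_eq_abs, he,
          ← mul_assoc e, he2]
        linarith) hw (hx' ▸ hx)
    rw [← hx'] at h1
    linarith
  have hU : ∀ e : ℝ, IsOpen {x | 0 < e * cross y (x - c)} := fun e =>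
    isOpen_lt continuous_const (by fun_prop)
  have hpts : ∀ e : ℝ, |e| = 1 → 0 < s * polyVal F (v + t • (e • z)) →
      ({x ∈ Metric.ball v r | 0 < s * polyVal F x} ∩
        {x | 0 < (e * SignType.sign (cross y z)) * cross y (x - c)}).Nonempty := by
    intro e he hpos
    refine ⟨v + t • (e • z), ⟨(hend e he).1, hpos⟩, ?_⟩
    have he2 : e * e = 1 := by rw [← abs_mul_abs_self, he, one_mul]
    have h1 : v + t • (e • z) - c = (t * e) • z - (c - v) := by module
    rw [Set.mem_ofPred_eq, h1, cross_sub_right, cross_smul_right]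
    set g : ℝ := ((SignType.sign (cross y z) : SignType) : ℝ) with hg
    have h2 : g * cross y z = |cross y z| := sign_mul_self _
    have h4 : |e * g| ≤ 1 := by
      rw [abs_mul, he, one_mul, hg]
      rcases lt_trichotomy (cross y z) 0 with h | h | h <;> simp [h]
    have h3 : |e * g * cross y (c - v)| < t * |cross y z| := by
      rw [abs_mul]
      exact (mul_le_of_le_one_left (abs_nonneg _) h4).trans_lt hcross
    have h5 : e * g * (t * e * cross y z - cross y (c - v))
        = (e * e) * (t * (g * cross y z)) - e * g * cross y (c - v) := by ring
    rw [h5, he2, h2]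
    linarith [(abs_lt.1 h3).2]
  have hcover : {x ∈ Metric.ball v r | 0 < s * polyVal F x} ⊆
      {x | 0 < (1 * SignType.sign (cross y z)) * cross y (x - c)} ∪
        {x | 0 < (-1 * SignType.sign (cross y z)) * cross y (x - c)} := by
    intro x hx
    have hne : cross y (x - c) ≠ 0 := fun h0 => (hline x hx.1 h0).not_gt hx.2
    have hne2 : ((SignType.sign (cross y z) : SignType) : ℝ) ≠ 0 := by
      rcases hyz.lt_or_gt with h | h <;> simp [h]
    rcases (mul_ne_zero hne2 hne).lt_or_gt with h | h
    · right; simp only [Set.mem_ofPred_eq]; linarith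
    · left; simp only [Set.mem_ofPred_eq]; linarith
  obtain ⟨x, -, hx1, hx2⟩ := hconn.isPreconnected _ _ (hU _) (hU _) hcover (hpts 1 (by simp) hF1)
    (hpts (-1) (by simp) hF2)
  simp only [Set.mem_ofPred_eq] at hx1 hx2
  linarith

end LineArrangement

/-- The rotation of a plane vector by a right angle. -/
def rot (x : Plane) : Plane := !₂[-x 1, x 0]

lemma inner_rot (x y : Plane) : inner ℝ (rot x) y = cross x y := by
  simp [inner_plane, rot, cross]; ring

lemma cross_rot_self (x : Plane) : cross x (rot x) = ‖x‖ ^ 2 := by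
  rw [← real_inner_self_eq_norm_sq, inner_plane]; simp [cross, rot]

lemma cross_rot_left_self (x : Plane) : cross (rot x) x = -‖x‖ ^ 2 := by
  rw [← real_inner_self_eq_norm_sq, inner_plane]; simp [cross, rot]; ring

lemma cross_self_eq_zero (x : Plane) : cross x x = 0 := by rw [cross]; ring

lemma norm_rot (x : Plane) : ‖rot x‖ = ‖x‖ := by
  have h : ‖rot x‖ ^ 2 = ‖x‖ ^ 2 := by
    rw [← real_inner_self_eq_norm_sq, ← real_inner_self_eq_norm_sq, inner_plane, inner_plane]
    simp [rot]; ring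
  exact (pow_left_inj₀ (norm_nonneg _) (norm_nonneg _) two_ne_zero).1 h

lemma isDiameter_of_cross_eq_zero {F : MvPolynomial (Fin 2) ℝ} {p q n : Plane} {l m : ℝ}
    (hn : n ≠ 0) (hpq : p ≠ q) (hp : polyVal F p = 0) (hq : polyVal F q = 0) (hl : l ≠ 0)
    (hm : m ≠ 0) (hgp : polyGrad F p = l • n) (hgq : polyGrad F q = m • n)
    (h : cross n (q - p) = 0) : IsDiameter F p q := by
  obtain ⟨t, ht⟩ := exists_smul_of_cross_eq_zero hn h
  refine ⟨hpq, ⟨hp, ?_⟩, ⟨hq, ?_⟩, fun x hx => ?_, fun x hx => ?_⟩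
  · rw [hgp]; exact smul_ne_zero hl hn
  · rw [hgq]; exact smul_ne_zero hm hn
  · have hx : inner ℝ (polyGrad F p) (x - p) = 0 := hx
    rw [hgp, real_inner_smul_left] at hx
    rw [ht, real_inner_smul_left, (mul_eq_zero.1 hx).resolve_left hl, mul_zero]
  · have hx : inner ℝ (polyGrad F q) (x - q) = 0 := hx
    rw [hgq, real_inner_smul_left] at hx
    rw [ht, real_inner_smul_left, (mul_eq_zero.1 hx).resolve_left hm, mul_zero]

/-- Two arcs of the curve with a common continuous family of normal directions contain the endpoints
of a diameter if the moment of the chord changes sign. -/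
lemma exists_isDiameter_of_arcs {F : MvPolynomial (Fin 2) ℝ} {a b : ℝ} (hab : a ≤ b)
    {p q n : ℝ → Plane} (hp : ContinuousOn p (Set.Icc a b)) (hq : ContinuousOn q (Set.Icc a b))
    (hn : ContinuousOn n (Set.Icc a b)) (hn0 : ∀ t ∈ Set.Icc a b, n t ≠ 0)
    (hpq : ∀ t ∈ Set.Icc a b, p t ≠ q t)
    (hFp : ∀ t ∈ Set.Icc a b, polyVal F (p t) = 0 ∧ ∃ l : ℝ, l ≠ 0 ∧ polyGrad F (p t) = l • n t)
    (hFq : ∀ t ∈ Set.Icc a b, polyVal F (q t) = 0 ∧ ∃ l : ℝ, l ≠ 0 ∧ polyGrad F (q t) = l • n t)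
    (hsign : cross (n a) (q a - p a) * cross (n b) (q b - p b) ≤ 0) :
    ∃ t ∈ Set.Icc a b, IsDiameter F (p t) (q t) := by
  have hc : ContinuousOn (fun t => cross (n t) (q t - p t)) (Set.Icc a b) := by fun_prop
  obtain ⟨t, ht, h0⟩ : ∃ t ∈ Set.Icc a b, cross (n t) (q t - p t) = 0 := by
    rcases mul_nonpos_iff.1 hsign with ⟨h1, h2⟩ | ⟨h1, h2⟩
    · exact intermediate_value_Icc' hab hc ⟨h2, h1⟩
    · exact intermediate_value_Icc hab hc ⟨h1, h2⟩
  obtain ⟨hp0, l, hl, hgp⟩ := hFp t ht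
  obtain ⟨hq0, m, hm, hgq⟩ := hFq t ht
  exact ⟨t, ht, isDiameter_of_cross_eq_zero (hn0 t ht) (hpq t ht) hp0 hq0 hl hm hgp hgq h0⟩

/-- All critical points near `v` lie in the region where the polynomial has the sign of `s`. -/
def CriticalPos (F : MvPolynomial (Fin 2) ℝ) (v : Plane) (η s : ℝ) : Prop :=
  ∀ c ∈ Metric.ball v η, polyGrad F c = 0 → 0 < s * polyVal F c

lemma exists_window {B : Plane →L[ℝ] Plane} {n₀ e₀ : Plane} {s : ℝ}
    (h : s * inner ℝ n₀ (B e₀) < 0) : ∃ κ > 0, ∃ m > 0, ∀ n e, ‖n - n₀‖ ≤ κ → ‖e - e₀‖ ≤ κ →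
      ∀ T : Plane →L[ℝ] Plane, ‖T - B‖ ≤ κ → s * inner ℝ n (T e) ≤ -m := by
  have hc : Continuous fun x : (Plane × Plane) × (Plane →L[ℝ] Plane) =>
      s * inner ℝ x.1.1 (x.2 x.1.2) := by fun_prop
  have hev := (hc.continuousAt (x := ((n₀, e₀), B))).eventually_lt_const
    (show s * inner ℝ n₀ (B e₀) < s * inner ℝ n₀ (B e₀) / 2 by linarith)
  obtain ⟨κ, hκ, hb⟩ := Metric.eventually_nhds_iff.1 hev
  refine ⟨κ / 2, by positivity, -(s * inner ℝ n₀ (B e₀) / 2), by linarith,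
    fun n e hn he T hT => ?_⟩
  have := hb (y := ((n, e), T)) (by
    rw [Prod.dist_eq, Prod.dist_eq, dist_eq_norm, dist_eq_norm, dist_eq_norm]
    exact max_lt (max_lt (by linarith) (by linarith)) (by linarith))
  simp only at this
  linarith

/-- The vector `n₀`, tilted by an angle of tangent `t * κ`. -/
def tilt (n₀ : Plane) (κ t : ℝ) : Plane := n₀ + (t * κ) • rot n₀

@[fun_prop]
lemma continuous_tilt (n₀ : Plane) (κ : ℝ) : Continuous (tilt n₀ κ) := by
  unfold tilt; fun_prop

lemma norm_tilt_sub_le (n₀ : Plane) {κ t : ℝ} (hκ : 0 ≤ κ) (ht : t ∈ Set.Icc (-1 : ℝ) 1) :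
    ‖tilt n₀ κ t - n₀‖ ≤ κ * ‖n₀‖ := by
  rw [tilt, add_sub_cancel_left, norm_smul, norm_rot, Real.norm_eq_abs, abs_mul, abs_of_nonneg hκ]
  have := abs_le.2 ht
  have : 0 ≤ κ * ‖n₀‖ := by positivity
  nlinarith

lemma cross_tilt_self (n₀ : Plane) (κ t : ℝ) : cross (tilt n₀ κ t) n₀ = -(t * κ * ‖n₀‖ ^ 2) := by
  rw [tilt, cross_add_left, cross_smul_left, cross_self_eq_zero, cross_rot_left_self]
  ring

lemma cross_tilt_map (n₀ : Plane) (κ t : ℝ) {B : Plane →L[ℝ] Plane} {a b : ℝ}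
    (ha : B n₀ = a • n₀) (hb : B (rot n₀) = b • rot n₀) :
    cross (tilt n₀ κ t) (B (tilt n₀ κ t)) = t * κ * (b - a) * ‖n₀‖ ^ 2 := by
  rw [tilt, map_add, map_smul, ha, hb]
  simp only [cross_add_left, cross_add_right, cross_smul_left, cross_smul_right,
    cross_self_eq_zero, cross_rot_self, cross_rot_left_self]
  ring

lemma norm_smul_of_mul_self_eq_one {a : ℝ} (ha : a * a = 1) (n : Plane) : ‖a • n‖ = ‖n‖ := by
  have : |a| = 1 := by
    rw [← abs_mul_abs_self] at ha; nlinarith [abs_nonneg a]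
  rw [norm_smul, Real.norm_eq_abs, this, one_mul]

lemma IsGradInverse.exists_root_ray_of_sign {F : MvPolynomial (Fin 2) ℝ} {v : Plane} {ρ R ε : ℝ}
    {B : Plane →L[ℝ] Plane} {P : Plane → Plane} (h : IsGradInverse F v ρ R ε B P) {W : Set Plane}
    {t₀ s m : ℝ} (hm : 0 < m) (ht₀ : 0 < t₀) (hR : ∀ n ∈ W, t₀ * ‖n‖ < R)
    (hq : ∀ n ∈ W, ∀ T : Plane →L[ℝ] Plane, ‖T - B‖ ≤ ε → s * inner ℝ n (T n) ≤ -m)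
    (hpos : 0 < s * polyVal F (P 0)) (hlt : s * polyVal F (P 0) < m * t₀ ^ 2 / 2) {a : ℝ}
    (ha : a * a = 1) : ∃ g : Plane → ℝ, ContinuousOn g W ∧ ∀ n ∈ W, 0 < g n ∧
      ‖(g n * a) • n‖ < R ∧ polyVal F (P ((g n * a) • n)) = 0 := by
  have hna := norm_smul_of_mul_self_eq_one ha
  have haW : ∀ n ∈ W, a • n ∈ {n | a • n ∈ W} := fun n hn => by
    rw [Set.mem_ofPred_eq, smul_smul, ha, one_smul]; exact hn
  have hRW : ∀ n ∈ {n | a • n ∈ W}, t₀ * ‖n‖ < R := fun n hn => by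
    rw [← hna]; exact hR _ hn
  obtain ⟨g, hg, hg2⟩ := h.exists_root_ray (W := {n | a • n ∈ W}) (s := s) hm ht₀ hRW
    (fun n hn T hT => by
      have := hq _ hn T hT
      rwa [map_smul, real_inner_smul_left, real_inner_smul_right, ← mul_assoc a, ha, one_mul] at this)
    hpos hlt
  refine ⟨fun n => g (a • n), hg.comp (by fun_prop) haW, fun n hn => ?_⟩
  obtain ⟨h1, h2, h3⟩ := hg2 _ (haW n hn)
  rw [smul_smul] at h3
  refine ⟨h1, ?_, h3⟩
  rw [← smul_smul, norm_smul, Real.norm_of_nonneg h1.le]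
  exact (mul_le_mul_of_nonneg_right h2.le (norm_nonneg _)).trans_lt (hRW _ (haW n hn))

namespace LineArrangement

variable {d : ℕ} (A : LineArrangement d)

lemma eventually_gradInverse_close {v x : Plane} {ρ R ε : ℝ} {B : Plane →L[ℝ] Plane}
    (hε : 0 ≤ ε) (hx : x ∈ Metric.ball v ρ)
    (hR : ‖polyGrad A.poly x‖ < R) (hx0 : polyVal A.poly x = 0) {μ : ℝ} (hμ : 0 < μ) :
    ∀ᶠ F in A.deformations, ∀ P, IsGradInverse F v ρ R ε B P →
      |polyVal F (P (polyGrad A.poly x))| ≤ μ ∧ ‖P (polyGrad A.poly x) - x‖ ≤ μ := by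
  obtain ⟨ω, hω, hG⟩ := Metric.continuousAt_iff.1
    ((continuous_polyVal A.poly).continuousAt (x := x)) (μ / 2) (by positivity)
  set ξ := polyGrad A.poly x with hξ
  set β := min (ω / 2) μ with hβ
  have hβ0 : 0 < β := by positivity
  set τ := min ((R - ‖ξ‖) / 2) (β / (‖B‖ + ε + 1)) with hτ
  have hτ0 : 0 < τ := lt_min (by linarith) (by positivity)
  filter_upwards [A.eventually_close ‖x‖ hτ0, A.eventually_close (‖x‖ + ω) (half_pos hμ)]
    with F hF hF2 P hP
  have h1 := (hF x le_rfl).2.1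
  have h2 : ‖polyGrad F x‖ < R := by
    have := norm_sub_norm_le (polyGrad F x) ξ
    have h3 : τ ≤ (R - ‖ξ‖) / 2 := min_le_left _ _
    linarith
  have h3 : ‖P ξ - x‖ ≤ β := by
    have h4 := hP.approx hR h2
    rw [hP.leftInv x hx] at h4
    have h5 : ‖B (ξ - polyGrad F x)‖ ≤ ‖B‖ * ‖ξ - polyGrad F x‖ := B.le_opNorm _
    have h6 := norm_le_norm_add_norm_sub' (P ξ - x) (B (ξ - polyGrad F x))
    have h7 : ‖ξ - polyGrad F x‖ ≤ β / (‖B‖ + ε + 1) := by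
      rw [norm_sub_rev]; exact h1.trans (min_le_right _ _)
    calc ‖P ξ - x‖ ≤ (‖B‖ + ε) * ‖ξ - polyGrad F x‖ := by linarith
      _ ≤ (‖B‖ + ε + 1) * (β / (‖B‖ + ε + 1)) := by gcongr ?_ * ?_; linarith
      _ = β := by field_simp
  have h4 : ‖P ξ - x‖ < ω := h3.trans_lt ((min_le_left _ _).trans_lt (by linarith))
  refine ⟨?_, h3.trans (min_le_right _ _)⟩
  have h5 := hG (x := P ξ) (by rwa [dist_eq_norm])
  rw [hx0, Real.dist_eq, sub_zero] at h5
  have h6 := (hF2 (P ξ) (by linarith [norm_sub_norm_le (P ξ) x])).1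
  have := abs_sub_abs_le_abs_sub (polyVal F (P ξ)) (polyVal A.poly (P ξ))
  linarith

variable {v : Plane} {H : Plane ≃L[ℝ] Plane}

lemma eventually_critical_small (hv0 : polyVal A.poly v = 0) (hv : polyGrad A.poly v = 0)
    {ρ R ε s : ℝ} {B : Plane →L[ℝ] Plane} (hε : 0 ≤ ε) (hρ : 0 < ρ) (hR : 0 < R) {η : ℝ}
    (hη : ρ ≤ η) {μ : ℝ} (hμ : 0 < μ) :
    ∀ᶠ F in A.deformations, CriticalPos F v η s → ∀ P, IsGradInverse F v ρ R ε B P →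
      0 < s * polyVal F (P 0) ∧ s * polyVal F (P 0) < μ := by
  have h0 : 0 < |s| + 1 := by positivity
  filter_upwards [A.eventually_gradInverse_close (B := B) (R := R) hε (Metric.mem_ball_self hρ)
    (by rwa [hv, norm_zero]) hv0 (μ := μ / (2 * (|s| + 1))) (by positivity)] with F hF hcrit P hP
  rw [hv] at hF
  refine ⟨hcrit _ (Metric.ball_subset_ball hη (hP.mem 0 (by simpa))) (hP.grad 0 (by simpa)), ?_⟩
  have h1 := (hF P hP).1
  calc s * polyVal F (P 0) ≤ |s| * |polyVal F (P 0)| := by rw [← abs_mul]; exact le_abs_self _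
    _ ≤ (|s| + 1) * (μ / (2 * (|s| + 1))) := by gcongr; linarith
    _ = μ / 2 := by field_simp
    _ < μ := by linarith

/-- The two branches of the curve near a vertex, parametrized by the direction of the normal. -/
lemma eventually_branches (hv0 : polyVal A.poly v = 0) (hv : polyGrad A.poly v = 0)
    (hH : (H : Plane →L[ℝ] Plane) = polyHess A.poly v) {n₀ : Plane} {s : ℝ}
    (hn₀ : s * inner ℝ n₀ (H.symm n₀) < 0) : ∃ κ > 0, κ < ‖n₀‖ ∧ ∀ η > 0, ∀ᶠ F in A.deformations,
      CriticalPos F v η s → ∀ a : ℝ, a * a = 1 → ∃ p : Plane → Plane,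
        ContinuousOn p (Metric.closedBall n₀ κ) ∧ ∀ n ∈ Metric.closedBall n₀ κ,
          p n ∈ Metric.ball v η ∧ polyVal F (p n) = 0 ∧
            ∃ l : ℝ, 0 < a * l ∧ polyGrad F (p n) = l • n := by
  have hn : 0 < ‖n₀‖ := norm_pos_iff.2 (by rintro rfl; simp at hn₀)
  obtain ⟨κ₀, hκ₀, m, hm, hw⟩ := exists_window (B := (H.symm : Plane →L[ℝ] Plane)) hn₀
  refine ⟨min κ₀ (‖n₀‖ / 2), by positivity, (min_le_right _ _).trans_lt (by linarith),
    fun η hη => ?_⟩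
  set W := Metric.closedBall n₀ (min κ₀ (‖n₀‖ / 2)) with hW
  obtain ⟨ρ, hρ, hρη, R, hR, hP⟩ := A.exists_isGradInverse v hv H hH hκ₀ hη
  set t₀ := R / (2 * ‖n₀‖) with ht₀
  have ht₀' : 0 < t₀ := by positivity
  filter_upwards [hP, A.eventually_critical_small hv0 hv hκ₀.le hρ hR hρη (s := s)
    (B := (H.symm : Plane →L[ℝ] Plane)) (μ := m * t₀ ^ 2 / 2) (by positivity)]
    with F ⟨P, hP⟩ hF hcrit a ha
  obtain ⟨hpos, hlt⟩ := hF hcrit P hP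
  have hWn : ∀ n ∈ W, ‖n - n₀‖ ≤ κ₀ ∧ ‖n‖ < 2 * ‖n₀‖ := fun n hn' => by
    have h1 : ‖n - n₀‖ ≤ min κ₀ (‖n₀‖ / 2) := by rwa [← dist_eq_norm]
    refine ⟨h1.trans (min_le_left _ _), ?_⟩
    have h2 := h1.trans (min_le_right _ _)
    linarith [norm_sub_norm_le n n₀]
  have hRW : ∀ n ∈ W, t₀ * ‖n‖ < R := fun n hn' => by
    calc t₀ * ‖n‖ < t₀ * (2 * ‖n₀‖) := by gcongr; exact (hWn _ hn').2
      _ = R := by rw [ht₀]; field_simp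
  obtain ⟨g, hg, hg2⟩ := hP.exists_root_ray_of_sign hm ht₀' hRW
    (fun n hn' => hw _ _ (hWn _ hn').1 (hWn _ hn').1) hpos hlt ha
  refine ⟨fun n => P ((g n * a) • n), hP.continuousOn.comp (by fun_prop) fun n hn' =>
    (hg2 n hn').2.1, fun n hn' => ⟨Metric.ball_subset_ball hρη (hP.mem _ (hg2 n hn').2.1),
      (hg2 n hn').2.2, g n * a, ?_, hP.grad _ (hg2 n hn').2.1⟩⟩
  calc 0 < g n := (hg2 n hn').1
    _ = a * (g n * a) := by rw [mul_comm (g _), ← mul_assoc, ha, one_mul]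

lemma inner_pos_of_mem_window {n₀ n : Plane} {κ : ℝ} (hκ : κ < ‖n₀‖)
    (hn : n ∈ Metric.closedBall n₀ κ) : 0 < inner ℝ n n₀ := by
  have h1 : ‖n - n₀‖ ≤ κ := by rwa [← dist_eq_norm]
  have h2 := (abs_le.1 (abs_real_inner_le_norm (n - n₀) n₀)).1
  rw [inner_sub_left, real_inner_self_eq_norm_sq] at h2
  nlinarith [norm_nonneg (n - n₀), norm_nonneg n₀]

/-- The short diameter near a vertex. -/
lemma eventually_short_diameter (hv0 : polyVal A.poly v = 0) (hv : polyGrad A.poly v = 0)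
    (hH : (H : Plane →L[ℝ] Plane) = polyHess A.poly v) {n₀ : Plane} {s a b : ℝ} (hn₀ : n₀ ≠ 0)
    (ha : H.symm n₀ = a • n₀) (hb : H.symm (rot n₀) = b • rot n₀) (hsa : s * a < 0)
    (hab : a ≠ b) {η : ℝ} (hη : 0 < η) : ∀ᶠ F in A.deformations,
      CriticalPos F v η s → ∃ p ∈ Metric.ball v η, ∃ q ∈ Metric.ball v η, IsDiameter F p q := by
  have hn : 0 < ‖n₀‖ := norm_pos_iff.2 hn₀
  obtain ⟨κ₀, hκ₀, m, hm, hw⟩ := exists_window (B := (H.symm : Plane →L[ℝ] Plane)) (s := s)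
    (n₀ := n₀) (e₀ := n₀) (by
      change s * inner ℝ n₀ (H.symm n₀) < 0
      rw [ha, real_inner_smul_right, real_inner_self_eq_norm_sq, ← mul_assoc]
      exact mul_neg_of_neg_of_pos hsa (by positivity))
  set κ := min (1 / 2) (κ₀ / ‖n₀‖) with hκ
  have hκ0 : 0 < κ := by positivity
  have hκ1 : κ ≤ 1 / 2 := min_le_left _ _
  have hκ2 : κ * ‖n₀‖ ≤ κ₀ := by
    calc κ * ‖n₀‖ ≤ κ₀ / ‖n₀‖ * ‖n₀‖ := by gcongr; exact min_le_right _ _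
      _ = κ₀ := by field_simp
  have hab' : 0 < |b - a| := abs_pos.2 (sub_ne_zero.2 hab.symm)
  set ε := min κ₀ (κ * |b - a| / 8) with hε
  have hε0 : 0 < ε := by positivity
  obtain ⟨ρ, hρ, hρη, R, hR, hP⟩ := A.exists_isGradInverse v hv H hH hε0 hη
  set t₀ := R / (2 * ‖n₀‖) with ht₀
  have ht₀' : 0 < t₀ := by positivity
  obtain ⟨N, hN⟩ : ∃ N, N = tilt n₀ κ := ⟨_, rfl⟩
  have hNc : Continuous N := hN ▸ continuous_tilt n₀ κ
  have hNn : ∀ t ∈ Set.Icc (-1 : ℝ) 1, ‖N t - n₀‖ ≤ κ * ‖n₀‖ := fun t ht =>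
    hN ▸ norm_tilt_sub_le n₀ hκ0.le ht
  have hNlt : ∀ t ∈ Set.Icc (-1 : ℝ) 1, ‖N t‖ < 2 * ‖n₀‖ := fun t ht => by
    have h1 := hNn t ht
    have h2 := norm_sub_norm_le (N t) n₀
    nlinarith
  have hN0 : ∀ t ∈ Set.Icc (-1 : ℝ) 1, N t ≠ 0 := fun t ht h0 => by
    have h1 := hNn t ht
    rw [h0, zero_sub, norm_neg] at h1
    nlinarith
  filter_upwards [hP, A.eventually_critical_small hv0 hv hε0.le hρ hR hρη (s := s)
    (B := (H.symm : Plane →L[ℝ] Plane)) (μ := m * t₀ ^ 2 / 2) (by positivity)]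
    with F ⟨P, hP⟩ hF hcrit
  obtain ⟨hpos, hlt⟩ := hF hcrit P hP
  have key : ∀ e : ℝ, e * e = 1 → ∃ g : ℝ → ℝ, ContinuousOn g (Set.Icc (-1) 1) ∧
      ∀ t ∈ Set.Icc (-1 : ℝ) 1, 0 < g t ∧ ‖(g t * e) • N t‖ < R ∧
        polyVal F (P ((g t * e) • N t)) = 0 := by
    intro e he
    have hRW : ∀ n ∈ N '' Set.Icc (-1) 1, t₀ * ‖n‖ < R := by
      rintro _ ⟨t, ht, rfl⟩
      calc t₀ * ‖N t‖ < t₀ * (2 * ‖n₀‖) := by gcongr; exact hNlt t ht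
        _ = R := by rw [ht₀]; field_simp
    obtain ⟨g, hg, hg2⟩ := hP.exists_root_ray_of_sign hm ht₀' hRW (by
        rintro _ ⟨t, ht, rfl⟩ T hT
        have h1 := (hNn t ht).trans hκ2
        exact hw (N t) (N t) h1 h1 T (hT.trans (min_le_left _ _))) hpos hlt he
    exact ⟨fun t => g (N t), hg.comp hNc.continuousOn (Set.mapsTo_image _ _),
      fun t ht => hg2 _ (Set.mem_image_of_mem _ ht)⟩
  obtain ⟨g, hg, hg2⟩ := key 1 (by norm_num)
  obtain ⟨f, hf, hf2⟩ := key (-1) (by norm_num)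
  have hgrad1 := fun t ht => hP.grad _ (hg2 t ht).2.1
  have hgrad2 := fun t ht => hP.grad _ (hf2 t ht).2.1
  have hmom : ∀ t, |t| = 1 → ∃ μ > 0, ∃ D, |D| < κ * |b - a| * ‖n₀‖ ^ 2 ∧
      cross (N t) (P ((f t * -1) • N t) - P ((g t * 1) • N t))
        = -μ * (t * κ * (b - a) * ‖n₀‖ ^ 2 + D) := by
    intro t ht
    have htI : t ∈ Set.Icc (-1 : ℝ) 1 := abs_le.1 ht.le
    have happ := hP.approx (hg2 t htI).2.1 (hf2 t htI).2.1
    have h1 : (g t * 1) • N t - (f t * -1) • N t = (g t + f t) • N t := by module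
    rw [h1] at happ
    set μ := g t + f t with hμ
    have hμ0 : 0 < μ := add_pos (hg2 t htI).1 (hf2 t htI).1
    obtain ⟨E, hE⟩ : ∃ E, E = P ((g t * 1) • N t) - P ((f t * -1) • N t) - H.symm (μ • N t) :=
      ⟨_, rfl⟩
    have hE' : ‖E‖ ≤ ε * (μ * ‖N t‖) := by
      rw [norm_smul, Real.norm_of_nonneg hμ0.le] at happ
      rw [hE]; exact happ
    have hcr : cross (N t) (H.symm (N t)) = t * κ * (b - a) * ‖n₀‖ ^ 2 :=
      hN ▸ cross_tilt_map (B := (H.symm : Plane →L[ℝ] Plane)) n₀ κ t ha hb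
    refine ⟨μ, hμ0, cross (N t) (μ⁻¹ • E), ?_, ?_⟩
    · refine (abs_cross_le _ _).trans_lt ?_
      rw [norm_smul, Real.norm_of_nonneg (inv_nonneg.2 hμ0.le)]
      have h3 : μ⁻¹ * ‖E‖ ≤ ε * ‖N t‖ := by
        rw [inv_mul_le_iff₀ hμ0]; linarith
      have h4 := hNlt t htI
      have h5 : ε ≤ κ * |b - a| / 8 := min_le_right _ _
      calc ‖N t‖ * (μ⁻¹ * ‖E‖) ≤ ‖N t‖ * (ε * ‖N t‖) := by gcongr
        _ = ε * ‖N t‖ ^ 2 := by ring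
        _ ≤ κ * |b - a| / 8 * (2 * ‖n₀‖) ^ 2 := by gcongr
        _ < κ * |b - a| * ‖n₀‖ ^ 2 := by
          have : 0 < κ * |b - a| * ‖n₀‖ ^ 2 := by positivity
          nlinarith
    · have h6 : P ((f t * -1) • N t) - P ((g t * 1) • N t) = -μ • (H.symm (N t) + μ⁻¹ • E) := by
        rw [smul_add, smul_smul, neg_mul μ, mul_inv_cancel₀ hμ0.ne', neg_smul, ← map_smul, hE]
        generalize H.symm (μ • N t) = Z
        generalize P ((f t * -1) • N t) = X
        generalize P ((g t * 1) • N t) = Y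
        module
      rw [h6, cross_smul_right, cross_add_right, hcr]
  obtain ⟨μ₁, hμ₁, D₁, hD₁, h1⟩ := hmom (-1) (by simp)
  obtain ⟨μ₂, hμ₂, D₂, hD₂, h2⟩ := hmom 1 (by simp)
  obtain ⟨t, ht, hdiam⟩ := exists_isDiameter_of_arcs (F := F) (a := -1) (b := 1) (by norm_num)
    (p := fun t => P ((g t * 1) • N t)) (q := fun t => P ((f t * -1) • N t)) (n := N)
    (hP.continuousOn.comp (by fun_prop) fun t ht => (hg2 t ht).2.1)
    (hP.continuousOn.comp (by fun_prop) fun t ht => (hf2 t ht).2.1) hNc.continuousOn hN0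
    (fun t ht hpq => by
      have h3 := congrArg (polyGrad F) hpq
      rw [hgrad1 t ht, hgrad2 t ht] at h3
      have h4 : (g t + f t) • N t = 0 := by
        rw [← sub_eq_zero] at h3; rw [← h3]; module
      exact smul_ne_zero (add_pos (hg2 t ht).1 (hf2 t ht).1).ne' (hN0 t ht) h4)
    (fun t ht => ⟨(hg2 t ht).2.2, g t * 1, by simpa using (hg2 t ht).1.ne', hgrad1 t ht⟩)
    (fun t ht => ⟨(hf2 t ht).2.2, f t * -1, by simpa using (hf2 t ht).1.ne', hgrad2 t ht⟩)
    (by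
      rw [h1, h2]
      have h3 := abs_lt.1 hD₁
      have h4 := abs_lt.1 hD₂
      have hprod : (-1 * κ * (b - a) * ‖n₀‖ ^ 2 + D₁) * (1 * κ * (b - a) * ‖n₀‖ ^ 2 + D₂) ≤ 0 := by
        rcases le_total 0 (b - a) with h | h
        · rw [abs_of_nonneg h] at h3 h4
          exact mul_nonpos_of_nonpos_of_nonneg (by linarith) (by linarith)
        · rw [abs_of_nonpos h] at h3 h4
          exact mul_nonpos_of_nonneg_of_nonpos (by linarith) (by linarith)
      have : 0 < μ₁ * μ₂ := mul_pos hμ₁ hμ₂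
      nlinarith)
  exact ⟨_, Metric.ball_subset_ball hρη (hP.mem _ (hg2 t ht).2.1), _,
    Metric.ball_subset_ball hρη (hP.mem _ (hf2 t ht).2.1), hdiam⟩

/-- The diameters near the segment that joins two vertices that see each other. -/
lemma eventually_diameters_of_seeing {w : Plane} {H' : Plane ≃L[ℝ] Plane}
    (hv0 : polyVal A.poly v = 0) (hv : polyGrad A.poly v = 0)
    (hH : (H : Plane →L[ℝ] Plane) = polyHess A.poly v)
    (hw0 : polyVal A.poly w = 0) (hw : polyGrad A.poly w = 0)
    (hH' : (H' : Plane →L[ℝ] Plane) = polyHess A.poly w) {s s' : ℝ}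
    (hs : s * inner ℝ (w - v) (H.symm (w - v)) < 0)
    (hs' : s' * inner ℝ (w - v) (H'.symm (w - v)) < 0) {η : ℝ} (hη : 0 < η) :
    ∀ᶠ F in A.deformations, CriticalPos F v η s → CriticalPos F w η s' →
      ∀ a b : ℝ, a * a = 1 → b * b = 1 → ∃ p ∈ Metric.ball v η, ∃ q ∈ Metric.ball w η,
        IsDiameter F p q ∧ 0 < a * inner ℝ (polyGrad F p) (w - v) ∧
          0 < b * inner ℝ (polyGrad F q) (w - v) := by
  set n₀ := w - v with hn₀
  have hn : 0 < ‖n₀‖ := norm_pos_iff.2 (by intro h; rw [h] at hs; simp at hs)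
  obtain ⟨κ₁, hκ₁, hκ₁', h1⟩ := A.eventually_branches hv0 hv hH hs
  obtain ⟨κ₂, hκ₂, hκ₂', h2⟩ := A.eventually_branches hw0 hw hH' hs'
  set κ := min κ₁ κ₂ / ‖n₀‖ with hκ
  have hκ0 : 0 < κ := by positivity
  have hκ3 : κ * ‖n₀‖ = min κ₁ κ₂ := by rw [hκ]; field_simp
  obtain ⟨N, hN⟩ : ∃ N, N = tilt n₀ κ := ⟨_, rfl⟩
  have hNc : Continuous N := hN ▸ continuous_tilt n₀ κ
  have hNn : ∀ t ∈ Set.Icc (-1 : ℝ) 1, ‖N t - n₀‖ ≤ κ * ‖n₀‖ := fun t ht =>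
    hN ▸ norm_tilt_sub_le n₀ hκ0.le ht
  have hN1 : ∀ t ∈ Set.Icc (-1 : ℝ) 1, N t ∈ Metric.closedBall n₀ κ₁ := fun t ht => by
    rw [Metric.mem_closedBall, dist_eq_norm]
    exact (hNn t ht).trans (hκ3.le.trans (min_le_left _ _))
  have hN2 : ∀ t ∈ Set.Icc (-1 : ℝ) 1, N t ∈ Metric.closedBall n₀ κ₂ := fun t ht => by
    rw [Metric.mem_closedBall, dist_eq_norm]
    exact (hNn t ht).trans (hκ3.le.trans (min_le_right _ _))
  have hNpos : ∀ t ∈ Set.Icc (-1 : ℝ) 1, 0 < inner ℝ (N t) n₀ := fun t ht =>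
    inner_pos_of_mem_window hκ₁' (hN1 t ht)
  have hNlt : ∀ t ∈ Set.Icc (-1 : ℝ) 1, ‖N t‖ < 2 * ‖n₀‖ := fun t ht => by
    have h1 := hNn t ht
    have h2 := norm_sub_norm_le (N t) n₀
    have h3 : min κ₁ κ₂ < ‖n₀‖ := (min_le_left _ _).trans_lt hκ₁'
    linarith
  set η' := min η (min (‖n₀‖ / 2) (κ * ‖n₀‖ / 4)) with hη'
  have hη0 : 0 < η' := by positivity
  have hη1 : η' ≤ η := min_le_left _ _
  have hη2 : η' ≤ ‖n₀‖ / 2 := (min_le_right _ _).trans (min_le_left _ _)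
  have hη3 : η' ≤ κ * ‖n₀‖ / 4 := (min_le_right _ _).trans (min_le_right _ _)
  filter_upwards [h1 η' hη0, h2 η' hη0] with F hF1 hF2 hc1 hc2 a b ha hb
  obtain ⟨p, hp, hp2⟩ := hF1 (fun c hc => hc1 c (Metric.ball_subset_ball hη1 hc)) a ha
  obtain ⟨q, hq, hq2⟩ := hF2 (fun c hc => hc2 c (Metric.ball_subset_ball hη1 hc)) b hb
  have hdist : ∀ t ∈ Set.Icc (-1 : ℝ) 1, ‖q (N t) - p (N t) - n₀‖ < 2 * η' := fun t ht => by
    have h3 := (hp2 _ (hN1 t ht)).1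
    have h4 := (hq2 _ (hN2 t ht)).1
    rw [Metric.mem_ball, dist_eq_norm] at h3 h4
    have h5 : q (N t) - p (N t) - n₀ = (q (N t) - w) - (p (N t) - v) := by rw [hn₀]; abel
    rw [h5]
    exact (norm_sub_le _ _).trans_lt (by linarith)
  have hmom : ∀ t, |t| = 1 → ∃ D, |D| < κ * ‖n₀‖ ^ 2 ∧
      cross (N t) (q (N t) - p (N t)) = -(t * κ * ‖n₀‖ ^ 2) + D := by
    intro t ht
    have htI : t ∈ Set.Icc (-1 : ℝ) 1 := abs_le.1 ht.le
    refine ⟨cross (N t) (q (N t) - p (N t) - n₀), ?_, ?_⟩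
    · refine (abs_cross_le _ _).trans_lt ?_
      have h3 := hdist t htI
      have h4 := hNlt t htI
      calc ‖N t‖ * ‖q (N t) - p (N t) - n₀‖ < 2 * ‖n₀‖ * (2 * η') :=
            mul_lt_mul'' h4 h3 (norm_nonneg _) (norm_nonneg _)
        _ ≤ 2 * ‖n₀‖ * (2 * (κ * ‖n₀‖ / 4)) := by gcongr
        _ = κ * ‖n₀‖ ^ 2 := by ring
    · have h3 : cross (N t) n₀ = -(t * κ * ‖n₀‖ ^ 2) := hN ▸ cross_tilt_self n₀ κ t
      rw [cross_sub_right _ _ n₀, h3]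
      ring
  obtain ⟨D₁, hD₁, h3⟩ := hmom (-1) (by simp)
  obtain ⟨D₂, hD₂, h4⟩ := hmom 1 (by simp)
  have ha0 : a ≠ 0 := by rintro rfl; simp at ha
  have hb0 : b ≠ 0 := by rintro rfl; simp at hb
  obtain ⟨t, ht, hdiam⟩ := exists_isDiameter_of_arcs (F := F) (a := -1) (b := 1) (by norm_num)
    (p := fun t => p (N t)) (q := fun t => q (N t)) (n := N)
    (hp.comp hNc.continuousOn hN1) (hq.comp hNc.continuousOn hN2) hNc.continuousOn
    (fun t ht h0 => by have := hNpos t ht; rw [h0, inner_zero_left] at this; exact this.false)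
    (fun t ht hpq => by
      have := hdist t ht
      rw [hpq, sub_self, zero_sub, norm_neg] at this
      linarith)
    (fun t ht => by
      obtain ⟨-, h5, l, hl, h6⟩ := hp2 _ (hN1 t ht)
      exact ⟨h5, l, right_ne_zero_of_mul hl.ne', h6⟩)
    (fun t ht => by
      obtain ⟨-, h5, l, hl, h6⟩ := hq2 _ (hN2 t ht)
      exact ⟨h5, l, right_ne_zero_of_mul hl.ne', h6⟩)
    (by
      rw [h3, h4]
      have h5 := abs_lt.1 hD₁
      have h6 := abs_lt.1 hD₂
      exact mul_nonpos_of_nonneg_of_nonpos (by linarith) (by linarith))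
  obtain ⟨h5, -, l, hl, h6⟩ := hp2 _ (hN1 t ht)
  obtain ⟨h7, -, l', hl', h8⟩ := hq2 _ (hN2 t ht)
  refine ⟨_, Metric.ball_subset_ball hη1 h5, _, Metric.ball_subset_ball hη1 h7, hdiam, ?_, ?_⟩
  · simp only [h6, real_inner_smul_left]
    rw [← mul_assoc]; exact mul_pos hl (hNpos t ht)
  · simp only [h8, real_inner_smul_left]
    rw [← mul_assoc]; exact mul_pos hl' (hNpos t ht)

end LineArrangement

/-- There is an arc of the curve near `f` with normal directions near `n₀`, such that the normal lines
at its two ends pass the points near `v` on different sides. -/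
def HasFootArc (F : MvPolynomial (Fin 2) ℝ) (v f n₀ : Plane) (κ η η' : ℝ) : Prop :=
  ∃ (a b : ℝ) (q N : ℝ → Plane) (e : ℝ), a ≤ b ∧ ContinuousOn q (Set.Icc a b) ∧
    ContinuousOn N (Set.Icc a b) ∧
    (∀ t ∈ Set.Icc a b, q t ∈ Metric.ball f η ∧ N t ∈ Metric.closedBall n₀ κ ∧
      polyVal F (q t) = 0 ∧ ∃ l : ℝ, l ≠ 0 ∧ polyGrad F (q t) = l • N t) ∧
    ∀ p ∈ Metric.ball v η', 0 < e * cross (N a) (q a - p) ∧ 0 < (-e) * cross (N b) (q b - p)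

lemma exists_cross_pos_nhds {N₀ q₀ p₀ : Plane} {e : ℝ} (h : 0 < e * cross N₀ (q₀ - p₀)) :
    ∃ θ > 0, ∀ N q p, ‖N - N₀‖ < θ → ‖q - q₀‖ < θ → ‖p - p₀‖ < θ →
      0 < e * cross N (q - p) := by
  have hc : Continuous fun x : Plane × Plane × Plane => e * cross x.1 (x.2.1 - x.2.2) := by fun_prop
  obtain ⟨θ, hθ, hb⟩ := Metric.eventually_nhds_iff.1
    ((hc.continuousAt (x := (N₀, q₀, p₀))).eventually_const_lt h)
  refine ⟨θ, hθ, fun N q p hN hq hp => hb (y := (N, q, p)) ?_⟩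
  rw [Prod.dist_eq, Prod.dist_eq, dist_eq_norm, dist_eq_norm, dist_eq_norm]
  exact max_lt hN (max_lt hq hp)

/-- An implicit function theorem for a curve that is crossed by all segments in a direction. -/
lemma exists_continuousOn_graph {F : MvPolynomial (Fin 2) ℝ} {f u n : Plane} {l c z₀ : ℝ}
    {S : Set ℝ} (hl : l ≠ 0) (hc : 0 < c) (hz₀ : 0 < z₀)
    (hgrad : ∀ y ∈ S, ∀ z ∈ Set.Icc (-z₀) z₀,
      -l * inner ℝ (polyGrad F (f + y • u + z • n)) n + c ≤ 0)
    (hmid : ∀ y ∈ S, |-l * polyVal F (f + y • u)| ≤ c * z₀) :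
    ∃ g : ℝ → ℝ, ContinuousOn g S ∧ ∀ y ∈ S, g y ∈ Set.Icc (-z₀) z₀ ∧
      polyVal F (f + y • u + g y • n) = 0 := by
  have hder : ∀ y z : ℝ, HasDerivAt (fun z => -l * polyVal F (f + y • u + z • n) + c * z)
      (-l * inner ℝ (polyGrad F (f + y • u + z • n)) n + c) z := fun y z => by
    have h1 : HasDerivAt (fun z : ℝ => f + y • u + z • n) n z := by
      simpa only [one_smul, id] using ((hasDerivAt_id z).smul_const n).const_add (f + y • u)
    have h2 := (hasFDerivAt_polyVal F (f + y • u + z • n)).comp_hasDerivAt z h1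
    have h3 : HasDerivAt (fun z : ℝ => c * z) c z := by
      simpa using (hasDerivAt_id z).const_mul c
    exact (h2.const_mul (-l)).add h3
  have hanti : ∀ y ∈ S,
      AntitoneOn (fun z => -l * polyVal F (f + y • u + z • n) + c * z) (Set.Icc (-z₀) z₀) :=
    fun y hy => antitoneOn_of_deriv_nonpos (convex_Icc _ _)
      (fun z _ => (hder y z).continuousAt.continuousWithinAt)
      (fun z _ => (hder y z).differentiableAt.differentiableWithinAt)
      (fun z hz => (hder y z).deriv ▸ hgrad y hy z (interior_subset hz))
  have h0mem : (0 : ℝ) ∈ Set.Icc (-z₀) z₀ := ⟨by linarith, hz₀.le⟩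
  have hzmem : z₀ ∈ Set.Icc (-z₀) z₀ := ⟨by linarith, le_rfl⟩
  have hzmem' : -z₀ ∈ Set.Icc (-z₀) z₀ := ⟨le_rfl, by linarith⟩
  obtain ⟨g, hgc, hg2⟩ := exists_continuousOn_root (S := S)
    (f := fun y z => -l * polyVal F (f + y • u + z • n)) (a := -z₀) (b := z₀) (by linarith)
    (Continuous.continuousOn (continuous_const.mul ((continuous_polyVal F).comp (by fun_prop))))
    (fun y hy z hz w hw hzw => by
      have := hanti y hy hz hw hzw.le
      simp only at this ⊢
      nlinarith)
    (fun y hy => by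
      have h1 := hanti y hy hzmem' h0mem (by linarith)
      have h2 := (abs_le.1 (hmid y hy)).1
      simp only [zero_smul, add_zero] at h1 h2 ⊢
      linarith)
    (fun y hy => by
      have h1 := hanti y hy h0mem hzmem hz₀.le
      have h2 := (abs_le.1 (hmid y hy)).2
      simp only [zero_smul, add_zero] at h1 h2 ⊢
      linarith)
  exact ⟨g, hgc, fun y hy => ⟨(hg2 y hy).1, (mul_eq_zero.1 (hg2 y hy).2).resolve_left
    (neg_ne_zero.2 hl)⟩⟩

namespace LineArrangement

variable {d : ℕ} (A : LineArrangement d)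

lemma eventually_grad_close (x : Plane) {θ : ℝ} (hθ : 0 < θ) : ∃ ω > 0, ∀ᶠ F in A.deformations,
    ∀ y ∈ Metric.ball x ω, ‖polyGrad F y - polyGrad A.poly x‖ < θ := by
  obtain ⟨ω, hω, hb⟩ := Metric.continuousAt_iff.1
    ((continuous_polyGrad A.poly).continuousAt (x := x)) (θ / 2) (by positivity)
  refine ⟨ω, hω, ?_⟩
  filter_upwards [A.eventually_close (‖x‖ + ω) (ε := θ / 3) (by positivity)] with F hF y hy
  have hy' := hy
  rw [Metric.mem_ball, dist_eq_norm] at hy'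
  have h1 := hb hy
  rw [dist_eq_norm] at h1
  have h2 := (hF y (by linarith [norm_sub_norm_le y x])).2.1
  have := norm_add_le (polyGrad F y - polyGrad A.poly y) (polyGrad A.poly y - polyGrad A.poly x)
  rw [sub_add_sub_cancel] at this
  linarith

variable {v : Plane} {H : Plane ≃L[ℝ] Plane}

/-- Diameters near an altitude. -/
lemma eventually_diameters_of_footArc (hv0 : polyVal A.poly v = 0) (hv : polyGrad A.poly v = 0)
    (hH : (H : Plane →L[ℝ] Plane) = polyHess A.poly v) {f : Plane} {s : ℝ}
    (hs : s * inner ℝ (f - v) (H.symm (f - v)) < 0) {Q : MvPolynomial (Fin 2) ℝ → ℝ → Prop}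
    (hQ : ∀ F η₁ η₂, η₁ ≤ η₂ → Q F η₂ → Q F η₁)
    (hfoot : ∀ κ > 0, ∀ η > 0, ∃ η' > 0, ∀ᶠ F in A.deformations, Q F η →
      HasFootArc F v f (f - v) κ η η') {η : ℝ} (hη : 0 < η) :
    ∀ᶠ F in A.deformations, CriticalPos F v η s → Q F η →
      ∀ a : ℝ, a * a = 1 → ∃ p ∈ Metric.ball v η, ∃ q ∈ Metric.ball f η,
        IsDiameter F p q ∧ 0 < a * inner ℝ (polyGrad F p) (f - v) := by
  set n₀ := f - v with hn₀
  have hn : 0 < ‖n₀‖ := norm_pos_iff.2 (by intro h; rw [h] at hs; simp at hs)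
  obtain ⟨κ, hκ, hκ', hbr⟩ := A.eventually_branches hv0 hv hH hs
  set η₁ := min η (‖n₀‖ / 2) with hη₁
  have hη₁0 : 0 < η₁ := by positivity
  obtain ⟨η', hη', hft⟩ := hfoot κ hκ η₁ hη₁0
  set η₂ := min η₁ η' with hη₂
  have hη₂0 : 0 < η₂ := lt_min hη₁0 hη'
  have h21 : η₂ ≤ η₁ := min_le_left _ _
  have h1η : η₁ ≤ η := min_le_left _ _
  filter_upwards [hbr η₂ hη₂0, hft] with F hF1 hF2 hcrit hq a ha
  obtain ⟨p, hp, hp2⟩ := hF1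
    (fun c hc => hcrit c (Metric.ball_subset_ball (h21.trans h1η) hc)) a ha
  obtain ⟨t₁, t₂, q, N, e, ht, hqc, hN, hq2, hsign⟩ := hF2 (hQ F _ _ h1η hq)
  have hNpos : ∀ t ∈ Set.Icc t₁ t₂, 0 < inner ℝ (N t) n₀ := fun t ht =>
    inner_pos_of_mem_window hκ' (hq2 t ht).2.1
  have hs1 := (hsign _ (Metric.ball_subset_ball (min_le_right _ _)
    (hp2 _ (hq2 t₁ (Set.left_mem_Icc.2 ht)).2.1).1)).1
  have hs2 := (hsign _ (Metric.ball_subset_ball (min_le_right _ _)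
    (hp2 _ (hq2 t₂ (Set.right_mem_Icc.2 ht)).2.1).1)).2
  obtain ⟨t, ht, hdiam⟩ := exists_isDiameter_of_arcs (F := F) ht
    (p := fun t => p (N t)) (q := q) (n := N)
    (hp.comp hN fun t ht => (hq2 t ht).2.1) hqc hN
    (fun t ht h0 => by have := hNpos t ht; rw [h0, inner_zero_left] at this; exact this.false)
    (fun t ht hpq => by
      have h1 := (hp2 _ (hq2 t ht).2.1).1
      have h2 := (hq2 t ht).1
      rw [hpq, Metric.mem_ball] at h1
      rw [Metric.mem_ball] at h2
      have h3 := dist_triangle_left f v (q t)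
      rw [dist_eq_norm f v, ← hn₀] at h3
      have h4 : η₁ ≤ ‖n₀‖ / 2 := min_le_right _ _
      linarith)
    (fun t ht => by
      obtain ⟨-, h5, l, hl, h6⟩ := hp2 _ (hq2 t ht).2.1
      exact ⟨h5, l, right_ne_zero_of_mul hl.ne', h6⟩)
    (fun t ht => (hq2 t ht).2.2)
    (by nlinarith [mul_pos hs1 hs2, sq_nonneg e])
  obtain ⟨h5, -, l, hl, h6⟩ := hp2 _ (hq2 t ht).2.1
  refine ⟨_, Metric.ball_subset_ball (h21.trans h1η) h5, _, Metric.ball_subset_ball h1η (hq2 t ht).1,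
    hdiam, ?_⟩
  simp only [h6, real_inner_smul_left]
  rw [← mul_assoc]; exact mul_pos hl (hNpos t ht)

lemma eventually_cross_pos {x n₀ : Plane} {l φ e : ℝ} (hl : l ≠ 0)
    (hgrad : polyGrad A.poly x = φ • n₀) (hpos : 0 < e * cross ((φ / l) • n₀) (x - v)) :
    ∃ θ > 0, ∃ ω > 0, ∀ᶠ F in A.deformations, ∀ q ∈ Metric.ball x ω, ∀ p ∈ Metric.ball v θ,
      0 < e * cross (l⁻¹ • polyGrad F q) (q - p) := by
  have hl' : 0 < |l| := abs_pos.2 hl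
  obtain ⟨θ, hθ, hcr⟩ := exists_cross_pos_nhds hpos
  obtain ⟨ω, hω, hgr⟩ := A.eventually_grad_close x (θ := |l| * θ) (by positivity)
  refine ⟨θ, hθ, min θ ω, lt_min hθ hω, ?_⟩
  filter_upwards [hgr] with F hF q hq p hp
  refine hcr _ _ _ ?_ ?_ ?_
  · have h1 := hF q (Metric.ball_subset_ball (min_le_right _ _) hq)
    have h2 : l⁻¹ • polyGrad F q - (φ / l) • n₀ = l⁻¹ • (polyGrad F q - φ • n₀) := by
      rw [smul_sub, smul_smul]; congr 2; ring
    rw [h2, norm_smul, norm_inv, Real.norm_eq_abs, inv_mul_lt_iff₀ hl', ← hgrad]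
    exact h1
  · rw [← dist_eq_norm]; exact (Metric.mem_ball.1 hq).trans_le (min_le_left _ _)
  · rw [← dist_eq_norm]; exact hp

/-- The arc near the foot of an altitude that is not a vertex. -/
lemma eventually_footArc_of_regular {f n₀ : Plane} {l : ℝ} {φ : ℝ → ℝ} (hn₀ : n₀ ≠ 0) (hl : l ≠ 0)
    (hvf : f - v = n₀) (hgrad : polyGrad A.poly f = l • n₀)
    (hline : ∀ t : ℝ, polyVal A.poly (f + t • rot n₀) = 0)
    (hφ : ∀ t : ℝ, polyGrad A.poly (f + t • rot n₀) = φ t • n₀) {κ η : ℝ} (hκ : 0 < κ)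
    (hη : 0 < η) : ∃ η' > 0, ∀ᶠ F in A.deformations, HasFootArc F v f n₀ κ η η' := by
  have hn : 0 < ‖n₀‖ := norm_pos_iff.2 hn₀
  have hl' : 0 < |l| := abs_pos.2 hl
  set μ := |l| * min κ (‖n₀‖ / 2) with hμ
  have hμ0 : 0 < μ := by positivity
  obtain ⟨ω₀, hω₀, hg⟩ := A.eventually_grad_close f hμ0
  have hgG := eventually_deformations.self A hg
  rw [hgrad] at hg hgG
  set ω := min ω₀ η with hω
  have hω0 : 0 < ω := lt_min hω₀ hη
  set y₀ := ω / (4 * ‖n₀‖) with hy₀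
  have hy₀0 : 0 < y₀ := by positivity
  have hy₀n : y₀ * ‖n₀‖ = ω / 4 := by rw [hy₀]; field_simp
  have hbox : ∀ y z : ℝ, |y| ≤ y₀ → |z| ≤ y₀ →
      f + y • rot n₀ + z • n₀ ∈ Metric.ball f ω := fun y z hy hz => by
    rw [Metric.mem_ball, dist_eq_norm, add_assoc, add_sub_cancel_left]
    refine (norm_add_le _ _).trans_lt ?_
    rw [norm_smul, norm_smul, norm_rot, Real.norm_eq_abs, Real.norm_eq_abs]
    have h1 : |y| * ‖n₀‖ ≤ y₀ * ‖n₀‖ := by gcongr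
    have h2 : |z| * ‖n₀‖ ≤ y₀ * ‖n₀‖ := by gcongr
    linarith
  have hφpos : ∀ y, |y| ≤ y₀ → 0 < φ y / l := fun y hy => by
    have h1 := hgG _ (Metric.ball_subset_ball (min_le_left _ _)
      (hbox y 0 hy (by simpa using hy₀0.le)))
    rw [zero_smul, add_zero, hφ, ← sub_smul, norm_smul, Real.norm_eq_abs] at h1
    have h2 : μ ≤ |l| * (‖n₀‖ / 2) := by rw [hμ]; gcongr; exact min_le_right _ _
    have h3 : |φ y - l| < |l| := by
      by_contra! h
      have : |l| * ‖n₀‖ ≤ |φ y - l| * ‖n₀‖ := by gcongr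
      nlinarith
    rcases hl.lt_or_gt with h | h
    · rw [abs_of_neg h] at h3
      exact div_pos_of_neg_of_neg (by linarith [(abs_lt.1 h3).2]) h
    · rw [abs_of_pos h] at h3
      exact div_pos (by linarith [(abs_lt.1 h3).1]) h
  have hend : ∀ e : ℝ, |e| = 1 → ∃ θ > 0, ∃ ω₁ > 0, ∀ᶠ F in A.deformations,
      ∀ q ∈ Metric.ball (f + (e * y₀) • rot n₀) ω₁, ∀ p ∈ Metric.ball v θ,
        0 < e * cross (l⁻¹ • polyGrad F q) (q - p) := by
    intro e he
    have he2 : e * e = 1 := by rw [← abs_mul_abs_self, he, one_mul]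
    refine A.eventually_cross_pos hl (hφ _) ?_
    rw [add_sub_right_comm, hvf, cross_smul_left, cross_add_right, cross_smul_right,
      cross_self_eq_zero, cross_rot_self]
    have := hφpos (e * y₀) (by rw [abs_mul, he, one_mul, abs_of_pos hy₀0])
    calc 0 < (φ (e * y₀) / l) * y₀ * ‖n₀‖ ^ 2 := by positivity
      _ = (e * e) * ((φ (e * y₀) / l) * y₀ * ‖n₀‖ ^ 2) := by rw [he2, one_mul]
      _ = _ := by ring
  obtain ⟨θ₁, hθ₁, ω₁, hω₁, hend1⟩ := hend 1 (by simp)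
  obtain ⟨θ₂, hθ₂, ω₂, hω₂, hend2⟩ := hend (-1) (by simp)
  set z₀ := min y₀ (min ω₁ ω₂ / (2 * ‖n₀‖)) with hz₀
  have hz₀0 : 0 < z₀ := by positivity
  have hzy : z₀ ≤ y₀ := min_le_left _ _
  have hzn : z₀ * ‖n₀‖ < min ω₁ ω₂ := by
    have h1 : 0 < min ω₁ ω₂ := lt_min hω₁ hω₂
    calc z₀ * ‖n₀‖ ≤ min ω₁ ω₂ / (2 * ‖n₀‖) * ‖n₀‖ := by gcongr; exact min_le_right _ _
      _ = min ω₁ ω₂ / 2 := by field_simp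
      _ < min ω₁ ω₂ := by linarith
  set c := l ^ 2 * ‖n₀‖ ^ 2 / 2 with hc
  have hc0 : 0 < c := by positivity
  refine ⟨min θ₁ θ₂, lt_min hθ₁ hθ₂, ?_⟩
  filter_upwards [hg, hend1, hend2, A.eventually_close (‖f‖ + ω) (ε := c * z₀ / |l|) (by positivity)]
    with F hF hF1 hF2 hF3
  have hIcc : ∀ {t u : ℝ}, t ∈ Set.Icc (-u) u → |t| ≤ u := fun ht => abs_le.2 ht
  have hmem : ∀ y ∈ Set.Icc (-y₀) y₀, ∀ z ∈ Set.Icc (-z₀) z₀,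
      f + y • rot n₀ + z • n₀ ∈ Metric.ball f ω :=
    fun y hy z hz => hbox y z (hIcc hy) ((hIcc hz).trans hzy)
  obtain ⟨g, hgc, hg2⟩ := exists_continuousOn_graph (F := F) (f := f) (u := rot n₀) (n := n₀)
    (S := Set.Icc (-y₀) y₀) hl hc0 hz₀0 (fun y hy z hz => by
      have h1 := hF _ (Metric.ball_subset_ball (min_le_left _ _) (hmem y hy z hz))
      have h2 := (abs_real_inner_le_norm _ n₀).trans
        (mul_le_mul_of_nonneg_right h1.le (norm_nonneg _))
      have h3 : μ ≤ |l| * (‖n₀‖ / 2) := by rw [hμ]; gcongr; exact min_le_right _ _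
      rw [inner_sub_left, real_inner_smul_left, real_inner_self_eq_norm_sq] at h2
      generalize inner ℝ (polyGrad F (f + y • rot n₀ + z • n₀)) n₀ = I at h2 ⊢
      have h4 : |l * (I - l * ‖n₀‖ ^ 2)| ≤ c := by
        rw [abs_mul]
        calc _ ≤ |l| * (μ * ‖n₀‖) := by gcongr
          _ ≤ |l| * (|l| * (‖n₀‖ / 2) * ‖n₀‖) := by gcongr
          _ = |l| * |l| * ‖n₀‖ ^ 2 / 2 := by ring
          _ = c := by rw [abs_mul_abs_self, hc]; ring
      have h5 := (abs_le.1 h4).1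
      have h6 : l * (l * ‖n₀‖ ^ 2) = 2 * c := by rw [hc]; ring
      linarith) (fun y hy => by
      have h1 := hmem y hy 0 ⟨by linarith, hz₀0.le⟩
      rw [zero_smul, add_zero, Metric.mem_ball, dist_eq_norm] at h1
      have h2 := (hF3 (f + y • rot n₀) (by linarith [norm_sub_norm_le (f + y • rot n₀) f])).1
      rw [hline, sub_zero] at h2
      rw [abs_mul, abs_neg]
      calc _ ≤ |l| * (c * z₀ / |l|) := by gcongr
        _ = c * z₀ := by field_simp)
  have hqc : ContinuousOn (fun y => f + y • rot n₀ + g y • n₀) (Set.Icc (-y₀) y₀) := by fun_prop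
  have hclose : ∀ y ∈ Set.Icc (-y₀) y₀,
      ‖f + y • rot n₀ + g y • n₀ - (f + y • rot n₀)‖ < min ω₁ ω₂ := fun y hy => by
    rw [add_sub_cancel_left, norm_smul, Real.norm_eq_abs]
    have := hIcc (hg2 y hy).1
    exact (mul_le_mul_of_nonneg_right this hn.le).trans_lt hzn
  have hym : y₀ ∈ Set.Icc (-y₀) y₀ := ⟨by linarith, le_rfl⟩
  have hym' : -y₀ ∈ Set.Icc (-y₀) y₀ := ⟨le_rfl, by linarith⟩
  refine ⟨-y₀, y₀, _, fun y => l⁻¹ • polyGrad F (f + y • rot n₀ + g y • n₀), -1, by linarith, hqc,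
    ((continuous_polyGrad F).comp_continuousOn hqc).const_smul l⁻¹,
    fun y hy => ⟨?_, ?_, (hg2 y hy).2, l, hl, ?_⟩, fun p hp => ⟨?_, ?_⟩⟩
  · exact Metric.ball_subset_ball (min_le_right _ _) (hmem y hy _ (hg2 y hy).1)
  · have h1 := hF _ (Metric.ball_subset_ball (min_le_left _ _) (hmem y hy _ (hg2 y hy).1))
    have h2 : ∀ ξ : Plane, l⁻¹ • ξ - n₀ = l⁻¹ • (ξ - l • n₀) := fun ξ => by
      rw [smul_sub, smul_smul, inv_mul_cancel₀ hl, one_smul]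
    rw [Metric.mem_closedBall, dist_eq_norm, h2, norm_smul, norm_inv, Real.norm_eq_abs,
      inv_mul_le_iff₀ hl']
    refine h1.le.trans ?_
    rw [hμ]; gcongr; exact min_le_left _ _
  · rw [smul_smul, mul_inv_cancel₀ hl, one_smul]
  · refine hF2 _ ?_ p (Metric.ball_subset_ball (min_le_right _ _) hp)
    rw [Metric.mem_ball, dist_eq_norm, neg_one_mul]
    exact (hclose _ hym').trans_le (min_le_right _ _)
  · rw [neg_neg]
    refine hF1 _ ?_ p (Metric.ball_subset_ball (min_le_left _ _) hp)
    rw [Metric.mem_ball, dist_eq_norm, one_mul]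
    exact (hclose _ hym).trans_le (min_le_left _ _)

end LineArrangement

lemma rot_ne_zero {x : Plane} (hx : x ≠ 0) : rot x ≠ 0 := by
  rw [← norm_ne_zero_iff, norm_rot]; exact norm_ne_zero_iff.2 hx

/-- The signs of a quadratic form on both sides of an isotropic line. -/
lemma exists_tilt_window {B : Plane →L[ℝ] Plane} (hB : ∀ x y, inner ℝ x (B y) = inner ℝ (B x) y)
    {n₀ τ : Plane} {s : ℝ} (hn₀ : inner ℝ n₀ (B n₀) = 0) (hτ : s * inner ℝ n₀ (B τ) < 0)
    {κ : ℝ} (hκ : 0 < κ) : ∃ k > 0, ∃ m > 0, ∃ ε > 0, k * ‖τ‖ ≤ κ ∧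
      ∀ T : Plane →L[ℝ] Plane, ‖T - B‖ ≤ ε →
        (∀ t ∈ Set.Icc (-1 : ℝ) 1, s * inner ℝ (n₀ + (t * k) • τ) (T τ) ≤ -m) ∧
        s * inner ℝ (n₀ + k • τ) (T (n₀ + k • τ)) ≤ -m ∧
        -s * inner ℝ (n₀ - k • τ) (T (n₀ - k • τ)) ≤ -m := by
  have hτ0 : τ ≠ 0 := by rintro rfl; simp at hτ
  have hτn : 0 < ‖τ‖ := norm_pos_iff.2 hτ0
  obtain ⟨κ₀, hκ₀, m, hm, hw⟩ := exists_window hτ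
  set k := min κ κ₀ / ‖τ‖ with hk
  have hk0 : 0 < k := by positivity
  have hkτ : k * ‖τ‖ = min κ κ₀ := by rw [hk]; field_simp
  have hwin : ∀ t ∈ Set.Icc (-1 : ℝ) 1, ‖n₀ + (t * k) • τ - n₀‖ ≤ κ₀ := fun t ht => by
    rw [add_sub_cancel_left, norm_smul, Real.norm_eq_abs, abs_mul, abs_of_pos hk0, mul_assoc, hkτ]
    calc |t| * min κ κ₀ ≤ 1 * κ₀ :=
          mul_le_mul (abs_le.2 ht) (min_le_right _ _) (by positivity) zero_le_one
      _ = κ₀ := one_mul _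
  have hq : ∀ t : ℝ, inner ℝ (n₀ + (t * k) • τ) (B (n₀ + (t * k) • τ))
      = t * k * (inner ℝ n₀ (B τ) + inner ℝ (n₀ + (t * k) • τ) (B τ)) := fun t => by
    have h1 : inner ℝ τ (B n₀) = inner ℝ n₀ (B τ) := by rw [hB, real_inner_comm]
    simp only [map_add, map_smul, inner_add_left, inner_add_right, real_inner_smul_left,
      real_inner_smul_right, hn₀, h1]
    ring
  have hBB : ‖B - B‖ ≤ κ₀ := by simpa using hκ₀.le
  have h1 := hw _ τ (hwin 1 (by norm_num)) (by simpa using hκ₀.le) B hBB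
  have h2 := hw _ τ (hwin (-1) (by norm_num)) (by simpa using hκ₀.le) B hBB
  have e1 : n₀ + ((1 : ℝ) * k) • τ = n₀ + k • τ := by rw [one_mul]
  have e2 : n₀ + ((-1 : ℝ) * k) • τ = n₀ - k • τ := by module
  have hq1 := hq 1
  have hq2 := hq (-1)
  rw [e1] at h1 hq1
  rw [e2] at h2 hq2
  obtain ⟨κ₁, hκ₁, m₁, hm₁, hw₁⟩ := exists_window (B := B) (n₀ := n₀ + k • τ) (e₀ := n₀ + k • τ)
    (s := s) (by rw [hq1]; nlinarith)
  obtain ⟨κ₂, hκ₂, m₂, hm₂, hw₂⟩ := exists_window (B := B) (n₀ := n₀ - k • τ) (e₀ := n₀ - k • τ)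
    (s := -s) (by rw [hq2]; nlinarith)
  refine ⟨k, hk0, min m (min m₁ m₂), by positivity, min κ₀ (min κ₁ κ₂), by positivity,
    hkτ.le.trans (min_le_left _ _), fun T hT => ⟨fun t ht => ?_, ?_, ?_⟩⟩
  · refine (hw _ τ (hwin t ht) (by simpa using hκ₀.le) T (hT.trans (min_le_left _ _))).trans ?_
    exact neg_le_neg (min_le_left _ _)
  · refine (hw₁ _ _ (by simpa using hκ₁.le) (by simpa using hκ₁.le) T
      (hT.trans ((min_le_right _ _).trans (min_le_left _ _)))).trans ?_
    exact neg_le_neg ((min_le_right _ _).trans (min_le_left _ _))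
  · refine (hw₂ _ _ (by simpa using hκ₂.le) (by simpa using hκ₂.le) T
      (hT.trans ((min_le_right _ _).trans (min_le_right _ _)))).trans ?_
    exact neg_le_neg ((min_le_right _ _).trans (min_le_right _ _))

/-- The part of the curve near a vertex on which the normal direction turns from a direction in the
dual persistent cone almost to the normal of one of the lines. -/
lemma IsGradInverse.exists_turning_arc {F : MvPolynomial (Fin 2) ℝ} {w : Plane} {ρ R ε : ℝ}
    {B : Plane →L[ℝ] Plane} {P : Plane → Plane} (h : IsGradInverse F w ρ R ε B P) {n₀ τ : Plane}
    {s k m L a : ℝ} (hk : 0 < k) (hm : 0 < m) (hL : 0 < L) (ha : a * a = 1)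
    (hq : ∀ T : Plane →L[ℝ] Plane, ‖T - B‖ ≤ ε →
      (∀ t ∈ Set.Icc (-1 : ℝ) 1, s * inner ℝ (n₀ + (t * k) • τ) (T τ) ≤ -m) ∧
      s * inner ℝ (n₀ + k • τ) (T (n₀ + k • τ)) ≤ -m ∧
      -s * inner ℝ (n₀ - k • τ) (T (n₀ - k • τ)) ≤ -m)
    (hR : ∀ t ∈ Set.Icc (-1 : ℝ) 1, L * ‖n₀ + (t * k) • τ‖ < R)
    (hpos : 0 < s * polyVal F (P 0)) (hlt : s * polyVal F (P 0) < m * L ^ 2 / 2) :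
    ∃ l g, 0 < l ∧ l ≤ L ∧ ContinuousOn g (Set.Icc l L) ∧ g l = 1 ∧
      L ^ 2 * k * m * |g L| ≤ |s * polyVal F (P ((L * a) • n₀))| ∧
      ∀ u ∈ Set.Icc l L, g u ∈ Set.Icc (-1 : ℝ) 1 ∧
        polyVal F (P ((u * a) • (n₀ + (g u * k) • τ))) = 0 := by
  have hs : s ≠ 0 := by rintro rfl; simp at hpos
  have hna := norm_smul_of_mul_self_eq_one ha
  have h1mem : (1 : ℝ) ∈ Set.Icc (-1 : ℝ) 1 := by norm_num
  have h1mem' : (-1 : ℝ) ∈ Set.Icc (-1 : ℝ) 1 := by norm_num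
  have hone : n₀ + ((1 : ℝ) * k) • τ = n₀ + k • τ := by rw [one_mul]
  have hneg : n₀ + ((-1 : ℝ) * k) • τ = n₀ - k • τ := by module
  have hquad : ∀ (x : Plane) (T : Plane →L[ℝ] Plane),
      inner ℝ (a • x) (T (a • x)) = inner ℝ x (T x) := fun x T => by
    rw [map_smul, real_inner_smul_left, real_inner_smul_right, ← mul_assoc a, ha, one_mul]
  have hR1 : L * ‖a • (n₀ + k • τ)‖ < R := by rw [hna, ← hone]; exact hR 1 h1mem
  have hR2 : L * ‖a • (n₀ - k • τ)‖ < R := by rw [hna, ← hneg]; exact hR (-1) h1mem'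
  have hq1 : ∀ T : Plane →L[ℝ] Plane, ‖T - B‖ ≤ ε →
      s * inner ℝ (a • (n₀ + k • τ)) (T (a • (n₀ + k • τ))) ≤ -m := fun T hT => by
    rw [hquad]; exact (hq T hT).2.1
  have hq2 : ∀ T : Plane →L[ℝ] Plane, ‖T - B‖ ≤ ε →
      -s * inner ℝ (a • (n₀ - k • τ)) (T (a • (n₀ - k • τ))) ≤ -m := fun T hT => by
    rw [hquad]; exact (hq T hT).2.2
  obtain ⟨g₀, -, hg₀⟩ := h.exists_root_ray (W := {a • (n₀ + k • τ)}) (s := s) hm hL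
    (by rintro _ rfl; exact hR1) (by rintro _ rfl; exact hq1) hpos hlt
  obtain ⟨hl0, hlL, hroot⟩ := hg₀ _ rfl
  set l := g₀ (a • (n₀ + k • τ))
  have hnorm : ∀ u ∈ Set.Icc 0 L, ∀ t ∈ Set.Icc (-1 : ℝ) 1,
      ‖(u * a) • (n₀ + (t * k) • τ)‖ < R := fun u hu t ht => by
    rw [← smul_smul, norm_smul, hna, Real.norm_of_nonneg hu.1]
    exact (mul_le_mul_of_nonneg_right hu.2 (norm_nonneg _)).trans_lt (hR t ht)
  have hIcc : ∀ u ∈ Set.Icc l L, u ∈ Set.Icc 0 L := fun u hu => ⟨hl0.le.trans hu.1, hu.2⟩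
  have hanti : ∀ u ∈ Set.Icc 0 L, AntitoneOn (fun t : ℝ =>
      s * polyVal F (P ((u * a) • (n₀ + (t * k) • τ))) + u ^ 2 * k * m * t) (Set.Icc (-1) 1) := by
    intro u hu
    have hre : ∀ t : ℝ, (u * a) • n₀ + t • ((u * a * k) • τ) = (u * a) • (n₀ + (t * k) • τ) :=
      fun t => by module
    have := h.antitoneOn_line (ξ := (u * a) • n₀) (e := (u * a * k) • τ) (a := -1) (b := 1) (s := s)
      (φ := fun t => u ^ 2 * k * m * t) (φ' := fun _ => u ^ 2 * k * m)
      (fun t ht => by rw [hre]; exact hnorm u hu t ht)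
      (fun t => by simpa using (hasDerivAt_id t).const_mul (u ^ 2 * k * m))
      (fun t ht T hT => by
        rw [hre, map_smul, real_inner_smul_left, real_inner_smul_right]
        have h1 := (hq T hT).1 t ht
        have h2 : 0 ≤ u ^ 2 * k := by positivity
        calc _ = (a * a) * (u ^ 2 * k * (s * inner ℝ (n₀ + (t * k) • τ) (T τ))) + u ^ 2 * k * m := by
              ring
          _ ≤ 0 := by rw [ha]; nlinarith)
    simpa only [hre] using this
  have hposm : ∀ u ∈ Set.Icc 0 L, 0 < s * polyVal F (P ((u * a) • (n₀ - k • τ))) := fun u hu => by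
    have h1 := h.antitoneOn_ray (s := -s) (m := m) hR2 hq2 (Set.left_mem_Icc.2 hL.le) hu hu.1
    simp only [smul_smul, zero_mul, zero_smul] at h1
    have : 0 ≤ m * u ^ 2 / 2 := by positivity
    linarith
  have hnegp : ∀ u ∈ Set.Icc l L, s * polyVal F (P ((u * a) • (n₀ + k • τ))) ≤ 0 := fun u hu => by
    have h1 := (h.strictAntiOn_ray hm hR1 hq1).antitoneOn ⟨hl0.le, hlL.le⟩ (hIcc u hu) hu.1
    rw [hroot, mul_zero, smul_smul] at h1
    exact h1
  have hsanti : ∀ u ∈ Set.Icc l L, StrictAntiOn (fun t : ℝ =>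
      s * polyVal F (P ((u * a) • (n₀ + (t * k) • τ)))) (Set.Icc (-1) 1) := by
    intro u hu t ht t' ht' htt
    have h1 := hanti u (hIcc u hu) ht ht' htt.le
    have h2 : 0 < u ^ 2 * k * m := by
      have := hl0.trans_le hu.1
      positivity
    simp only at h1 ⊢
    nlinarith
  obtain ⟨g, hgc, hg⟩ := exists_continuousOn_root (S := Set.Icc l L)
    (f := fun u t => s * polyVal F (P ((u * a) • (n₀ + (t * k) • τ)))) (a := -1) (b := 1)
    (by norm_num)
    (continuousOn_const.mul ((continuous_polyVal F).comp_continuousOn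
      (h.continuousOn.comp (by fun_prop) fun p hp => hnorm p.1 (hIcc _ hp.1) p.2 hp.2)))
    hsanti (fun u hu => by rw [hneg]; exact (hposm u (hIcc u hu)).le)
    (fun u hu => by rw [hone]; exact hnegp u hu)
  refine ⟨l, g, hl0, hlL.le, hgc, ?_, ?_, fun u hu => ⟨(hg u hu).1,
    (mul_eq_zero.1 (hg u hu).2).resolve_left hs⟩⟩
  · have hlmem : l ∈ Set.Icc l L := Set.left_mem_Icc.2 hlL.le
    refine (hsanti l hlmem).injOn (hg l hlmem).1 h1mem ?_
    simp only [(hg l hlmem).2, hone]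
    rw [← smul_smul, hroot, mul_zero]
  · have hLmem : L ∈ Set.Icc l L := Set.right_mem_Icc.2 hlL.le
    have h0mem : (0 : ℝ) ∈ Set.Icc (-1 : ℝ) 1 := by norm_num
    have h0 := (hg L hLmem).2
    have hz : n₀ + ((0 : ℝ) * k) • τ = n₀ := by simp
    rcases le_total 0 (g L) with hg0 | hg0
    · have h1 := hanti L (hIcc L hLmem) h0mem (hg L hLmem).1 hg0
      simp only [h0, hz] at h1
      rw [abs_of_nonneg hg0]
      exact le_trans (by linarith) (le_abs_self _)
    · have h1 := hanti L (hIcc L hLmem) (hg L hLmem).1 h0mem hg0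
      simp only [h0, hz] at h1
      rw [abs_of_nonpos hg0]
      exact le_trans (by linarith) (neg_le_abs _)

namespace LineArrangement

variable {d : ℕ} (A : LineArrangement d) {v w : Plane} {H : Plane ≃L[ℝ] Plane}

set_option maxHeartbeats 800000 in
/-- The arc near the foot of an altitude that is a vertex. -/
lemma eventually_footArc_of_vertex (hw0 : polyVal A.poly w = 0) (hw : polyGrad A.poly w = 0)
    (hH : (H : Plane →L[ℝ] Plane) = polyHess A.poly w)
    (hsymm : ∀ x y, inner ℝ x (H.symm y) = inner ℝ (H.symm x) y)
    {n₀ : Plane} {β s : ℝ} {φ : ℝ → ℝ} (hn₀ : n₀ ≠ 0) (hβ : β ≠ 0) (hs : s ≠ 0)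
    (hvw : w - v = n₀) (hHn : H.symm n₀ = β • rot n₀)
    (hline : ∀ t : ℝ, polyVal A.poly (w + t • rot n₀) = 0)
    (hφ : ∀ t : ℝ, polyGrad A.poly (w + t • rot n₀) = φ t • n₀) {κ η : ℝ} (hκ : 0 < κ)
    (hη : 0 < η) : ∃ η' > 0, ∀ᶠ F in A.deformations, CriticalPos F w η s →
      HasFootArc F v w n₀ κ η η' := by
  have hn : 0 < ‖n₀‖ := norm_pos_iff.2 hn₀
  obtain ⟨e, he, hse⟩ : ∃ e : ℝ, e * e = 1 ∧ s * β * e < 0 := by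
    rcases (mul_ne_zero hs hβ).lt_or_gt with h | h
    · exact ⟨1, by norm_num, by linarith⟩
    · exact ⟨-1, by norm_num, by linarith⟩
  set τ := e • rot n₀ with hτ
  have hτn : ‖τ‖ = ‖n₀‖ := by rw [hτ, norm_smul_of_mul_self_eq_one he, norm_rot]
  have hcr1 : cross n₀ τ = e * ‖n₀‖ ^ 2 := by rw [hτ, cross_smul_right, cross_rot_self]
  have hcr2 : cross τ n₀ = -e * ‖n₀‖ ^ 2 := by
    rw [hτ, cross_smul_left, cross_rot_left_self]; ring
  set B : Plane →L[ℝ] Plane := (H.symm : Plane →L[ℝ] Plane) with hB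
  have hBn : inner ℝ n₀ (B τ) = β * e * ‖n₀‖ ^ 2 := by
    change inner ℝ n₀ (H.symm τ) = _
    rw [hsymm, hHn, hτ, real_inner_smul_left, real_inner_smul_right, real_inner_self_eq_norm_sq,
      norm_rot]
    ring
  obtain ⟨k, hk, m, hm, ε, hε, hkτ, hq⟩ := exists_tilt_window (B := B) (n₀ := n₀) (τ := τ) (s := s)
    hsymm (by
      change inner ℝ n₀ (H.symm n₀) = _
      rw [hHn, real_inner_smul_right, real_inner_comm, inner_rot, cross_self_eq_zero, mul_zero])
    (by
      rw [hBn]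
      calc s * (β * e * ‖n₀‖ ^ 2) = s * β * e * ‖n₀‖ ^ 2 := by ring
        _ < 0 := mul_neg_of_neg_of_pos hse (by positivity))
    (κ := min κ ‖n₀‖) (by positivity)
  have hkn : k * ‖n₀‖ ≤ min κ ‖n₀‖ := hτn ▸ hkτ
  obtain ⟨θ₁, hθ₁, hend1⟩ := exists_cross_pos_nhds (N₀ := n₀ + k • τ) (q₀ := w) (p₀ := v) (e := -e) (by
    rw [hvw, cross_add_left, cross_smul_left, cross_self_eq_zero, hcr2]
    calc 0 < k * ‖n₀‖ ^ 2 := by positivity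
      _ = (e * e) * (k * ‖n₀‖ ^ 2) := by rw [he, one_mul]
      _ = _ := by ring)
  obtain ⟨ρ, hρ, hρη, R, hR, hP⟩ := A.exists_isGradInverse w hw H hH hε
    (ρ₀ := min η θ₁) (by positivity)
  have hρη' : ρ ≤ η := hρη.trans (min_le_left _ _)
  have hρθ : ρ ≤ θ₁ := hρη.trans (min_le_right _ _)
  obtain ⟨y, hy0, hyρ, hyR⟩ : ∃ y : ℝ, 0 < y ∧ y * ‖n₀‖ < ρ ∧
      2 * ‖polyGrad A.poly (w + y • τ)‖ < R := by
    have hc : Continuous fun y : ℝ => 2 * ‖polyGrad A.poly (w + y • τ)‖ := by fun_prop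
    have h1 : ∀ᶠ y in 𝓝[>] (0 : ℝ), 2 * ‖polyGrad A.poly (w + y • τ)‖ < R :=
      (hc.continuousAt.eventually_lt_const (by simp [hw, hR])).filter_mono nhdsWithin_le_nhds
    have hc2 : Continuous fun y : ℝ => y * ‖n₀‖ := by fun_prop
    have h2 : ∀ᶠ y in 𝓝[>] (0 : ℝ), y * ‖n₀‖ < ρ :=
      (hc2.continuousAt.eventually_lt_const (by simpa using hρ)).filter_mono nhdsWithin_le_nhds
    obtain ⟨y, h3, h4, h5⟩ := (h1.and (h2.and self_mem_nhdsWithin)).exists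
    exact ⟨y, h5, h4, h3⟩
  set x := w + y • τ with hx
  have hx' : x = w + (y * e) • rot n₀ := by rw [hx, hτ, smul_smul]
  have hxball : x ∈ Metric.ball w ρ := by
    rw [Metric.mem_ball, dist_eq_norm, hx, add_sub_cancel_left, norm_smul, hτn,
      Real.norm_of_nonneg hy0.le]
    exact hyρ
  have hxw : x ≠ w := fun h => by
    rw [hx, add_eq_left] at h
    have h2 := congrArg norm h
    rw [norm_smul, hτn, norm_zero, Real.norm_of_nonneg hy0.le] at h2
    exact (mul_pos hy0 hn).ne' h2
  have hx0 : polyVal A.poly x = 0 := by rw [hx']; exact hline _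
  have hxg : polyGrad A.poly x = φ (y * e) • n₀ := by rw [hx']; exact hφ _
  obtain ⟨P₀, hP₀⟩ := eventually_deformations.self A hP
  have hφ0 : φ (y * e) ≠ 0 := fun h => hxw <| by
    rw [h, zero_smul] at hxg
    rw [← hP₀.leftInv x hxball, hxg, ← hw, hP₀.leftInv w (Metric.mem_ball_self hρ)]
  obtain ⟨L, a, hL, ha, hLa⟩ : ∃ L a : ℝ, 0 < L ∧ a * a = 1 ∧ φ (y * e) = L * a := by
    rcases hφ0.lt_or_gt with h | h
    · exact ⟨-φ (y * e), -1, by linarith, by norm_num, by ring⟩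
    · exact ⟨φ (y * e), 1, h, by norm_num, by ring⟩
  rw [hLa] at hxg
  have hLR : 2 * (L * ‖n₀‖) < R := by
    rwa [hxg, ← smul_smul, norm_smul, norm_smul_of_mul_self_eq_one ha,
      Real.norm_of_nonneg hL.le] at hyR
  have hRt : ∀ t ∈ Set.Icc (-1 : ℝ) 1, L * ‖n₀ + (t * k) • τ‖ < R := fun t ht => by
    have h1 : ‖(t * k) • τ‖ ≤ ‖n₀‖ := by
      rw [norm_smul, hτn, Real.norm_eq_abs, abs_mul, abs_of_pos hk, mul_assoc]
      have := hkn.trans (min_le_right _ _)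
      have h3 : |t| ≤ 1 := abs_le.2 ht
      calc |t| * (k * ‖n₀‖) ≤ 1 * ‖n₀‖ := mul_le_mul h3 this (by positivity) zero_le_one
        _ = ‖n₀‖ := one_mul _
    have h2 := norm_add_le n₀ ((t * k) • τ)
    nlinarith
  obtain ⟨θ₂, hθ₂, hend2⟩ := exists_cross_pos_nhds (N₀ := n₀) (q₀ := x) (p₀ := v) (e := e) (by
    rw [hx, add_sub_right_comm, hvw, cross_add_right, cross_smul_right, cross_self_eq_zero, hcr1]
    calc 0 < y * ‖n₀‖ ^ 2 := by positivity
      _ = (e * e) * (y * ‖n₀‖ ^ 2) := by rw [he, one_mul]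
      _ = _ := by ring)
  set D := ‖n₀‖ * k * ((‖B‖ + ε) * L + 1) + 1 with hD
  have hD0 : 0 < D := by positivity
  set ζ := θ₂ / (2 * D) with hζ
  have hζ0 : 0 < ζ := by positivity
  have hs' : 0 < |s| := abs_pos.2 hs
  set μ := min (θ₂ / 4) (L ^ 2 * k * m * ζ / |s|) with hμ
  have hμ0 : 0 < μ := by positivity
  refine ⟨min θ₁ θ₂, lt_min hθ₁ hθ₂, ?_⟩
  filter_upwards [hP, A.eventually_critical_small hw0 hw hε.le hρ hR hρη' (s := s) (B := B)
      (μ := m * L ^ 2 / 2) (by positivity),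
    A.eventually_gradInverse_close (B := B) (R := R) hε.le hxball
      (by linarith [norm_nonneg (polyGrad A.poly x)]) hx0 hμ0]
    with F ⟨P, hP⟩ hcs hcl hcrit
  obtain ⟨hpos, hlt⟩ := hcs hcrit P hP
  obtain ⟨hcl1, hcl2⟩ := hcl P hP
  rw [hxg] at hcl1 hcl2
  obtain ⟨l, g, hl, hlL, hgc, hgl, hgL, hg⟩ := hP.exists_turning_arc hk hm hL ha hq hRt hpos hlt
  have hnorm : ∀ u ∈ Set.Icc l L, ‖(u * a) • (n₀ + (g u * k) • τ)‖ < R := fun u hu => by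
    rw [← smul_smul, norm_smul, norm_smul_of_mul_self_eq_one ha,
      Real.norm_of_nonneg (hl.le.trans hu.1)]
    exact (mul_le_mul_of_nonneg_right hu.2 (norm_nonneg _)).trans_lt (hRt _ (hg u hu).1)
  have hlmem : l ∈ Set.Icc l L := Set.left_mem_Icc.2 hlL
  have hLmem : L ∈ Set.Icc l L := Set.right_mem_Icc.2 hlL
  have hNc : ContinuousOn (fun u => n₀ + (g u * k) • τ) (Set.Icc l L) := by fun_prop
  refine ⟨l, L, fun u => P ((u * a) • (n₀ + (g u * k) • τ)), fun u => n₀ + (g u * k) • τ, -e, hlL,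
    hP.continuousOn.comp (by fun_prop) hnorm, hNc, fun u hu => ⟨?_, ?_, (hg u hu).2, u * a, ?_, ?_⟩,
    fun p hp => ⟨?_, ?_⟩⟩
  · exact Metric.ball_subset_ball hρη' (hP.mem _ (hnorm u hu))
  · rw [Metric.mem_closedBall, dist_eq_norm, add_sub_cancel_left, norm_smul, hτn, Real.norm_eq_abs,
      abs_mul, abs_of_pos hk, mul_assoc]
    have := hkn.trans (min_le_left _ _)
    have h3 : |g u| ≤ 1 := abs_le.2 (hg u hu).1
    calc |g u| * (k * ‖n₀‖) ≤ 1 * κ := mul_le_mul h3 this (by positivity) zero_le_one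
      _ = κ := one_mul _
  · have h1 : 0 < u := hl.trans_le hu.1
    have h2 : a ≠ 0 := by rintro rfl; simp at ha
    exact mul_ne_zero h1.ne' h2
  · exact hP.grad _ (hnorm u hu)
  · refine hend1 _ _ _ ?_ ?_ ?_
    · simp only [hgl, one_mul, sub_self, norm_zero]; exact hθ₁
    · rw [← dist_eq_norm]
      exact (Metric.mem_ball.1 (hP.mem _ (hnorm l hlmem))).trans_le hρθ
    · rw [← dist_eq_norm]; exact (Metric.mem_ball.1 hp).trans_le (min_le_left _ _)
  · rw [neg_neg]
    have hgLζ : |g L| ≤ ζ := by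
      have h1 : |s * polyVal F (P ((L * a) • n₀))| ≤ L ^ 2 * k * m * ζ := by
        rw [abs_mul]
        calc _ ≤ |s| * (L ^ 2 * k * m * ζ / |s|) := by
              gcongr; exact hcl1.trans (min_le_right _ _)
          _ = _ := by field_simp
      exact le_of_mul_le_mul_left (hgL.trans h1) (by positivity)
    have hζD : D * ζ = θ₂ / 2 := by rw [hζ]; field_simp
    have hshift : ‖(g L * k) • τ‖ ≤ ‖n₀‖ * k * ζ := by
      rw [norm_smul, hτn, Real.norm_eq_abs, abs_mul, abs_of_pos hk]
      calc |g L| * k * ‖n₀‖ ≤ ζ * k * ‖n₀‖ := by gcongr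
        _ = _ := by ring
    have hnk : 0 ≤ ‖n₀‖ * k * ((‖B‖ + ε) * L) := by positivity
    have hnk' : 0 ≤ ‖n₀‖ * k := by positivity
    have hD1 : ‖n₀‖ * k ≤ D := by rw [hD]; linarith
    have hD2 : ‖n₀‖ * k * ((‖B‖ + ε) * L) ≤ D := by rw [hD]; linarith
    refine hend2 _ _ _ ?_ ?_ ?_
    · simp only [add_sub_cancel_left]
      have := mul_le_mul_of_nonneg_right hD1 hζ0.le
      linarith
    · have h1 := hP.approx (hnorm L hLmem) (ζ := (L * a) • n₀) (by
        have := hRt 0 (by norm_num)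
        rw [zero_mul, zero_smul, add_zero] at this
        rwa [← smul_smul, norm_smul, norm_smul_of_mul_self_eq_one ha, Real.norm_of_nonneg hL.le])
      rw [← smul_sub, add_sub_cancel_left] at h1
      have h2 : ‖(L * a) • (g L * k) • τ‖ ≤ L * (‖n₀‖ * k * ζ) := by
        rw [← smul_smul, norm_smul, norm_smul_of_mul_self_eq_one ha, Real.norm_of_nonneg hL.le]
        gcongr
      have h3 : ‖P ((L * a) • (n₀ + (g L * k) • τ)) - P ((L * a) • n₀)‖
          ≤ (‖B‖ + ε) * (L * (‖n₀‖ * k * ζ)) := by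
        have h4 := B.le_opNorm ((L * a) • (g L * k) • τ)
        have h5 := norm_le_norm_add_norm_sub'
          (P ((L * a) • (n₀ + (g L * k) • τ)) - P ((L * a) • n₀)) (B ((L * a) • (g L * k) • τ))
        calc _ ≤ (‖B‖ + ε) * ‖(L * a) • (g L * k) • τ‖ := by linarith
          _ ≤ _ := by gcongr
      have h6 := norm_add_le (P ((L * a) • (n₀ + (g L * k) • τ)) - P ((L * a) • n₀))
        (P ((L * a) • n₀) - x)
      rw [sub_add_sub_cancel] at h6
      have h7 : μ ≤ θ₂ / 4 := min_le_left _ _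
      have h8 : (‖B‖ + ε) * (L * (‖n₀‖ * k * ζ)) ≤ θ₂ / 2 := by
        calc _ = ‖n₀‖ * k * ((‖B‖ + ε) * L) * ζ := by ring
          _ ≤ D * ζ := by gcongr
          _ = θ₂ / 2 := hζD
      simp only
      linarith
    · rw [← dist_eq_norm]; exact (Metric.mem_ball.1 hp).trans_le (min_le_right _ _)

end LineArrangement

lemma polyHess_mul_apply (F G : MvPolynomial (Fin 2) ℝ) (x u : Plane) :
    polyHess (F * G) x u = polyVal F x • polyHess G x u + inner ℝ (polyGrad F x) u • polyGrad G x
      + (polyVal G x • polyHess F x u + inner ℝ (polyGrad G x) u • polyGrad F x) := by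
  have h1 := ((hasFDerivAt_polyVal F x).smul (hasFDerivAt_polyGrad G x)).add
    ((hasFDerivAt_polyVal G x).smul (hasFDerivAt_polyGrad F x))
  have h2 : polyGrad (F * G) = fun x => polyVal F x • polyGrad G x + polyVal G x • polyGrad F x :=
    funext (polyGrad_mul F G)
  have h3 := hasFDerivAt_polyGrad (F * G) x
  rw [h2] at h3
  rw [h3.unique h1]
  simp

lemma rot_smul (t : ℝ) (x : Plane) : rot (t • x) = t • rot x := by
  ext i; fin_cases i <;> simp [rot]

lemma cross_rot_left (x y : Plane) : cross (rot x) y = -inner ℝ x y := by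
  simp [inner_plane, rot, cross]; ring

lemma exists_smul_rot_of_inner_eq_zero {n u : Plane} (hn : n ≠ 0) (h : inner ℝ n u = 0) :
    ∃ t : ℝ, u = t • rot n :=
  exists_smul_of_cross_eq_zero (rot_ne_zero hn) (by rw [cross_rot_left, h, neg_zero])

lemma inner_rot_self (x : Plane) : inner ℝ x (rot x) = 0 := by
  rw [real_inner_comm, inner_rot, cross_self_eq_zero]

/-- The sum of the squares of the inner product and the determinant. -/
lemma inner_sq_add_cross_sq (x y : Plane) : inner ℝ x y ^ 2 + cross x y ^ 2 = (‖x‖ * ‖y‖) ^ 2 := by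
  rw [mul_pow, ← real_inner_self_eq_norm_sq, ← real_inner_self_eq_norm_sq, inner_plane,
    inner_plane, inner_plane, cross]
  ring

namespace LineArrangement

variable {d : ℕ} (A : LineArrangement d)

lemma polyVal_linePoly (i : Fin d) (x : Plane) :
    polyVal (A.linePoly i) x = inner ℝ (A.normal i) x - A.level i := by
  simp [polyVal, linePoly, inner_plane]

lemma polyGrad_linePoly (i : Fin d) (x : Plane) : polyGrad (A.linePoly i) x = A.normal i := by
  ext j; fin_cases j <;> simp [polyGrad, polyVal, linePoly, MvPolynomial.pderiv_X]

lemma polyHess_linePoly (i : Fin d) (x u : Plane) : polyHess (A.linePoly i) x u = 0 := by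
  have h := hasFDerivAt_polyGrad (A.linePoly i) x
  have h2 : polyGrad (A.linePoly i) = fun _ => A.normal i := funext (A.polyGrad_linePoly i)
  rw [h2] at h
  rw [h.unique (hasFDerivAt_const _ _)]
  rfl

variable {A} in
lemma polyVal_linePoly_eq_zero {i : Fin d} {x : Plane} :
    polyVal (A.linePoly i) x = 0 ↔ x ∈ A.line i := by
  rw [polyVal_linePoly, sub_eq_zero]; rfl

lemma polyVal_prod {ι : Type*} (S : Finset ι) (f : ι → MvPolynomial (Fin 2) ℝ) (x : Plane) :
    polyVal (∏ i ∈ S, f i) x = ∏ i ∈ S, polyVal (f i) x := by simp [polyVal]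

/-- The product of the equations of the lines, except for one of them. -/
def cofactor (k : Fin d) : MvPolynomial (Fin 2) ℝ := ∏ i ∈ Finset.univ.erase k, A.linePoly i

lemma poly_eq_mul_cofactor (k : Fin d) : A.poly = A.linePoly k * A.cofactor k :=
  (Finset.mul_prod_erase _ _ (Finset.mem_univ k)).symm

variable {A}

lemma polyVal_poly_of_mem_line {k : Fin d} {x : Plane} (hx : x ∈ A.line k) :
    polyVal A.poly x = 0 := by
  rw [A.poly_eq_mul_cofactor k, polyVal_mul, polyVal_linePoly_eq_zero.2 hx, zero_mul]

lemma polyGrad_poly_of_mem_line {k : Fin d} {x : Plane} (hx : x ∈ A.line k) :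
    polyGrad A.poly x = polyVal (A.cofactor k) x • A.normal k := by
  rw [A.poly_eq_mul_cofactor k, polyGrad_mul, polyVal_linePoly_eq_zero.2 hx, zero_smul, zero_add,
    polyGrad_linePoly]

lemma polyVal_cofactor_ne_zero {k : Fin d} {x : Plane} (hx : ∀ i, i ≠ k → x ∉ A.line i) :
    polyVal (A.cofactor k) x ≠ 0 := by
  rw [cofactor, polyVal_prod, Finset.prod_ne_zero_iff]
  intro i hi
  rw [Ne, polyVal_linePoly_eq_zero]
  exact hx i (Finset.ne_of_mem_erase hi)

lemma cross_normal_ne_zero (hA : A.StronglyGeneric) {i j : Fin d} (hij : i ≠ j) :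
    cross (A.normal i) (A.normal j) ≠ 0 := fun h => by
  obtain ⟨t, ht⟩ := exists_smul_of_cross_eq_zero (A.normal_ne_zero i) h
  have h1 := (LinearIndependent.pair_iff.1 (hA.not_parallel i j hij)) t (-1) (by rw [ht]; module)
  exact absurd h1.2 (by norm_num)

/-- The data of the second order part of the product at a vertex. -/
structure HessData (A : LineArrangement d) (i j : Fin d) (v : Plane) (C : ℝ)
    (H : Plane ≃L[ℝ] Plane) : Prop where
  ne : i ≠ j
  mem_left : v ∈ A.line i
  mem_right : v ∈ A.line j
  coeff_ne_zero : C ≠ 0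
  cross_ne_zero : cross (A.normal i) (A.normal j) ≠ 0
  val : polyVal A.poly v = 0
  grad : polyGrad A.poly v = 0
  hess : (H : Plane →L[ℝ] Plane) = polyHess A.poly v
  apply : ∀ u, H u = C • (inner ℝ (A.normal j) u • A.normal i + inner ℝ (A.normal i) u • A.normal j)
  symm_apply : ∀ n, H.symm n = -(C * cross (A.normal i) (A.normal j) ^ 2)⁻¹ •
    (cross (A.normal j) n • rot (A.normal i) + cross (A.normal i) n • rot (A.normal j))
  cone : ∀ (s : ℤˣ) (x : Plane), x ∈ A.signCone s v →
    0 < ((s : ℤ) : ℝ) * C * (inner ℝ (A.normal i) (x - v) * inner ℝ (A.normal j) (x - v))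

lemma exists_equiv_apply {a b : Plane} {C : ℝ} (hC : C ≠ 0) (hab : cross a b ≠ 0)
    (T : Plane →L[ℝ] Plane) (hT : ∀ u, T u = C • (inner ℝ b u • a + inner ℝ a u • b)) :
    ∃ H : Plane ≃L[ℝ] Plane, (H : Plane →L[ℝ] Plane) = T ∧ ∀ n, H.symm n =
      -(C * cross a b ^ 2)⁻¹ • (cross b n • rot a + cross a n • rot b) := by
  set B : Plane →L[ℝ] Plane := -(C * cross a b ^ 2)⁻¹ •
    ((innerSL ℝ (rot b)).smulRight (rot a) + (innerSL ℝ (rot a)).smulRight (rot b)) with hB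
  have hBn : ∀ n, B n = -(C * cross a b ^ 2)⁻¹ • (cross b n • rot a + cross a n • rot b) := by
    intro n
    simp [hB, inner_rot]
  have hT1 : ∀ n, T (cross b n • rot a + cross a n • rot b) = -(C * cross a b ^ 2) • n := by
    intro n
    rw [hT]
    ext i
    fin_cases i <;> simp [inner_plane, cross, rot] <;> ring
  have hT2 : ∀ u, cross b (T u) • rot a + cross a (T u) • rot b = -(C * cross a b ^ 2) • u := by
    intro u
    rw [hT]
    ext i
    fin_cases i <;> simp [inner_plane, cross, rot] <;> ring
  have hne : -(C * cross a b ^ 2) ≠ 0 := neg_ne_zero.2 (mul_ne_zero hC (pow_ne_zero 2 hab))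
  refine ⟨ContinuousLinearEquiv.equivOfInverse T B (fun u => ?_) (fun n => ?_), ?_, hBn⟩
  · rw [hBn, hT2, smul_smul, ← inv_neg, inv_mul_cancel₀ hne, one_smul]
  · rw [hBn, map_smul, hT1, smul_smul, ← inv_neg, inv_mul_cancel₀ hne, one_smul]
  · rfl

lemma exists_hessData (hA : A.StronglyGeneric) {i j : Fin d} (hij : i ≠ j) {v : Plane}
    (hi : v ∈ A.line i) (hj : v ∈ A.line j) : ∃ C H, HessData A i j v C H := by
  set Q := ∏ k ∈ (Finset.univ.erase i).erase j, A.linePoly k with hQ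
  have hG : A.poly = A.linePoly i * (A.linePoly j * Q) := by
    rw [A.poly_eq_mul_cofactor i, cofactor, hQ, Finset.mul_prod_erase _ A.linePoly
      (Finset.mem_erase.2 ⟨hij.symm, Finset.mem_univ j⟩)]
  have hC : polyVal Q v ≠ 0 := by
    rw [hQ, polyVal_prod, Finset.prod_ne_zero_iff]
    intro k hk
    rw [Finset.mem_erase, Finset.mem_erase] at hk
    rw [Ne, polyVal_linePoly_eq_zero]
    intro hkv
    have := hA.not_concurrent i j k hij hk.2.1.symm hk.1.symm
    exact Set.notMem_empty v (this ▸ ⟨⟨hi, hj⟩, hkv⟩)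
  have hLi := polyVal_linePoly_eq_zero.2 hi
  have hLj := polyVal_linePoly_eq_zero.2 hj
  have hval : polyVal A.poly v = 0 := by rw [hG, polyVal_mul, hLi, zero_mul]
  have hgrad : polyGrad A.poly v = 0 := by
    rw [hG, polyGrad_mul, polyVal_mul, hLi, hLj]; simp
  have hhess : ∀ u, polyHess A.poly v u = polyVal Q v •
      (inner ℝ (A.normal j) u • A.normal i + inner ℝ (A.normal i) u • A.normal j) := by
    intro u
    rw [hG, polyHess_mul_apply, polyVal_mul, polyGrad_mul, polyHess_linePoly, hLi, hLj,
      polyGrad_linePoly, polyGrad_linePoly]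
    simp only [zero_smul, zero_mul, zero_add, real_inner_smul_left]
    module
  have hcr := cross_normal_ne_zero hA hij
  obtain ⟨H, hH, hHs⟩ := exists_equiv_apply hC hcr _ hhess
  refine ⟨polyVal Q v, H, hij, hi, hj, hC, hcr, hval, hgrad, hH, fun u => ?_, hHs,
    fun s x hx => ?_⟩
  · rw [← hhess, ← hH]; rfl
  · set α := inner ℝ (A.normal i) (x - v) with hα
    set β := inner ℝ (A.normal j) (x - v) with hβ
    have hLt : ∀ (k : Fin d), v ∈ A.line k → ∀ t : ℝ,
        polyVal (A.linePoly k) (v + t • (x - v)) = t * inner ℝ (A.normal k) (x - v) := by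
      intro k hk t
      have : inner ℝ (A.normal k) v = A.level k := hk
      rw [polyVal_linePoly, inner_add_right, real_inner_smul_right, this]; ring
    have hev : ∀ᶠ t : ℝ in 𝓝[>] 0, 0 < ((s : ℤ) : ℝ) * (α * β) * polyVal Q (v + t • (x - v)) := by
      filter_upwards [hx, self_mem_nhdsWithin] with t ht ht0
      rw [hG, polyVal_mul, polyVal_mul, hLt i hi, hLt j hj] at ht
      have ht0' : 0 < t := ht0
      have h1 : ((s : ℤ) : ℝ) * (t * α * (t * β * polyVal Q (v + t • (x - v))))
          = t ^ 2 * (((s : ℤ) : ℝ) * (α * β) * polyVal Q (v + t • (x - v))) := by ring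
      rw [h1] at ht
      exact pos_of_mul_pos_right ht (by positivity)
    have hc : Continuous fun t : ℝ => ((s : ℤ) : ℝ) * (α * β) * polyVal Q (v + t • (x - v)) := by
      fun_prop
    have hlim : Tendsto (fun t : ℝ => ((s : ℤ) : ℝ) * (α * β) * polyVal Q (v + t • (x - v)))
        (𝓝[>] 0) (𝓝 (((s : ℤ) : ℝ) * (α * β) * polyVal Q v)) := by
      have := (hc.tendsto 0).mono_left (nhdsWithin_le_nhds (s := Set.Ioi 0))
      simpa using this
    have h0 : 0 ≤ ((s : ℤ) : ℝ) * (α * β) * polyVal Q v :=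
      ge_of_tendsto hlim (hev.mono fun t ht => ht.le)
    obtain ⟨t, ht⟩ := hev.exists
    have hne := mul_ne_zero (left_ne_zero_of_mul ht.ne') hC
    have : ((s : ℤ) : ℝ) * (α * β) * polyVal Q v = ((s : ℤ) : ℝ) * polyVal Q v * (α * β) := by ring
    rw [← this]
    exact lt_of_le_of_ne h0 hne.symm

namespace HessData

variable {i j : Fin d} {v : Plane} {C : ℝ} {H : Plane ≃L[ℝ] Plane}

lemma inner_symm (h : HessData A i j v C H) (x y : Plane) :
    inner ℝ x (H.symm y) = inner ℝ (H.symm x) y := by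
  rw [h.symm_apply, h.symm_apply, real_inner_smul_left, real_inner_smul_right]
  congr 1
  simp [inner_plane, cross, rot]
  ring

/-- The dual persistent cone in terms of the inverse of the second order part. -/
lemma neg_of_orthogonal (h : HessData A i j v C H) {s : ℤˣ} {x y : Plane} (hxv : x ≠ v)
    (hy : y ∈ A.signCone s v) (hxy : inner ℝ (x - v) (y - v) = 0) :
    ((s : ℤ) : ℝ) * inner ℝ (x - v) (H.symm (x - v)) < 0 := by
  have h1 := h.cone s y hy
  obtain ⟨t, ht⟩ := exists_smul_rot_of_inner_eq_zero (sub_ne_zero.2 hxv) hxy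
  rw [ht, real_inner_smul_right, real_inner_smul_right, real_inner_comm, inner_rot,
    real_inner_comm, inner_rot] at h1
  set n := x - v
  have h2 : inner ℝ n (H.symm n) = -(2 * (C * cross (A.normal i) (A.normal j) ^ 2)⁻¹) *
      (cross n (A.normal i) * cross n (A.normal j)) := by
    rw [h.symm_apply, real_inner_smul_right]
    simp [inner_plane, cross, rot]
    ring
  have hC := h.coeff_ne_zero
  have hD := h.cross_ne_zero
  set D := cross (A.normal i) (A.normal j)
  set X := cross n (A.normal i)
  set Y := cross n (A.normal j)
  have h3 : 0 < ((s : ℤ) : ℝ) * C * (X * Y) := by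
    have : ((s : ℤ) : ℝ) * C * (t * X * (t * Y)) = t ^ 2 * (((s : ℤ) : ℝ) * C * (X * Y)) := by ring
    rw [this] at h1
    exact pos_of_mul_pos_right h1 (by positivity)
  have h4 : ((s : ℤ) : ℝ) * inner ℝ n (H.symm n)
      = -(2 / (C ^ 2 * D ^ 2) * (((s : ℤ) : ℝ) * C * (X * Y))) := by
    rw [h2]; field_simp
  rw [h4, neg_lt_zero]
  positivity

/-- The axes of the two cones at a vertex. -/
lemma exists_axes (h : HessData A i j v C H) {s : ℝ} (hs : s ≠ 0) : ∃ (n : Plane) (a b : ℝ),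
    n ≠ 0 ∧ H n = a • n ∧ H (rot n) = b • rot n ∧ s * a < 0 ∧ 0 < s * b := by
  have hC := h.coeff_ne_zero
  set p := A.normal i with hp
  set q := A.normal j with hq
  have hp0 : 0 < ‖p‖ := norm_pos_iff.2 (A.normal_ne_zero i)
  have hq0 : 0 < ‖q‖ := norm_pos_iff.2 (A.normal_ne_zero j)
  set g := inner ℝ p q with hg
  set M := ‖p‖ * ‖q‖ with hM
  have hM0 : 0 < M := mul_pos hp0 hq0
  have hgM : |g| < M := by
    refine abs_lt_of_sq_lt_sq ?_ hM0.le
    have h1 := inner_sq_add_cross_sq p q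
    have h2 : 0 < cross p q ^ 2 := by have := h.cross_ne_zero; positivity
    linarith
  have hpp : inner ℝ p p = ‖p‖ ^ 2 := real_inner_self_eq_norm_sq p
  have hqq : inner ℝ q q = ‖q‖ ^ 2 := real_inner_self_eq_norm_sq q
  have hqp : inner ℝ q p = g := real_inner_comm _ _
  have key : ∀ e : ℝ, e * e = 1 → H (‖q‖ • p + (e * ‖p‖) • q)
      = (C * (g + e * M)) • (‖q‖ • p + (e * ‖p‖) • q) := by
    intro e he
    have he' : e * M * (e * ‖p‖) = M * ‖p‖ := by
      calc _ = (e * e) * (M * ‖p‖) := by ring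
        _ = _ := by rw [he, one_mul]
    rw [h.apply, inner_add_right, inner_add_right, real_inner_smul_right, real_inner_smul_right,
      real_inner_smul_right, real_inner_smul_right, hpp, hqq, hqp, mul_smul]
    congr 1
    rw [smul_add, smul_smul, smul_smul, add_mul g, add_mul g, he', hM]
    module
  have hor : inner ℝ (‖q‖ • p + ((-1) * ‖p‖) • q) (‖q‖ • p + (1 * ‖p‖) • q) = 0 := by
    simp only [inner_add_left, inner_add_right, real_inner_smul_left, real_inner_smul_right, hpp,
      hqq, hqp, ← hg]
    ring
  have hne : ∀ e : ℝ, e * e = 1 → ‖q‖ • p + (e * ‖p‖) • q ≠ 0 := by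
    intro e he h0
    have h1 : cross p (‖q‖ • p + (e * ‖p‖) • q) = e * ‖p‖ * cross p q := by
      rw [cross_add_right, cross_smul_right, cross_smul_right, cross_self_eq_zero]; ring
    rw [h0] at h1
    have h2 : e ≠ 0 := by rintro rfl; simp at he
    have h3 : cross p 0 = 0 := by simp [cross]
    rw [h3] at h1
    exact (mul_ne_zero (mul_ne_zero h2 hp0.ne') h.cross_ne_zero) h1.symm
  have hrot : ∀ e : ℝ, e * e = 1 → H (rot (‖q‖ • p + (e * ‖p‖) • q))
      = (C * (g + (-e) * M)) • rot (‖q‖ • p + (e * ‖p‖) • q) := by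
    intro e he
    set n := ‖q‖ • p + (e * ‖p‖) • q with hn
    set n' := ‖q‖ • p + ((-e) * ‖p‖) • q with hn'
    have he' : (-e) * (-e) = 1 := by rw [neg_mul_neg, he]
    have hor' : inner ℝ n n' = 0 := by
      simp only [hn, hn', inner_add_left, inner_add_right, real_inner_smul_left,
        real_inner_smul_right, hpp, hqq, hqp, ← hg]
      linear_combination (-(‖p‖ ^ 2 * ‖q‖ ^ 2)) * he
    obtain ⟨t, ht⟩ := exists_smul_rot_of_inner_eq_zero (hne e he) hor'
    have ht0 : t ≠ 0 := by
      rintro rfl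
      exact hne _ he' (by rw [← hn', ht, zero_smul])
    have h1 := key (-e) he'
    rw [← hn', ht, map_smul, smul_comm] at h1
    exact smul_right_injective _ ht0 h1
  have h1 := (abs_lt.1 hgM).1
  have h2 := (abs_lt.1 hgM).2
  rcases (mul_ne_zero hs hC).lt_or_gt with h3 | h3
  · refine ⟨_, _, _, hne 1 (by norm_num), key 1 (by norm_num), hrot 1 (by norm_num), ?_, ?_⟩ <;>
      rw [← mul_assoc] <;> nlinarith
  · refine ⟨_, _, _, hne (-1) (by norm_num), key (-1) (by norm_num), hrot (-1) (by norm_num),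
      ?_, ?_⟩ <;> rw [← mul_assoc] <;> nlinarith

lemma symm_of_eigen (H : Plane ≃L[ℝ] Plane) {n : Plane} {a : ℝ} (ha : a ≠ 0) (h : H n = a • n) :
    H.symm n = a⁻¹ • n := by
  rw [H.symm_apply_eq, map_smul, h, smul_smul, inv_mul_cancel₀ ha, one_smul]

end HessData

lemma units_cast_ne_zero (s : ℤˣ) : ((s : ℤ) : ℝ) ≠ 0 := by exact_mod_cast s.ne_zero

variable (A) in
/-- Near a vertex the critical value has the sign of the merging cone. -/
lemma exists_radius_criticalPos (hA : A.StronglyGeneric) {v : Plane} (hv : v ∈ A.vertices) (s : ℤˣ) :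
    ∃ r₀ > 0, ∀ r, 0 < r → r < r₀ → ∃ η > 0, ∀ᶠ F in A.deformations,
      IsConnected {x ∈ Metric.ball v r | 0 < ((s : ℤ) : ℝ) * polyVal F x} →
        CriticalPos F v η ((s : ℤ) : ℝ) := by
  obtain ⟨i, j, hij, hi, hj⟩ := hv
  obtain ⟨C, H, h⟩ := exists_hessData hA hij hi hj
  obtain ⟨n, a, b, hn, ha, hb, hsa, hsb⟩ := h.exists_axes (units_cast_ne_zero s)
  have hn0 : 0 < ‖n‖ := norm_pos_iff.2 hn
  refine A.critical_value_pos h.val h.grad (y := n) (z := rot n) ?_ ?_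
  · rw [← h.hess]
    change _ * inner ℝ n (H n) < 0
    rw [ha, real_inner_smul_right, real_inner_self_eq_norm_sq, ← mul_assoc]
    exact mul_neg_of_neg_of_pos hsa (by positivity)
  · rw [← h.hess]
    change 0 < _ * inner ℝ (rot n) (H (rot n))
    rw [hb, real_inner_smul_right, real_inner_self_eq_norm_sq, norm_rot, ← mul_assoc]
    positivity

variable (A) in
lemma eventually_vertex_diameter (hA : A.StronglyGeneric) {v : Plane} (hv : v ∈ A.vertices) {η : ℝ}
    (hη : 0 < η) (s : ℤˣ) : ∀ᶠ F in A.deformations, CriticalPos F v η ((s : ℤ) : ℝ) →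
      ∃ p ∈ Metric.ball v η, ∃ q ∈ Metric.ball v η, IsDiameter F p q := by
  obtain ⟨i, j, hij, hi, hj⟩ := hv
  obtain ⟨C, H, h⟩ := exists_hessData hA hij hi hj
  obtain ⟨n, a, b, hn, ha, hb, hsa, hsb⟩ := h.exists_axes (units_cast_ne_zero s)
  have ha0 : a ≠ 0 := by rintro rfl; simp at hsa
  have hb0 : b ≠ 0 := by rintro rfl; simp at hsb
  refine A.eventually_short_diameter h.val h.grad h.hess hn (HessData.symm_of_eigen H ha0 ha)
    (HessData.symm_of_eigen H hb0 hb) ?_ ?_ hη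
  · have h1 : ((s : ℤ) : ℝ) * a⁻¹ = ((s : ℤ) : ℝ) * a * (a⁻¹) ^ 2 := by field_simp
    rw [h1]
    exact mul_neg_of_neg_of_pos hsa (by positivity)
  · intro hab
    have : a = b := inv_injective hab
    rw [this] at hsa
    linarith

variable (A) in
lemma eventually_seeing_diameters (hA : A.StronglyGeneric) {v w : Plane} (hv : v ∈ A.vertices)
    (hw : w ∈ A.vertices) (hvw : v ≠ w) {s s' : ℤˣ}
    (hs : ∃ y ∈ A.signCone s v, inner ℝ (w - v) (y - v) = 0)
    (hs' : ∃ y ∈ A.signCone s' w, inner ℝ (v - w) (y - w) = 0) {η : ℝ} (hη : 0 < η) :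
    ∀ᶠ F in A.deformations, CriticalPos F v η ((s : ℤ) : ℝ) → CriticalPos F w η ((s' : ℤ) : ℝ) →
      ∀ a b : ℝ, a * a = 1 → b * b = 1 → ∃ p ∈ Metric.ball v η, ∃ q ∈ Metric.ball w η,
        IsDiameter F p q ∧ 0 < a * inner ℝ (polyGrad F p) (w - v) ∧
          0 < b * inner ℝ (polyGrad F q) (w - v) := by
  obtain ⟨i, j, hij, hi, hj⟩ := hv
  obtain ⟨C, H, h⟩ := exists_hessData hA hij hi hj
  obtain ⟨i', j', hij', hi', hj'⟩ := hw
  obtain ⟨C', H', h'⟩ := exists_hessData hA hij' hi' hj'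
  obtain ⟨y, hy, hyo⟩ := hs
  obtain ⟨y', hy', hyo'⟩ := hs'
  refine A.eventually_diameters_of_seeing h.val h.grad h.hess h'.val h'.grad h'.hess
    (h.neg_of_orthogonal hvw.symm hy hyo) ?_ hη
  have h1 := h'.neg_of_orthogonal hvw hy' hyo'
  have h2 : v - w = -(w - v) := by abel
  rwa [h2, map_neg, inner_neg_neg] at h1

lemma IsAltitude.ne {v f : Plane} {k : Fin d} (hvk : v ∉ A.line k) (hf : f ∈ A.line k) : f ≠ v :=
  fun h => hvk (h ▸ hf)

lemma add_rot_mem_line {k : Fin d} {f : Plane} (hf : f ∈ A.line k) (t : ℝ) :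
    f + t • rot (A.normal k) ∈ A.line k := by
  have hf : inner ℝ (A.normal k) f = A.level k := hf
  change inner ℝ (A.normal k) _ = _
  rw [inner_add_right, real_inner_smul_right, inner_rot_self, hf, mul_zero, add_zero]

/-- An altitude is parallel to the normal of the line on which it ends. -/
lemma exists_smul_normal {v f : Plane} {k : Fin d} (hvk : v ∉ A.line k) (hf : f ∈ A.line k)
    (hperp : ∀ x ∈ A.line k, inner ℝ (f - v) (x - f) = 0) :
    ∃ c : ℝ, c ≠ 0 ∧ f - v = c • A.normal k := by
  have h1 := hperp _ (add_rot_mem_line hf 1)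
  rw [one_smul, add_sub_cancel_left, real_inner_comm, inner_rot] at h1
  obtain ⟨c, hc⟩ := exists_smul_of_cross_eq_zero (A.normal_ne_zero k) h1
  refine ⟨c, ?_, hc⟩
  rintro rfl
  rw [zero_smul, sub_eq_zero] at hc
  exact hvk (hc ▸ hf)

variable (A) in
lemma eventually_altitude_diameters (hA : A.StronglyGeneric) {v f : Plane} (hvf : A.IsAltitude v f)
    {s s' : ℤˣ} (hs : ∃ y ∈ A.signCone s v, inner ℝ (f - v) (y - v) = 0) {η : ℝ} (hη : 0 < η) :
    ∀ᶠ F in A.deformations, CriticalPos F v η ((s : ℤ) : ℝ) →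
      (f ∈ A.vertices → CriticalPos F f η ((s' : ℤ) : ℝ)) →
        ∀ a : ℝ, a * a = 1 → ∃ p ∈ Metric.ball v η, ∃ q ∈ Metric.ball f η,
          IsDiameter F p q ∧ 0 < a * inner ℝ (polyGrad F p) (f - v) := by
  obtain ⟨⟨i, j, hij, hi, hj⟩, k, hvk, hfk, hperp⟩ := hvf
  obtain ⟨C, H, h⟩ := exists_hessData hA hij hi hj
  obtain ⟨y, hy, hyo⟩ := hs
  have hfv : f ≠ v := IsAltitude.ne hvk hfk
  obtain ⟨c, hc, hfc⟩ := exists_smul_normal hvk hfk hperp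
  have hmem : ∀ t : ℝ, f + t • rot (f - v) ∈ A.line k := fun t => by
    rw [hfc, rot_smul, smul_smul]; exact add_rot_mem_line hfk _
  have hgr : ∀ t : ℝ, polyGrad A.poly (f + t • rot (f - v))
      = (polyVal (A.cofactor k) (f + t • rot (f - v)) * c⁻¹) • (f - v) := fun t => by
    have h1 : A.normal k = c⁻¹ • (f - v) := by
      rw [hfc, smul_smul, inv_mul_cancel₀ hc, one_smul]
    rw [polyGrad_poly_of_mem_line (hmem t), h1, smul_smul]
  refine A.eventually_diameters_of_footArc h.val h.grad h.hess (h.neg_of_orthogonal hfv hy hyo)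
    (Q := fun F η => f ∈ A.vertices → CriticalPos F f η ((s' : ℤ) : ℝ))
    (fun F η₁ η₂ h12 hQ hf z hz => hQ hf z (Metric.ball_subset_ball h12 hz))
    (fun κ hκ η hη => ?_) hη
  by_cases hreg : ∀ m, m ≠ k → f ∉ A.line m
  · obtain ⟨η', hη', hev⟩ := A.eventually_footArc_of_regular (v := v) (f := f)
      (l := polyVal (A.cofactor k) f * c⁻¹) (sub_ne_zero.2 hfv)
      (mul_ne_zero (polyVal_cofactor_ne_zero hreg) (inv_ne_zero hc)) rfl
      (by simpa using hgr 0) (fun t => polyVal_poly_of_mem_line (hmem t)) hgr hκ hη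
    exact ⟨η', hη', hev.mono fun F hF _ => hF⟩
  · push Not at hreg
    obtain ⟨m, hmk, hfm⟩ := hreg
    have hfv' : f ∈ A.vertices := ⟨k, m, hmk.symm, hfk, hfm⟩
    obtain ⟨C', H', h'⟩ := exists_hessData hA hmk.symm hfk hfm
    have hcr := h'.cross_ne_zero
    obtain ⟨η', hη', hev⟩ := A.eventually_footArc_of_vertex (v := v) (w := f) h'.val h'.grad h'.hess
      h'.inner_symm (β := -(C' * cross (A.normal k) (A.normal m) ^ 2)⁻¹ *
        cross (A.normal m) (A.normal k)) (sub_ne_zero.2 hfv)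
      (mul_ne_zero (neg_ne_zero.2 (inv_ne_zero (mul_ne_zero h'.coeff_ne_zero (pow_ne_zero 2 hcr))))
        (cross_normal_ne_zero hA hmk)) (units_cast_ne_zero s') rfl
      (by
        rw [h'.symm_apply, hfc, rot_smul, cross_smul_right, cross_smul_right, cross_self_eq_zero,
          mul_zero, zero_smul, add_zero]
        module) (fun t => polyVal_poly_of_mem_line (hmem t)) hgr hκ hη
    exact ⟨η', hη', hev.mono fun F hF hQ => hF (hQ hfv')⟩

end LineArrangement

namespace LineArrangement

variable {d : ℕ} {A : LineArrangement d}

lemma exists_mem_line_inter (hA : A.StronglyGeneric) {i j : Fin d} (hij : i ≠ j) :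
    ∃ x, x ∈ A.line i ∧ x ∈ A.line j := by
  have hD := cross_normal_ne_zero hA hij
  refine ⟨(cross (A.normal i) (A.normal j))⁻¹ •
    (A.level j • rot (A.normal i) - A.level i • rot (A.normal j)), ?_, ?_⟩
  · change inner ℝ (A.normal i) _ = _
    rw [real_inner_smul_right, inner_sub_right, real_inner_smul_right, real_inner_smul_right,
      inner_rot_self, real_inner_comm, inner_rot, inv_mul_eq_iff_eq_mul₀ hD]
    simp only [cross]; ring
  · change inner ℝ (A.normal j) _ = _
    rw [real_inner_smul_right, inner_sub_right, real_inner_smul_right, real_inner_smul_right,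
      inner_rot_self, real_inner_comm, inner_rot, inv_mul_eq_iff_eq_mul₀ hD]
    ring

/-- There are at least as many vertices as pairs of lines. -/
lemma choose_two_le_encard_vertices (hA : A.StronglyGeneric) :
    (d.choose 2 : ℕ∞) ≤ A.vertices.encard := by
  have hex : ∀ z : {z : Sym2 (Fin d) // ¬z.IsDiag}, ∃ x, ∀ i ∈ z.1, x ∈ A.line i := by
    rintro ⟨z, hz⟩
    induction z using Sym2.ind with
    | _ i j =>
      obtain ⟨x, hi, hj⟩ := exists_mem_line_inter hA (i := i) (j := j) (by simpa using hz)
      refine ⟨x, fun k hk => ?_⟩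
      rcases Sym2.mem_iff.1 hk with rfl | rfl
      · exact hi
      · exact hj
  choose p hp using hex
  have hv : ∀ z, p z ∈ A.vertices := by
    rintro ⟨z, hz⟩
    induction z using Sym2.ind with
    | _ i j =>
      exact ⟨i, j, by simpa using hz, hp _ i (Sym2.mem_mk_left i j), hp _ j (Sym2.mem_mk_right i j)⟩
  have hinj : Function.Injective fun z => (⟨p z, hv z⟩ : A.vertices) := by
    intro z z' hzz
    have hpp : p z = p z' := congrArg Subtype.val hzz
    by_contra hne
    obtain ⟨k, hk, hkz⟩ : ∃ k ∈ z'.1, k ∉ z.1 := by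
      by_contra! hsub
      refine hne (Subtype.ext ?_)
      obtain ⟨z', hz'⟩ := z'
      induction z' using Sym2.ind with
      | _ i j =>
        exact (Sym2.mem_and_mem_iff (by simpa using hz')).1
          ⟨hsub i (Sym2.mem_mk_left i j), hsub j (Sym2.mem_mk_right i j)⟩
    have hpk := hp z' k hk
    rw [← hpp] at hpk
    obtain ⟨z, hz⟩ := z
    induction z using Sym2.ind with
    | _ i j =>
      have hki : k ≠ i := fun h => hkz (h ▸ Sym2.mem_mk_left i j)
      have hkj : k ≠ j := fun h => hkz (h ▸ Sym2.mem_mk_right i j)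
      have hmem : p ⟨s(i, j), hz⟩ ∈ A.line i ∩ A.line j ∩ A.line k :=
        ⟨⟨hp _ i (Sym2.mem_mk_left i j), hp _ j (Sym2.mem_mk_right i j)⟩, hpk⟩
      rw [hA.not_concurrent i j k (by simpa using hz) hki.symm hkj.symm] at hmem
      exact hmem
  have h1 := ENat.card_le_card_of_injective hinj
  rwa [ENat.card_eq_coe_fintype_card, Sym2.card_subtype_not_diag, Fintype.card_fin,
    ENat.card_coe_set_eq] at h1

lemma finite_vertices (hA : A.StronglyGeneric) : A.vertices.Finite := by
  have h : A.vertices ⊆ ⋃ p : Fin d × Fin d, {v | p.1 ≠ p.2 ∧ v ∈ A.line p.1 ∧ v ∈ A.line p.2} := by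
    rintro v ⟨i, j, h⟩
    exact Set.mem_iUnion.2 ⟨(i, j), h⟩
  refine (Set.finite_iUnion fun p => Set.Subsingleton.finite ?_).subset h
  rintro v ⟨hne, h1, h2⟩ w ⟨-, h3, h4⟩
  have h1 : inner ℝ (A.normal p.1) v = A.level p.1 := h1
  have h2 : inner ℝ (A.normal p.2) v = A.level p.2 := h2
  have h3 : inner ℝ (A.normal p.1) w = A.level p.1 := h3
  have h4 : inner ℝ (A.normal p.2) w = A.level p.2 := h4
  obtain ⟨t, ht⟩ := exists_smul_rot_of_inner_eq_zero (A.normal_ne_zero p.1)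
    (u := v - w) (by rw [inner_sub_right, h1, h3, sub_self])
  have h5 : inner ℝ (A.normal p.2) (v - w) = 0 := by rw [inner_sub_right, h2, h4, sub_self]
  rw [ht, real_inner_smul_right, real_inner_comm, inner_rot] at h5
  have ht0 := (mul_eq_zero.1 h5).resolve_right (cross_normal_ne_zero hA hne)
  rw [ht0, zero_smul, sub_eq_zero] at ht
  exact ht

lemma finite_altitudes (hA : A.StronglyGeneric) :
    {α : Plane × Plane | A.IsAltitude α.1 α.2}.Finite := by
  refine (((finite_vertices hA).prod (Set.finite_univ (α := Fin d))).image fun p => (p.1, p.1 +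
    ((A.level p.2 - inner ℝ (A.normal p.2) p.1) / ‖A.normal p.2‖ ^ 2) • A.normal p.2)).subset ?_
  rintro ⟨v, f⟩ ⟨hv, k, hvk, hfk, hperp⟩
  obtain ⟨c, -, hc⟩ := exists_smul_normal hvk hfk hperp
  refine ⟨(v, k), ⟨hv, Set.mem_univ k⟩, Prod.ext rfl ?_⟩
  have hn : ‖A.normal k‖ ^ 2 ≠ 0 := pow_ne_zero 2 (norm_ne_zero_iff.2 (A.normal_ne_zero k))
  have hfk : inner ℝ (A.normal k) f = A.level k := hfk
  have h1 : A.level k - inner ℝ (A.normal k) v = c * ‖A.normal k‖ ^ 2 := by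
    rw [← hfk, ← inner_sub_right]
    change inner ℝ (A.normal k) (f - v) = _
    rw [show f - v = c • A.normal k from hc, real_inner_smul_right, real_inner_self_eq_norm_sq]
  change v + ((A.level k - inner ℝ (A.normal k) v) / ‖A.normal k‖ ^ 2) • A.normal k = f
  rw [h1, mul_div_cancel_right₀ _ hn, ← show f - v = c • A.normal k from hc]
  abel

/-- The foot of an altitude does not see the vertex from which the altitude starts. -/
lemma IsAltitude.not_seen {v f : Plane} (h : A.IsAltitude v f) (σ : Plane → ℤˣ) :
    v ∉ A.dualPersistentCone σ f := by
  rintro ⟨y, hy, hvy⟩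
  obtain ⟨-, k, hvk, hfk, hperp⟩ := h
  obtain ⟨c, hc, hfc⟩ := exists_smul_normal hvk hfk hperp
  have hvf : v - f = (-c) • A.normal k := by rw [neg_smul, ← hfc]; abel
  rw [hvf, real_inner_smul_left, mul_eq_zero, neg_eq_zero] at hvy
  have h1 := hvy.resolve_left hc
  have hy : ∀ᶠ t : ℝ in 𝓝[>] 0, 0 < ((σ f : ℤ) : ℝ) * polyVal A.poly (f + t • (y - f)) := hy
  obtain ⟨t, ht⟩ := hy.exists
  have hfk' : inner ℝ (A.normal k) f = A.level k := hfk
  have hmem : f + t • (y - f) ∈ A.line k := by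
    change inner ℝ (A.normal k) _ = _
    rw [inner_add_right, real_inner_smul_right, h1, hfk', mul_zero, add_zero]
  rw [polyVal_poly_of_mem_line hmem, mul_zero] at ht
  exact ht.false

/-- An altitude is not an altitude when it is reversed. -/
lemma IsAltitude.not_swap (hA : A.StronglyGeneric) {v f : Plane} (h : A.IsAltitude v f) :
    ¬A.IsAltitude f v := by
  rintro ⟨-, k', hvk', hfk', hperp'⟩
  obtain ⟨-, k, hvk, hfk, hperp⟩ := h
  obtain ⟨c, hc, hfc⟩ := exists_smul_normal hvk hfk hperp
  obtain ⟨c', hc', hfc'⟩ := exists_smul_normal hvk' hfk' hperp'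
  have hkk : k ≠ k' := by rintro rfl; exact hvk hfk'
  have h1 : c • A.normal k = (-c') • A.normal k' := by rw [← hfc, neg_smul, ← hfc']; abel
  have h2 := cross_smul_left c (A.normal k) (A.normal k')
  rw [h1, cross_smul_left, cross_self_eq_zero, mul_zero] at h2
  exact mul_ne_zero hc (cross_normal_ne_zero hA hkk) h2.symm

end LineArrangement

/-- Two chords that are equal have the same pair of centres. -/
lemma eq_of_sym2_eq_of_near {S : Set Plane} {η : ℝ}
    (hS : ∀ x ∈ S, ∀ y ∈ S, x ≠ y → 2 * η ≤ dist x y) {x y x' y' p q p' q' : Plane} (hx : x ∈ S)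
    (hy : y ∈ S) (hx' : x' ∈ S) (hy' : y' ∈ S) (hp : p ∈ Metric.ball x η)
    (hq : q ∈ Metric.ball y η) (hp' : p' ∈ Metric.ball x' η) (hq' : q' ∈ Metric.ball y' η)
    (h : s(p, q) = s(p', q')) :
    (x = x' ∧ y = y' ∧ p = p' ∧ q = q') ∨ (x = y' ∧ y = x' ∧ p = q' ∧ q = p') := by
  have key : ∀ {x y p : Plane}, x ∈ S → y ∈ S → p ∈ Metric.ball x η → p ∈ Metric.ball y η →
      x = y := by
    intro x y p hx hy h1 h2
    by_contra hne
    have h3 := hS x hx y hy hne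
    rw [Metric.mem_ball] at h1 h2
    linarith [dist_triangle_left x y p]
  rcases Sym2.eq_iff.1 h with ⟨rfl, rfl⟩ | ⟨rfl, rfl⟩
  · exact Or.inl ⟨key hx hx' hp hp', key hy hy' hq hq', rfl, rfl⟩
  · exact Or.inr ⟨key hx hy' hp hq', key hy hx' hq hp', rfl, rfl⟩

lemma exists_separation {S : Set Plane} (hS : S.Finite) :
    ∀ᶠ η in 𝓝[>] (0 : ℝ), ∀ x ∈ S, ∀ y ∈ S, x ≠ y → 2 * η ≤ dist x y := by
  rw [eventually_all_finite hS]
  intro x _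
  rw [eventually_all_finite hS]
  intro y _
  by_cases hxy : x = y
  · exact Eventually.of_forall fun _ h => absurd hxy h
  · filter_upwards [Ioo_mem_nhdsGT (half_pos (dist_pos.2 hxy))] with η hη _
    linarith [hη.2]

lemma units_mul_self_cast (a : ℤˣ) : ((a : ℤ) : ℝ) * ((a : ℤ) : ℝ) = 1 := by
  rcases Int.units_eq_one_or a with rfl | rfl <;> simp

lemma units_eq_of_mul_pos {a b : ℤˣ} {x : ℝ} (ha : 0 < ((a : ℤ) : ℝ) * x)
    (hb : 0 < ((b : ℤ) : ℝ) * x) : a = b := by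
  rcases Int.units_eq_one_or a with rfl | rfl <;> rcases Int.units_eq_one_or b with rfl | rfl <;>
    first
    | rfl
    | (exfalso; simp at ha hb; linarith)

namespace LineArrangement

variable {d : ℕ} {A : LineArrangement d}

/-- The diameters near the vertices, near the admissible altitudes and near the pairs of vertices
that see each other are distinct. -/
lemma encard_le_of_near (hA : A.StronglyGeneric) {σ : Plane → ℤˣ} {F : MvPolynomial (Fin 2) ℝ}
    {η : ℝ} {S : Set Plane} (hS : ∀ x ∈ S, ∀ y ∈ S, x ≠ y → 2 * η ≤ dist x y)
    (hSv : A.vertices ⊆ S) (hSf : ∀ v f, A.IsAltitude v f → f ∈ S)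
    (hver : ∀ v ∈ A.vertices, ∃ p ∈ Metric.ball v η, ∃ q ∈ Metric.ball v η, IsDiameter F p q)
    (halt : ∀ α ∈ A.admissibleAltitudes σ, ∀ a : ℤˣ, ∃ p ∈ Metric.ball α.1 η,
      ∃ q ∈ Metric.ball α.2 η, IsDiameter F p q ∧
        0 < ((a : ℤ) : ℝ) * inner ℝ (polyGrad F p) (α.2 - α.1))
    (hsee : ∀ v ∈ A.vertices, ∀ w ∈ A.vertices, v ≠ w → w ∈ A.dualPersistentCone σ v →
      v ∈ A.dualPersistentCone σ w → ∀ a b : ℤˣ, ∃ p ∈ Metric.ball v η, ∃ q ∈ Metric.ball w η,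
        IsDiameter F p q ∧ 0 < ((a : ℤ) : ℝ) * inner ℝ (polyGrad F p) (w - v) ∧
          0 < ((b : ℤ) : ℝ) * inner ℝ (polyGrad F q) (w - v)) :
    (d.choose 2 : ℕ∞) + 2 * (A.admissibleAltitudes σ).encard + 4 * (A.seeingPairs σ).encard
      ≤ (diameters F).encard := by
  choose pv hpv qv hqv hdv using fun v : A.vertices => hver v.1 v.2
  choose pa hpa qa hqa hda hsa using fun (α : A.admissibleAltitudes σ) => halt α.1 α.2
  choose v w hz hvw hv hw hwv hvw' using fun z : A.seeingPairs σ => z.2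
  choose ps hps qs hqs hds hsp hsq using fun z : A.seeingPairs σ =>
    hsee (v z) (hv z) (w z) (hw z) (hvw z) (hwv z) (hvw' z)
  have hav : ∀ α : A.admissibleAltitudes σ, α.1.1 ∈ S := fun α => hSv α.2.1.1
  have haf : ∀ α : A.admissibleAltitudes σ, α.1.2 ∈ S := fun α => hSf _ _ α.2.1
  have hane : ∀ α : A.admissibleAltitudes σ, α.1.2 ≠ α.1.1 := fun α => by
    obtain ⟨-, k, hvk, hfk, -⟩ := α.2.1
    exact IsAltitude.ne hvk hfk
  have hvertex_alt : ∀ (x : A.vertices) (α : A.admissibleAltitudes σ) (a : ℤˣ),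
      s(pv x, qv x) ≠ s(pa α a, qa α a) := fun x α a h => by
    rcases eq_of_sym2_eq_of_near hS (hSv x.2) (hSv x.2) (hav α) (haf α) (hpv x) (hqv x) (hpa α a)
      (hqa α a) h with ⟨h1, h2, -⟩ | ⟨h1, h2, -⟩
    · exact hane α (h2.symm.trans h1)
    · exact hane α (h1.symm.trans h2)
  have hvertex_see : ∀ (x : A.vertices) (z : A.seeingPairs σ) (a b : ℤˣ),
      s(pv x, qv x) ≠ s(ps z a b, qs z a b) := fun x z a b h => by
    rcases eq_of_sym2_eq_of_near hS (hSv x.2) (hSv x.2) (hSv (hv z)) (hSv (hw z)) (hpv x) (hqv x)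
      (hps z a b) (hqs z a b) h with ⟨h1, h2, -⟩ | ⟨h1, h2, -⟩
    · exact hvw z (h1.symm.trans h2)
    · exact hvw z (h2.symm.trans h1)
  have halt_see : ∀ (α : A.admissibleAltitudes σ) (z : A.seeingPairs σ) (e a b : ℤˣ),
      s(pa α e, qa α e) ≠ s(ps z a b, qs z a b) := fun α z e a b h => by
    rcases eq_of_sym2_eq_of_near hS (hav α) (haf α) (hSv (hv z)) (hSv (hw z)) (hpa α e) (hqa α e)
      (hps z a b) (hqs z a b) h with ⟨h1, h2, -⟩ | ⟨h1, h2, -⟩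
    · exact α.2.1.not_seen σ (by rw [h1, h2]; exact hvw' z)
    · exact α.2.1.not_seen σ (by rw [h1, h2]; exact hwv z)
  let Φ : A.vertices ⊕ (A.admissibleAltitudes σ × ℤˣ) ⊕ (A.seeingPairs σ × ℤˣ × ℤˣ) → diameters F :=
    Sum.elim (fun x => ⟨s(pv x, qv x), _, _, rfl, hdv x⟩)
      (Sum.elim (fun α => ⟨s(pa α.1 α.2, qa α.1 α.2), _, _, rfl, hda α.1 α.2⟩)
        (fun z => ⟨s(ps z.1 z.2.1 z.2.2, qs z.1 z.2.1 z.2.2), _, _, rfl, hds z.1 z.2.1 z.2.2⟩))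
  have hΦ : Function.Injective Φ := by
    rintro (x | ⟨α, a⟩ | ⟨z, a, b⟩) (x' | ⟨α', a'⟩ | ⟨z', a', b'⟩) h <;>
      replace h := congrArg Subtype.val h
    · rcases eq_of_sym2_eq_of_near hS (hSv x.2) (hSv x.2) (hSv x'.2) (hSv x'.2) (hpv x) (hqv x)
        (hpv x') (hqv x') h with ⟨h1, -⟩ | ⟨h1, -⟩ <;> rw [Subtype.ext h1]
    · exact absurd h (hvertex_alt _ _ _)
    · exact absurd h (hvertex_see _ _ _ _)
    · exact absurd h.symm (hvertex_alt _ _ _)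
    · rcases eq_of_sym2_eq_of_near hS (hav α) (haf α) (hav α') (haf α') (hpa α a) (hqa α a)
        (hpa α' a') (hqa α' a') h with ⟨h1, h2, h3, -⟩ | ⟨h1, h2, -⟩
      · obtain rfl : α = α' := Subtype.ext (Prod.ext h1 h2)
        have h4 := hsa α a
        rw [h3] at h4
        rw [units_eq_of_mul_pos h4 (hsa α a')]
      · refine absurd ?_ (α.2.1.not_swap hA)
        rw [h1, h2]
        exact α'.2.1
    · exact absurd h (halt_see _ _ _ _ _)
    · exact absurd h.symm (hvertex_see _ _ _ _)
    · exact absurd h.symm (halt_see _ _ _ _ _)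
    · have hcases := eq_of_sym2_eq_of_near hS (hSv (hv z)) (hSv (hw z)) (hSv (hv z')) (hSv (hw z'))
        (hps z a b) (hqs z a b) (hps z' a' b') (hqs z' a' b') h
      have hzz : z = z' := by
        refine Subtype.ext ?_
        rw [hz z, hz z']
        rcases hcases with ⟨h1, h2, -⟩ | ⟨h1, h2, -⟩
        · rw [h1, h2]
        · rw [h1, h2, Sym2.eq_swap]
      subst hzz
      rcases hcases with ⟨-, -, h3, h4⟩ | ⟨h1, -⟩
      · have h5 := hsp z a b
        have h6 := hsq z a b
        rw [h3] at h5
        rw [h4] at h6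
        rw [units_eq_of_mul_pos h5 (hsp z a' b'), units_eq_of_mul_pos h6 (hsq z a' b')]
      · exact absurd h1 (hvw z)
  have hcard := ENat.card_le_card_of_injective hΦ
  have hu : ENat.card ℤˣ = 2 := by rw [ENat.card_eq_coe_fintype_card]; rfl
  rw [ENat.card_sum, ENat.card_sum, ENat.card_prod, ENat.card_prod, ENat.card_prod, hu,
    ENat.card_coe_set_eq, ENat.card_coe_set_eq, ENat.card_coe_set_eq, ENat.card_coe_set_eq] at hcard
  refine le_trans ?_ hcard
  rw [add_assoc]
  refine add_le_add (choose_two_le_encard_vertices hA) (le_of_eq ?_)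
  rw [mul_comm 2, mul_comm 4]
  norm_num

end LineArrangement

end

/-- For all sufficiently small discs about the vertices, and all deformations of the same degree that
are sufficiently small with respect to these discs and that resolve all the vertices. -/
theorem mainTheorem5 (d : ℕ) (A : LineArrangement d) (hA : A.StronglyGeneric) :
    ∃ r₀ : ℝ, 0 < r₀ ∧ ∀ r : ℝ, 0 < r → r < r₀ → ∃ δ : ℝ, 0 < δ ∧
      ∀ (F : MvPolynomial (Fin 2) ℝ) (σ : Plane → ℤˣ),
        A.IsDeformation δ F → A.Realizes σ r F →
          (d.choose 2 : ℕ∞) + 2 * (A.admissibleAltitudes σ).encard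
              + 4 * (A.seeingPairs σ).encard
            ≤ (diameters F).encard := by
  have hV := LineArrangement.finite_vertices hA
  have hAlt := LineArrangement.finite_altitudes hA
  set S : Set Plane := A.vertices ∪ Prod.snd '' {α : Plane × Plane | A.IsAltitude α.1 α.2} with hS
  have hSfin : S.Finite := hV.union (hAlt.image _)
  have hr₀ : ∀ᶠ r₀ in 𝓝[>] (0 : ℝ), ∀ v ∈ A.vertices, ∀ s : ℤˣ, ∀ r, 0 < r → r < r₀ →
      ∃ η > 0, ∀ᶠ F in A.deformations,
        IsConnected {x ∈ Metric.ball v r | 0 < ((s : ℤ) : ℝ) * polyVal F x} →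
          CriticalPos F v η ((s : ℤ) : ℝ) := by
    rw [Filter.eventually_all_finite hV]
    intro v hv
    rw [Filter.eventually_all]
    intro s
    obtain ⟨r₀, hr₀, h⟩ := A.exists_radius_criticalPos hA hv s
    filter_upwards [Ioo_mem_nhdsGT hr₀] with r₁ hr₁ r hr hrr
    exact h r hr (hrr.trans hr₁.2)
  obtain ⟨r₀, hcrit, hr₀⟩ := (hr₀.and self_mem_nhdsWithin).exists
  refine ⟨r₀, hr₀, fun r hr hrr => ?_⟩
  have hη : ∀ᶠ η in 𝓝[>] (0 : ℝ), ∀ v ∈ A.vertices, ∀ s : ℤˣ, ∀ᶠ F in A.deformations,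
      IsConnected {x ∈ Metric.ball v r | 0 < ((s : ℤ) : ℝ) * polyVal F x} →
        CriticalPos F v η ((s : ℤ) : ℝ) := by
    rw [Filter.eventually_all_finite hV]
    intro v hv
    rw [Filter.eventually_all]
    intro s
    obtain ⟨η₀, hη₀, h⟩ := hcrit v hv s r hr hrr
    filter_upwards [Ioo_mem_nhdsGT hη₀] with η hη
    filter_upwards [h] with F hF hconn c hc
    exact hF hconn c (Metric.ball_subset_ball hη.2.le hc)
  obtain ⟨η, ⟨hηcrit, hsep⟩, hη0⟩ :=
    ((hη.and (exists_separation hSfin)).and self_mem_nhdsWithin).exists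
  have hη0 : 0 < η := hη0
  have hev1 : ∀ᶠ F in A.deformations, ∀ v ∈ A.vertices, ∀ s : ℤˣ,
      IsConnected {x ∈ Metric.ball v r | 0 < ((s : ℤ) : ℝ) * polyVal F x} →
        CriticalPos F v η ((s : ℤ) : ℝ) := by
    simp only [Filter.eventually_all_finite hV, Filter.eventually_all]
    exact hηcrit
  have hev2 : ∀ᶠ F in A.deformations, ∀ v ∈ A.vertices, ∀ s : ℤˣ,
      CriticalPos F v η ((s : ℤ) : ℝ) →
        ∃ p ∈ Metric.ball v η, ∃ q ∈ Metric.ball v η, IsDiameter F p q := by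
    simp only [Filter.eventually_all_finite hV, Filter.eventually_all]
    exact fun v hv s => A.eventually_vertex_diameter hA hv hη0 s
  have hev3 : ∀ᶠ F in A.deformations, ∀ α ∈ {α : Plane × Plane | A.IsAltitude α.1 α.2},
      ∀ s s' : ℤˣ, (∃ y ∈ A.signCone s α.1, inner ℝ (α.2 - α.1) (y - α.1) = 0) →
        CriticalPos F α.1 η ((s : ℤ) : ℝ) →
        (α.2 ∈ A.vertices → CriticalPos F α.2 η ((s' : ℤ) : ℝ)) →
        ∀ a : ℝ, a * a = 1 → ∃ p ∈ Metric.ball α.1 η, ∃ q ∈ Metric.ball α.2 η,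
          IsDiameter F p q ∧ 0 < a * inner ℝ (polyGrad F p) (α.2 - α.1) := by
    rw [Filter.eventually_all_finite hAlt]
    intro α hα
    rw [Filter.eventually_all]
    intro s
    rw [Filter.eventually_all]
    intro s'
    rw [Filter.eventually_imp_distrib_left]
    exact fun hs => A.eventually_altitude_diameters hA hα hs hη0
  have hev4 : ∀ᶠ F in A.deformations, ∀ v ∈ A.vertices, ∀ w ∈ A.vertices, ∀ s s' : ℤˣ, v ≠ w →
      (∃ y ∈ A.signCone s v, inner ℝ (w - v) (y - v) = 0) →
      (∃ y ∈ A.signCone s' w, inner ℝ (v - w) (y - w) = 0) →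
      CriticalPos F v η ((s : ℤ) : ℝ) → CriticalPos F w η ((s' : ℤ) : ℝ) →
      ∀ a b : ℝ, a * a = 1 → b * b = 1 → ∃ p ∈ Metric.ball v η, ∃ q ∈ Metric.ball w η,
        IsDiameter F p q ∧ 0 < a * inner ℝ (polyGrad F p) (w - v) ∧
          0 < b * inner ℝ (polyGrad F q) (w - v) := by
    rw [Filter.eventually_all_finite hV]
    intro v hv
    rw [Filter.eventually_all_finite hV]
    intro w hw
    rw [Filter.eventually_all]
    intro s
    rw [Filter.eventually_all]
    intro s'
    rw [Filter.eventually_imp_distrib_left]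
    intro hvw
    rw [Filter.eventually_imp_distrib_left]
    intro hs
    rw [Filter.eventually_imp_distrib_left]
    intro hs'
    exact A.eventually_seeing_diameters hA hv hw hvw hs hs' hη0
  obtain ⟨δ, hδ, hF⟩ := A.eventually_deformations.1 (hev1.and (hev2.and (hev3.and hev4)))
  refine ⟨δ, hδ, fun F σ hdef hreal => ?_⟩
  obtain ⟨h1, h2, h3, h4⟩ := hF F hdef
  have hpos : ∀ v ∈ A.vertices, CriticalPos F v η ((σ v : ℤ) : ℝ) := fun v hv =>
    h1 v hv (σ v) (hreal v hv)
  refine LineArrangement.encard_le_of_near hA hsep Set.subset_union_left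
    (fun v f h => Or.inr ⟨(v, f), h, rfl⟩) (fun v hv => h2 v hv (σ v) (hpos v hv))
    (fun α hα a => ?_) (fun v hv w hw hvw hwv hvw' a b => ?_)
  · exact h3 α hα.1 (σ α.1) (σ α.2) (hα.2 (right_mem_segment ℝ _ _)) (hpos _ hα.1.1)
      (fun h => hpos _ h) _ (units_mul_self_cast a)
  · exact h4 v hv w hw (σ v) (σ w) hvw hwv hvw' (hpos v hv) (hpos w hw) _ _ (units_mul_self_cast a)
      (units_mul_self_cast b)
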